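/- **Setting.** Let $X\subset\mathbb R^D$ be finite and non-empty (solutions) and $A\subset\mathbb R^J$ compact (parameters), and write $Z=X\times A$. Let $S=\{1,\dots,N_s\}$ be a set of data sources. Running the simulator costs $c_f>0$, querying source $s$ costs $c_s>0$. *Target function.* $\theta:Z\to\mathbb R$ is a Gaussian process with continuous sample paths, continuous mean function $\mu^0$ and continuous covariance function $k^0$. A simulation run at $z\in Z$ returns $y\sim N(\theta(z),\sigma_\epsilon^2)$, with $\sigma_\epsilon^2\ge 0$ known. *Parameter.* The true parameter $a^*$ has a prior probability distribution $\mathbb P[a]$ on $A$ (for example the uniform one) and is independent of $\theta$. Querying source $s$ returns $r\sim\mathbb P[r\mid a^*,s]$, where $\mathbb P[r\mid a,s]$ is a jointly measurable probability density with respect to a $\sigma$-finite measure $\nu_s$ on the data space. *Data collection.* At each iteration $t=0,1,2,\dots$ one action, a simulation point $z\in Z$ or a source $s\in S$, is chosen by an arbitrary non-anticipating rule, that is, as a measurable function of the data observed so far and possibly of exogenous randomness independent of $(\theta,a^*)$. The resulting observation is drawn from the law above, independently of the past given $(\theta,a^*)$. After $t$ iterations the data consist of $n$ simulation triplets $\mathscr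 F^n=\{(x,a,y)^1,\dots,(x,a,y)^n\}$ and $m$ pairs $\mathscr R^m=\{(s,r)^1,\dots,(s,r)^m\}$, with $n+m=t$. *Posteriors.* The posterior mean $\mu^n$ and covariance $k^n$ of $\theta$ given $\mathscr F^n$ are obtained by successive conditioning: if the $(n+1)$-st observation is $y$ at $z$, then $$\mu^{n+1}(u)=\mu^n(u)+\frac{k^n(u,z)}{k^n(z,z)+\sigma_\epsilon^2}\,(y-\mu^n(z)),\qquad k^{n+1}(u,u')=k^n(u,u')-\frac{k^n(u,z)\,k^n(z,u')}{k^n(z,z)+\sigma_\epsilon^2},$$ with no change if the denominator is $0$. For $\sigma_\epsilon^2>0$ and with $\tilde X^n$ the observed points and $Y^n$ the observed values, these are $$\mu^n(u)=\mu^0(u)+k^0(u,\tilde X^n)\,(k^0(\tilde X^n,\tilde X^n)+\sigma_\epsilon^2 I)^{-1}(Y^n-\mu^0(\tilde X^n)),$$ $$k^n(u,u')=k^0(u,u')-k^0(u,\tilde X^n)\,(k^0(\tilde X^n,\tilde X^n)+\sigma_\epsilon^2 I)^{-1}k^0(\tilde X^n,u').$$ The posterior of the parameter is $\mathbb P[da\mid\mathscr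 R^m]\propto\mathbb P[da]\prod_{i=1}^m\mathbb P[r^i\mid a,s^i]$. *Value of information.* Put $$G(x;\mathscr R^m,\mathscr F^n)=\int_A\mu^n(x,a)\,\mathbb P[da\mid\mathscr R^m],\qquad G^*(\mathscr R^m,\mathscr F^n)=\max_{x\in X}G(x;\mathscr R^m,\mathscr F^n).$$ For $z\in Z$ and $s\in S$ let $$\mathrm{VoI}^t(z)=\mathbb E_{y}\Big[\tfrac{G^*(\mathscr R^m,\mathscr F^n\cup\{(z,y)\})-G^*(\mathscr R^m,\mathscr F^n)}{c_f}\Big],\quad y\sim N\big(\mu^n(z),k^n(z,z)+\sigma_\epsilon^2\big),$$ $$\mathrm{VoI}^t(s)=\mathbb E_{r}\Big[\tfrac{G^*(\mathscr R^m\cup\{(s,r)\},\mathscr F^n)-G^*(\mathscr R^m,\mathscr F^n)}{c_s}\Big],\quad r\sim\int_A\mathbb P[r\mid a,s]\,\mathbb P[da\mid\mathscr R^m].$$ **Proposition.** Almost surely, the following two statements hold. 1. For every $(x',a')\in X\times A$ that is observed infinitely often, $\mathrm{VoI}^t\big((x',a')\big)\to0$ as $t\to\infty$. 2. For every source $s\in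 S$ that is observed infinitely often, $\mathrm{VoI}^t(s)\to0$ as $t\to\infty$. -/

import Mathlib

open MeasureTheory ProbabilityTheory Filter Topology
open scoped NNReal ENNReal

noncomputable section

namespace BICO

/-! ### Gaussian process regression -/

section GP

variable {Z : Type*}

/-- Posterior covariance function of a Gaussian process with prior covariance `k₀`, observed with
independent centred Gaussian noise of variance `v` at the locations of the list `F` (most recent
first). Conditioning is done one observation at a time. If `k z z + v = 0`, the value at `z` is
already known exactly, and the observation changes nothing (`x / 0 = 0`).
For `v > 0` this is the usual closed form, see `gpCov_eq_matrix`. -/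
def gpCov (k₀ : Z → Z → ℝ) (v : ℝ) : List (Z × ℝ) → Z → Z → ℝ
  | [], u, u' => k₀ u u'
  | (z, _) :: F, u, u' =>
      gpCov k₀ v F u u' - gpCov k₀ v F u z * gpCov k₀ v F z u' / (gpCov k₀ v F z z + v)

/-- Posterior mean of a Gaussian process with prior mean `μ₀` and prior covariance `k₀`, given the
noisy observations `(location, value)` in the list `F` (most recent first).
For `v > 0` this is the usual closed form, see `gpMean_eq_matrix`. -/
def gpMean (μ₀ : Z → ℝ) (k₀ : Z → Z → ℝ) (v : ℝ) : List (Z × ℝ) → Z → ℝ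
  | [], u => μ₀ u
  | (z, y) :: F, u =>
      gpMean μ₀ k₀ v F u
        + gpCov k₀ v F u z / (gpCov k₀ v F z z + v) * (y - gpMean μ₀ k₀ v F z)

/-- The Gram matrix `k₀(X̃, X̃)` of the observed locations. -/
def gram (k₀ : Z → Z → ℝ) (F : List (Z × ℝ)) : Matrix (Fin F.length) (Fin F.length) ℝ :=
  Matrix.of fun i j => k₀ (F.get i).1 (F.get j).1

/-- Symmetric positive semidefinite kernels. -/
structure IsCovKernel (k₀ : Z → Z → ℝ) : Prop where
  symm : ∀ u u', k₀ u u' = k₀ u' u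
  nonneg : ∀ (n : ℕ) (z : Fin n → Z) (c : Fin n → ℝ), 0 ≤ ∑ i, ∑ j, c i * c j * k₀ (z i) (z j)

theorem nonneg_of_weights {k₀ : Z → Z → ℝ} (hk : IsCovKernel k₀) {v : ℝ} (hv : 0 < v)
    (F : List (Z × ℝ)) (u : Z) (w : Fin F.length → ℝ)
    (hw : ∀ i, ∑ j, k₀ (F.get i).1 (F.get j).1 * w j + v * w i = k₀ (F.get i).1 u) :
    0 ≤ k₀ u u - ∑ i, w i * k₀ (F.get i).1 u := by
  have h := hk.nonneg (F.length + 1) (Fin.cons u fun i => (F.get i).1) (Fin.cons 1 fun i => - w i)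
  simp only [Fin.sum_univ_succ, Fin.cons_zero, Fin.cons_succ] at h
  have e1 : ∀ i, w i * ∑ j, k₀ (F.get i).1 (F.get j).1 * w j
      = w i * k₀ (F.get i).1 u - v * (w i) ^ 2 := fun i => by
    rw [← hw i]; ring
  have e2 : ∑ i, ∑ j, -w i * -w j * k₀ (F.get i).1 (F.get j).1
      = ∑ i, w i * k₀ (F.get i).1 u - v * ∑ i, (w i) ^ 2 := by
    rw [Finset.mul_sum, ← Finset.sum_sub_distrib]
    refine Finset.sum_congr rfl fun i _ => ?_
    rw [← e1 i, Finset.mul_sum]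
    exact Finset.sum_congr rfl fun j _ => by ring
  have e3 : ∑ j, 1 * -w j * k₀ u (F.get j).1 = - ∑ i, w i * k₀ (F.get i).1 u := by
    rw [← Finset.sum_neg_distrib]
    exact Finset.sum_congr rfl fun i _ => by rw [hk.symm u]; ring
  have e4 : ∑ i, -w i * 1 * k₀ (F.get i).1 u = - ∑ i, w i * k₀ (F.get i).1 u := by
    rw [← Finset.sum_neg_distrib]
    exact Finset.sum_congr rfl fun i _ => by ring
  rw [Finset.sum_add_distrib, e2, e3, e4] at h
  have h5 : 0 ≤ v * ∑ i, (w i) ^ 2 := mul_nonneg hv.le (Finset.sum_nonneg fun i _ => sq_nonneg _)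
  linarith

theorem exists_weights (μ₀ : Z → ℝ) {k₀ : Z → Z → ℝ} (hk : IsCovKernel k₀) {v : ℝ}
    (hv : 0 < v) (F : List (Z × ℝ)) : ∀ u, ∃ w : Fin F.length → ℝ,
      (∀ i, ∑ j, k₀ (F.get i).1 (F.get j).1 * w j + v * w i = k₀ (F.get i).1 u) ∧
      (∀ u', gpCov k₀ v F u u' = k₀ u u' - ∑ i, w i * k₀ (F.get i).1 u') ∧
      gpMean μ₀ k₀ v F u = μ₀ u + ∑ i, w i * ((F.get i).2 - μ₀ (F.get i).1) := by
  induction F with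
  | nil => intro u; exact ⟨fun i => i.elim0, fun i => i.elim0, by simp [gpCov], by simp [gpMean]⟩
  | cons q F ih =>
    obtain ⟨z, y⟩ := q
    intro u
    obtain ⟨a, ha1, ha2, ha3⟩ := ih u
    obtain ⟨b, hb1, hb2, hb3⟩ := ih z
    have hpos : 0 < gpCov k₀ v F z z + v := by
      rw [hb2]
      have := nonneg_of_weights hk hv F z b hb1
      linarith
    set c := gpCov k₀ v F u z / (gpCov k₀ v F z z + v) with hc
    have hcm : c * (gpCov k₀ v F z z + v) = gpCov k₀ v F u z := div_mul_cancel₀ _ hpos.ne'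
    have lin : ∀ g : Fin F.length → ℝ, ∑ i, (a i - c * b i) * g i
        = ∑ i, a i * g i - c * ∑ i, b i * g i := fun g => by
      rw [Finset.mul_sum, ← Finset.sum_sub_distrib]
      exact Finset.sum_congr rfl fun i _ => by ring
    refine ⟨Fin.cons c fun i => a i - c * b i, ?_, ?_, ?_⟩
    · refine Fin.cases ?_ fun i => ?_
      · refine (congrArg (· + _) (Fin.sum_univ_succ (n := F.length) _)).trans ?_
        simp only [List.get_eq_getElem, List.length_cons, Fin.val_zero, Fin.val_succ,
          List.getElem_cons_zero, List.getElem_cons_succ, Fin.cons_zero, Fin.cons_succ]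
        have e : ∑ j : Fin F.length, k₀ z F[(j : ℕ)].1 * (a j - c * b j)
            = ∑ j, (a j - c * b j) * k₀ (F.get j).1 z :=
          Finset.sum_congr rfl fun j _ => by rw [hk.symm z, mul_comm]; rfl
        have h1 := ha2 z
        have h2 := hb2 z
        rw [e, lin, hk.symm z u]
        linear_combination hcm + h1 - c * h2
      · refine (congrArg (· + _) (Fin.sum_univ_succ (n := F.length) _)).trans ?_
        simp only [List.get_eq_getElem, List.length_cons, Fin.val_zero, Fin.val_succ,
          List.getElem_cons_zero, List.getElem_cons_succ, Fin.cons_zero, Fin.cons_succ]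
        have h1 := ha1 i
        have h2 := hb1 i
        simp only [List.get_eq_getElem] at h1 h2
        have e : ∑ j : Fin F.length, k₀ F[(i : ℕ)].1 F[(j : ℕ)].1 * (a j - c * b j)
            = ∑ j : Fin F.length, k₀ F[(i : ℕ)].1 F[(j : ℕ)].1 * a j
              - c * ∑ j : Fin F.length, k₀ F[(i : ℕ)].1 F[(j : ℕ)].1 * b j := by
          rw [Finset.mul_sum, ← Finset.sum_sub_distrib]
          exact Finset.sum_congr rfl fun j _ => by ring
        rw [e]
        linear_combination h1 - c * h2
    · intro u'
      refine Eq.trans ?_ (congrArg (_ - ·) (Fin.sum_univ_succ (n := F.length) _).symm)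
      simp only [List.get_eq_getElem, List.length_cons, Fin.val_zero, Fin.val_succ,
        List.getElem_cons_zero, List.getElem_cons_succ, Fin.cons_zero, Fin.cons_succ]
      have l := lin fun i => k₀ (F.get i).1 u'
      simp only [List.get_eq_getElem] at l
      have h1 := ha2 u'
      have h2 := hb2 u'
      simp only [List.get_eq_getElem] at h1 h2
      rw [l, gpCov, mul_div_right_comm, ← hc]
      linear_combination h1 - c * h2
    · refine Eq.trans ?_ (congrArg (_ + ·) (Fin.sum_univ_succ (n := F.length) _).symm)
      simp only [List.get_eq_getElem, List.length_cons, Fin.val_zero, Fin.val_succ,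
        List.getElem_cons_zero, List.getElem_cons_succ, Fin.cons_zero, Fin.cons_succ]
      have l := lin fun i => (F.get i).2 - μ₀ (F.get i).1
      simp only [List.get_eq_getElem] at l ha3 hb3
      rw [l, gpMean, ← hc]
      linear_combination ha3 - c * hb3

theorem isUnit_det {k₀ : Z → Z → ℝ} (hk : IsCovKernel k₀) {v : ℝ} (hv : 0 < v)
    (F : List (Z × ℝ)) : IsUnit (gram k₀ F + v • (1 : Matrix _ _ ℝ)).det := by
  have h1 : (gram k₀ F).PosSemidef := by
    refine Matrix.PosSemidef.of_dotProduct_mulVec_nonneg ?_ fun c => ?_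
    · ext i j
      simpa [gram] using hk.symm _ _
    · have := hk.nonneg F.length (fun i => (F.get i).1) c
      simp only [star_trivial, dotProduct, Matrix.mulVec, gram, Matrix.of_apply, Finset.mul_sum]
      refine this.trans_eq ?_
      exact Finset.sum_congr rfl fun i _ => Finset.sum_congr rfl fun j _ => by ring
  have h2 : (v • (1 : Matrix (Fin F.length) (Fin F.length) ℝ)).PosDef := Matrix.PosDef.one.smul hv
  exact (Matrix.PosDef.posSemidef_add h1 h2).det_pos.ne'.isUnit

theorem weights_eq {k₀ : Z → Z → ℝ} (hk : IsCovKernel k₀) {v : ℝ} (hv : 0 < v)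
    (F : List (Z × ℝ)) (u : Z) (w : Fin F.length → ℝ)
    (hw : ∀ i, ∑ j, k₀ (F.get i).1 (F.get j).1 * w j + v * w i = k₀ (F.get i).1 u) :
    w = Matrix.vecMul (fun i => k₀ u (F.get i).1) (gram k₀ F + v • (1 : Matrix _ _ ℝ))⁻¹ := by
  set M := gram k₀ F + v • (1 : Matrix (Fin F.length) (Fin F.length) ℝ) with hM
  have hU : IsUnit M.det := isUnit_det hk hv F
  have hMs : M.transpose = M := by
    ext i j
    simpa [hM, gram, Matrix.one_apply, eq_comm] using hk.symm _ _
  have e : (fun i => k₀ u (F.get i).1) = Matrix.vecMul w M := by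
    rw [← Matrix.mulVec_transpose, hMs]
    funext i
    rw [hk.symm u, ← hw i]
    rw [hM, Matrix.add_mulVec, Matrix.smul_mulVec, Matrix.one_mulVec]
    simp [gram, Matrix.mulVec, dotProduct]
  rw [e, Matrix.vecMul_vecMul, Matrix.mul_nonsing_inv _ hU, Matrix.vecMul_one]

/-- `kⁿ(u,u') = k₀(u,u') - k₀(u,X̃) (k₀(X̃,X̃) + v I)⁻¹ k₀(X̃,u')`. -/
theorem gpCov_eq_matrix {k₀ : Z → Z → ℝ} (hk : IsCovKernel k₀) {v : ℝ} (hv : 0 < v)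
    (F : List (Z × ℝ)) (u u' : Z) :
    gpCov k₀ v F u u' = k₀ u u' -
      Matrix.vecMul (fun i => k₀ u (F.get i).1) (gram k₀ F + v • (1 : Matrix _ _ ℝ))⁻¹
        ⬝ᵥ (fun i => k₀ (F.get i).1 u') := by
  obtain ⟨w, h1, h2, -⟩ := exists_weights (fun _ => 0) hk hv F u
  rw [h2, ← weights_eq hk hv F u w h1]
  rfl

/-- `μⁿ(u) = μ₀(u) + k₀(u,X̃) (k₀(X̃,X̃) + v I)⁻¹ (Y - μ₀(X̃))`. -/
theorem gpMean_eq_matrix (μ₀ : Z → ℝ) {k₀ : Z → Z → ℝ} (hk : IsCovKernel k₀) {v : ℝ} (hv : 0 < v)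
    (F : List (Z × ℝ)) (u : Z) :
    gpMean μ₀ k₀ v F u = μ₀ u +
      Matrix.vecMul (fun i => k₀ u (F.get i).1) (gram k₀ F + v • (1 : Matrix _ _ ℝ))⁻¹
        ⬝ᵥ (fun i => (F.get i).2 - μ₀ (F.get i).1) := by
  obtain ⟨w, h1, -, h3⟩ := exists_weights μ₀ hk hv F u
  rw [h3, ← weights_eq hk hv F u w h1]
  rfl

end GP

/-! ### The problem and its statistical model -/

/-- Simulation optimisation under input uncertainty. Solutions form a finite set `X ⊂ ℝ^D`,
parameters a compact set `A ⊂ ℝ^J`, and there are `N` parameter data sources, with data in `R`. -/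
structure Problem (D J N : ℕ) (R : Type*) [MeasurableSpace R] where
  /-- solution space -/
  X : Finset (EuclideanSpace ℝ (Fin D))
  X_nonempty : X.Nonempty
  /-- parameter space -/
  A : Set (EuclideanSpace ℝ (Fin J))
  A_compact : IsCompact A
  /-- cost of one simulation run -/
  costSim : ℝ
  costSim_pos : 0 < costSim
  /-- cost of one query of each data source -/
  costSrc : Fin N → ℝ
  costSrc_pos : ∀ s, 0 < costSrc s
  /-- variance of the simulation noise -/
  noiseVar : ℝ≥0
  /-- prior mean and covariance functions of the Gaussian process model of the target function -/
  μ₀ : X × A → ℝ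
  μ₀_continuous : Continuous μ₀
  k₀ : X × A → X × A → ℝ
  k₀_continuous : Continuous (Function.uncurry k₀)
  /-- prior distribution of the true parameter -/
  prior : Measure A
  prior_prob : IsProbabilityMeasure prior
  /-- reference measure of the data of each source, such as Lebesgue or counting measure -/
  ref : Fin N → Measure R
  ref_sigmaFinite : ∀ s, SigmaFinite (ref s)
  /-- `lik s a r` is the probability density `P[r | a, s]` with respect to `ref s` -/
  lik : Fin N → A → R → ℝ≥0
  lik_measurable : ∀ s, Measurable (Function.uncurry (lik s))
  lik_prob : ∀ s a, ∫⁻ r, lik s a r ∂(ref s) = 1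

namespace Problem

variable {D J N : ℕ} {R : Type*} [MeasurableSpace R] (P : Problem D J N R)

/-- Simulation points `(x, a)`. -/
abbrev Point : Type := P.X × P.A

/-- Actions: run the simulator at a point, or query a data source. -/
abbrev Action : Type := P.Point ⊕ Fin N

/-- What one iteration adds to the data: `((x, a), y)` or `(s, r)`. -/
abbrev Datum : Type _ := (P.Point × ℝ) ⊕ (Fin N × R)

/-- The action that produced a datum. -/
def action : P.Datum → P.Action := Sum.map Prod.fst Prod.fst

/-- `𝓕ⁿ`: the simulation part of the data. -/
def simData (L : List P.Datum) : List (P.Point × ℝ) := L.filterMap Sum.getLeft?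

/-- `𝓡ᵐ`: the data-source part of the data. -/
def srcData (L : List P.Datum) : List (Fin N × R) := L.filterMap Sum.getRight?

/-- `μⁿ` -/
def mean (F : List (P.Point × ℝ)) : P.Point → ℝ := gpMean P.μ₀ P.k₀ P.noiseVar F

/-- `kⁿ` -/
def cov (F : List (P.Point × ℝ)) : P.Point → P.Point → ℝ := gpCov P.k₀ P.noiseVar F

/-- The prior weighted by the likelihood of the source data. -/
def unnormPosterior (Rm : List (Fin N × R)) : Measure P.A :=
  P.prior.withDensity fun a => ((Rm.map fun q => P.lik q.1 a q.2).prod : ℝ≥0)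

/-- The posterior distribution `P[a | 𝓡ᵐ]`. -/
def posterior (Rm : List (Fin N × R)) : Measure P.A :=
  (P.unnormPosterior Rm Set.univ)⁻¹ • P.unnormPosterior Rm

/-- `G(x; 𝓡ᵐ, 𝓕ⁿ) = ∫ μⁿ(x, a) P[a | 𝓡ᵐ] da` -/
def G (Rm : List (Fin N × R)) (F : List (P.Point × ℝ)) (x : P.X) : ℝ :=
  ∫ a, P.mean F (x, a) ∂(P.posterior Rm)

/-- `G*(𝓡ᵐ, 𝓕ⁿ) = max_x G(x; 𝓡ᵐ, 𝓕ⁿ)` -/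
def Gmax (Rm : List (Fin N × R)) (F : List (P.Point × ℝ)) : ℝ :=
  ⨆ x, P.G Rm F x

/-- Predictive distribution of the next performance at `z`:
`N(μⁿ(z), kⁿ(z, z) + noiseVar)`. -/
def predSim (F : List (P.Point × ℝ)) (z : P.Point) : Measure ℝ :=
  gaussianReal (P.mean F z) (P.cov F z z + P.noiseVar).toNNReal

/-- Predictive distribution of the next data point from source `s`, with density
`r ↦ ∫ P[r | a, s] P[a | 𝓡ᵐ] da`. -/
def predSrc (Rm : List (Fin N × R)) (s : Fin N) : Measure R :=
  (P.ref s).withDensity fun r => ∫⁻ a, P.lik s a r ∂(P.posterior Rm)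

/-- The value of information, given the data `L`, of each action: the expected increase of `Gmax`
caused by the next observation, under its predictive distribution, per unit cost. -/
def VoI (L : List P.Datum) : P.Action → ℝ
  | .inl z => ∫ y, (P.Gmax (P.srcData L) ((z, y) :: P.simData L)
      - P.Gmax (P.srcData L) (P.simData L)) / P.costSim ∂(P.predSim (P.simData L) z)
  | .inr s => ∫ r, (P.Gmax ((s, r) :: P.srcData L) (P.simData L)
      - P.Gmax (P.srcData L) (P.simData L)) / P.costSrc s ∂(P.predSrc (P.srcData L) s)

/-- The data available at iteration `t`: the first `t` observations, most recent first. -/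
def history (d : ℕ → P.Datum) : ℕ → List P.Datum
  | 0 => []
  | t + 1 => d t :: history d t

/-- Law of the datum produced by an action if the target function is `f` and the true parameter is
`a`: `y ~ N(f(x, a'), noiseVar)` for the simulation point `(x, a')`, and `r ~ P[r | a, s]` for the
source `s`. -/
def obsLaw (f : P.Point → ℝ) (a : P.A) : P.Action → Measure P.Datum
  | .inl z => (gaussianReal (f z) P.noiseVar).map fun y => .inl (z, y)
  | .inr s => ((P.ref s).withDensity fun r => (P.lik s a r : ℝ≥0∞)).map fun r => .inr (s, r)

/-- The information of the algorithm before iteration `t`, as a sigma-algebra: its own random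
choices `U` and the data of the iterations before `t`. -/
abbrev algInfo {Ω E : Type*} [MeasurableSpace E] (U : Ω → E) (d : ℕ → Ω → P.Datum) (t : ℕ) :
    MeasurableSpace Ω :=
  MeasurableSpace.comap U inferInstance ⊔
    ⨆ i : ℕ, ⨆ _ : i < t, MeasurableSpace.comap (d i) inferInstance

/-- The sigma-algebra generated by the target function. -/
abbrev targetInfo {Ω : Type*} (θ : P.Point → Ω → ℝ) : MeasurableSpace Ω :=
  ⨆ z, MeasurableSpace.comap (θ z) inferInstance

/-- The sigma-algebra generated by the true parameter. -/
abbrev paramInfo {Ω : Type*} (aStar : Ω → P.A) : MeasurableSpace Ω :=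
  MeasurableSpace.comap aStar inferInstance

/-- The Bayesian model of a sequential data collection. The target function `θ` is a Gaussian
process with continuous sample paths, the true parameter `aStar` has the prior law, `U` is the
exogenous randomness of the algorithm (if any), and these three are independent. At each iteration
`t` the algorithm chooses an action on the basis of the information it has, and then the datum
`d t` is drawn from the law of the observations of that action, independently of the past given
`θ` and `aStar`. -/
structure IsRun {Ω E : Type*} [MeasurableSpace Ω] [MeasurableSpace E] (ℙr : Measure Ω)
    (θ : P.Point → Ω → ℝ) (aStar : Ω → P.A) (U : Ω → E) (d : ℕ → Ω → P.Datum) : Prop where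
  θ_measurable : ∀ z, Measurable (θ z)
  θ_gaussian : IsGaussianProcess θ ℙr
  θ_mean : ∀ z, ∫ ω, θ z ω ∂ℙr = P.μ₀ z
  θ_cov : ∀ z z', cov[θ z, θ z'; ℙr] = P.k₀ z z'
  θ_continuous : ∀ ω, Continuous fun z => θ z ω
  aStar_measurable : Measurable aStar
  aStar_law : ℙr.map aStar = P.prior
  indep_θ_aStar : Indep (P.targetInfo θ) (P.paramInfo aStar) ℙr
  U_measurable : Measurable U
  indep_U : Indep (MeasurableSpace.comap U inferInstance)
    (P.targetInfo θ ⊔ P.paramInfo aStar) ℙr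
  d_measurable : ∀ t, Measurable (d t)
  nonanticipating : ∀ t, Measurable[P.algInfo U d t] fun ω => P.action (d t ω)
  observation : ∀ t, ∀ B : Set P.Datum, MeasurableSet B →
    ℙr⟦d t ⁻¹' B | P.algInfo U d t ⊔ P.targetInfo θ ⊔ P.paramInfo aStar⟧ =ᵐ[ℙr]
      fun ω => (P.obsLaw (fun z => θ z ω) (aStar ω) (P.action (d t ω))).real B

end Problem

end BICO

end

noncomputable section

namespace BICO

/-! ### Measures and conditioning -/

section Conditioning

variable {Ω S T : Type*} [MeasurableSpace Ω] [MeasurableSpace S]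

/-! The two statements are of different nature. For a simulation point $z$ the claim holds on every
path, whatever values are observed. With noise variance $v$, an observation at $z$ lowers $s_t =
k^t(z,z)$ by $s_t^2/(s_t+v)$ and no other observation raises it, so infinitely many of them force
$s_t \to 0$ (`tendsto_zero_of_frequently_sub_sq_div`). A further value $y$ at $z$ moves the
posterior mean at $u$ by the gain $k^t(u,z)/(s_t+v)$ times $y-\mu^t(z)$. If $v>0$, Cauchy–Schwarz
makes the gain vanish uniformly in $u$; if $v=0$, one observation already makes it zero
(`tendsto_VoI_inl`).

For a source $s$ the claim rests on a weak form of posterior consistency. Given the data and the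
target function, the true parameter has the law `posterior` (`posteriorLaw`), so posterior integrals
of $g$ are the martingale $E[g(a^*)\mid\mathcal F_t]$ and converge. Let $Y$ be the probability of a
set $C$ under the data law of $s$ at $a^*$. A query of $s$ yields an indicator with conditional mean
$Y$ given the past, $\theta$ and $a^*$. The squares of the conditional variances of $Y$ at the query
times are dominated in mean by the increments of $E[E[Y\mid\mathcal F_t]^2]$
(`integral_sq_condVar_le`), hence are summable, and $Y$ is known in the limit if there are
infinitely many queries. The posterior need not concentrate at $a^*$, but the likelihood of $s$
becomes asymptotically constant under it, equal to the likelihood at $a^*$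
(`lik_ae_eq_limitDensity`, `tendsto_lintegral_posterior_of_frequently`).

A likelihood that is nearly constant under the posterior hardly changes it. With $q$ the predictive
density, the posterior integral of $|\mathrm{lik}-q|$ is $2(q-\mathrm{overlap})$, so
$|\mathrm{VoI}(s)| \le (2M/c_s)(1-\int \mathrm{overlap})$ when the posterior mean is bounded by $M$
(`ofReal_abs_VoI_inr_le`), and Fatou's lemma gives $\int\mathrm{overlap}\to 1$
(`tendsto_lintegral_overlap`).

The bound $M$ has to be uniform in $t$. Under adaptive sampling, the conditional moment generating
function of $\theta$ is still that of a Gaussian with the posterior mean and covariance (`condMGF`).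
Therefore $\exp(\pm\mu^t(u)) \le E[e^S\mid\mathcal G_t]$, where $S\ge\sup|\theta|$ has exponential
moments by Fernique's theorem, and the right-hand side converges almost surely, so is bounded in $t$
(`ae_exists_bound_mean`). -/

theorem measure_eq_of_forall_inter_preimage [MeasurableSpace T] {ν₁ ν₂ : Measure Ω} [IsFiniteMeasure ν₁]
    {X : Ω → S} (hX : Measurable X) {Y : Ω → T} (hY : Measurable Y)
    (h : ∀ A, MeasurableSet A → ∀ B, MeasurableSet B →
      ν₁ (X ⁻¹' A ∩ Y ⁻¹' B) = ν₂ (X ⁻¹' A ∩ Y ⁻¹' B))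
    {E : Set Ω} (hE : MeasurableSet[MeasurableSpace.comap X inferInstance ⊔
      MeasurableSpace.comap Y inferInstance] E) :
    ν₁ E = ν₂ E := by
  have hmeas : Measurable fun ω => (X ω, Y ω) := hX.prodMk hY
  rw [← MeasurableSpace.comap_prodMk] at hE
  obtain ⟨E', hE1, rfl⟩ := hE
  have key : ν₁.map (fun ω => (X ω, Y ω)) = ν₂.map (fun ω => (X ω, Y ω)) := by
    refine Measure.ext_prod fun {s t} hs ht => ?_
    rw [Measure.map_apply hmeas (hs.prod ht), Measure.map_apply hmeas (hs.prod ht)]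
    exact h s hs t ht
  rw [← Measure.map_apply hmeas hE1, key, Measure.map_apply hmeas hE1]

/-- The hypothesis identifies the law of `(X, Y)` with a composition product on rectangles, hence
everywhere. Mass at most one is asked, not exactly one, because `posterior` is the zero measure when
the evidence is zero or infinite. -/
theorem lintegral_comp_eq_lintegral_lintegral [MeasurableSpace T] {μ : Measure Ω} [IsFiniteMeasure μ]
    {X : Ω → S} (hX : Measurable X) {Y : Ω → T} (hY : Measurable Y)
    {κ : S → Measure T} (hκ : Measurable κ) (hκ1 : ∀ x, κ x Set.univ ≤ 1)
    (h : ∀ A, MeasurableSet A → ∀ B, MeasurableSet B →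
      μ (X ⁻¹' A ∩ Y ⁻¹' B) = ∫⁻ ω in X ⁻¹' A, κ (X ω) B ∂μ)
    {Φ : S × T → ℝ≥0∞} (hΦ : Measurable Φ) :
    ∫⁻ ω, Φ (X ω, Y ω) ∂μ = ∫⁻ ω, ∫⁻ y, Φ (X ω, y) ∂(κ (X ω)) ∂μ := by
  have hmeas : Measurable fun ω => (X ω, Y ω) := hX.prodMk hY
  let K : Kernel S T := ⟨κ, hκ⟩
  have : IsFiniteKernel K := ⟨⟨1, ENNReal.one_lt_top, hκ1⟩⟩
  have key : μ.map (fun ω => (X ω, Y ω)) = (μ.map X) ⊗ₘ K := by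
    refine Measure.ext_prod fun {s t} hs ht => ?_
    rw [Measure.map_apply hmeas (hs.prod ht), Measure.compProd_apply_prod hs ht,
      setLIntegral_map hs (Kernel.measurable_coe K ht) hX]
    exact h s hs t ht
  rw [← lintegral_map hΦ hmeas, key, Measure.lintegral_compProd hΦ,
    lintegral_map hΦ.lintegral_kernel_prod_right' hX]
  rfl

/-- On each fibre of `f` the random parameter is a constant. -/
theorem lintegral_simpleFunc_comp (μ : Measure Ω) {X : Ω → S} (hX : Measurable X)
    {A : Set S} (hA : MeasurableSet A) (f : SimpleFunc S T) (F : T → Ω → ℝ≥0∞) :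
    ∫⁻ ω in X ⁻¹' A, F (f (X ω)) ω ∂μ
      = ∑ τ ∈ f.range, ∫⁻ ω in X ⁻¹' (A ∩ f ⁻¹' {τ}), F τ ω ∂μ := by
  have e : X ⁻¹' A = ⋃ τ ∈ f.range, X ⁻¹' (A ∩ f ⁻¹' {τ}) := by
    ext ω
    simp
  have hm : ∀ τ, MeasurableSet (X ⁻¹' (A ∩ f ⁻¹' {τ})) := fun τ =>
    hX (hA.inter (f.measurableSet_fiber τ))
  conv_lhs => rw [e]
  rw [lintegral_biUnion_finset]
  · refine Finset.sum_congr rfl fun τ _ => setLIntegral_congr_fun (hm τ) fun ω hω => ?_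
    have : f (X ω) = τ := hω.2
    simp only [this]
  · intro a _ b _ hab
    refine Set.disjoint_left.2 fun ω h1 h2 => hab ?_
    have h1' : f (X ω) = a := h1.2
    have h2' : f (X ω) = b := h2.2
    rw [← h1', h2']
  · exact fun τ _ => hm τ

theorem measurable_simpleFunc_comp {X : Ω → S} (hX : Measurable X) (f : SimpleFunc S T)
    {F : T → Ω → ℝ≥0∞} (hF : ∀ τ, Measurable (F τ)) : Measurable fun ω => F (f (X ω)) ω := by
  intro B hB
  have e : (fun ω => F (f (X ω)) ω) ⁻¹' B
      = ⋃ τ ∈ f.range, X ⁻¹' (f ⁻¹' {τ}) ∩ F τ ⁻¹' B := by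
    ext ω
    simp only [Set.mem_preimage, SimpleFunc.mem_range, Set.mem_range, Set.iUnion_exists,
      Set.iUnion_iUnion_eq', Set.mem_iUnion, Set.mem_inter_iff, Set.mem_singleton_iff]
    exact ⟨fun h => ⟨X ω, rfl, h⟩, fun ⟨i, hi, h⟩ => hi ▸ h⟩
  rw [e]
  exact Finset.measurableSet_biUnion _ fun τ _ => (hX (f.measurableSet_fiber τ)).inter (hF τ hB)

/-- A parameter may be replaced by a random one, if that is measurable with respect to the
conditioning sigma-algebra. -/
theorem setLIntegral_comp_eq_of_forall [MeasurableSpace T] [PseudoMetricSpace T] [SecondCountableTopology T]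
    [OpensMeasurableSpace T] {μ : Measure Ω} {X : Ω → S} (hX : Measurable X)
    {s : Set T} (hs : s.Nonempty) {F H : T → Ω → ℝ≥0∞}
    (hFm : ∀ τ, Measurable (F τ)) (hHm : ∀ τ, Measurable (H τ))
    (hFc : ∀ ω, Continuous fun τ => F τ ω) (hHc : ∀ ω, Continuous fun τ => H τ ω)
    {g h : Ω → ℝ≥0∞} (hFg : ∀ᵐ ω ∂μ, ∀ τ ∈ s, F τ ω ≤ g ω)
    (hHh : ∀ᵐ ω ∂μ, ∀ τ ∈ s, H τ ω ≤ h ω)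
    (hg : ∫⁻ ω, g ω ∂μ ≠ ∞) (hh : ∫⁻ ω, h ω ∂μ ≠ ∞)
    (hFH : ∀ τ ∈ s, ∀ A, MeasurableSet A → ∫⁻ ω in X ⁻¹' A, F τ ω ∂μ = ∫⁻ ω in X ⁻¹' A, H τ ω ∂μ)
    {Y : S → T} (hY : Measurable Y) (hYs : ∀ x, Y x ∈ s) {A : Set S} (hA : MeasurableSet A) :
    ∫⁻ ω in X ⁻¹' A, F (Y (X ω)) ω ∂μ = ∫⁻ ω in X ⁻¹' A, H (Y (X ω)) ω ∂μ := by
  obtain ⟨y₀, hy₀⟩ := hs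
  have : TopologicalSpace.SeparableSpace s := inferInstance
  -- The identity holds for simple parameters with values in `s`, fibre by fibre; continuity in the
  -- parameter and domination carry it to the limit `Y`.
  let f : ℕ → SimpleFunc S T := fun n => SimpleFunc.approxOn Y hY s y₀ hy₀ n
  have hf : ∀ n x, f n x ∈ s := fun n x => SimpleFunc.approxOn_mem hY hy₀ n x
  have hlim : ∀ x, Tendsto (fun n => f n x) atTop (𝓝 (Y x)) := fun x =>
    SimpleFunc.tendsto_approxOn hY hy₀ (subset_closure (hYs x))
  have lim : ∀ (F : T → Ω → ℝ≥0∞) (g : Ω → ℝ≥0∞), (∀ τ, Measurable (F τ)) →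
      (∀ ω, Continuous fun τ => F τ ω) → (∀ᵐ ω ∂μ, ∀ τ ∈ s, F τ ω ≤ g ω) → ∫⁻ ω, g ω ∂μ ≠ ∞ →
      Tendsto (fun n => ∫⁻ ω in X ⁻¹' A, F (f n (X ω)) ω ∂μ) atTop
        (𝓝 (∫⁻ ω in X ⁻¹' A, F (Y (X ω)) ω ∂μ)) := by
    intro F g hF hc hb hg
    refine tendsto_lintegral_of_dominated_convergence g
      (fun n => measurable_simpleFunc_comp hX (f n) hF)
      (fun n => ae_restrict_of_ae (hb.mono fun ω hω => hω _ (hf n _)))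
      (ne_top_of_le_ne_top hg (setLIntegral_le_lintegral _ _))
      (ae_of_all _ fun ω => ((hc ω).tendsto _).comp (hlim (X ω)))
  refine tendsto_nhds_unique (lim F g hFm hFc hFg hg) ?_
  refine (lim H h hHm hHc hHh hh).congr fun n => ?_
  rw [lintegral_simpleFunc_comp μ hX hA, lintegral_simpleFunc_comp μ hX hA]
  refine Finset.sum_congr rfl fun τ hτ => ?_
  obtain ⟨x, rfl⟩ := SimpleFunc.mem_range.1 hτ
  exact (hFH _ (hf n x) _ (hA.inter ((f n).measurableSet_fiber _))).symm

/-- The hypothesis says that the two measures with densities `f` and `g` coincide after restriction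
to `m`; they then integrate every `m`-measurable weight alike. -/
theorem lintegral_mul_eq_of_forall_setLIntegral_eq {Ω : Type*} {m m₀ : MeasurableSpace Ω} {μ : Measure[m₀] Ω}
    (hm : m ≤ m₀) {f g : Ω → ℝ≥0∞} (hf : Measurable[m₀] f) (hg : Measurable[m₀] g)
    (h : ∀ A, MeasurableSet[m] A → ∫⁻ ω in A, f ω ∂μ = ∫⁻ ω in A, g ω ∂μ)
    {w : Ω → ℝ≥0∞} (hw : Measurable[m] w) : ∫⁻ ω, w ω * f ω ∂μ = ∫⁻ ω, w ω * g ω ∂μ := by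
  have hw' : Measurable[m₀] w := hw.mono hm le_rfl
  have e : (μ.withDensity f).trim hm = (μ.withDensity g).trim hm := by
    refine @Measure.ext _ m _ _ fun A hA => ?_
    rw [trim_measurableSet_eq hm hA, trim_measurableSet_eq hm hA, withDensity_apply _ (hm A hA),
      withDensity_apply _ (hm A hA), h A hA]
  have key : ∀ f : Ω → ℝ≥0∞, Measurable[m₀] f →
      ∫⁻ ω, w ω * f ω ∂μ = ∫⁻ ω, w ω ∂((μ.withDensity f).trim hm) := fun f hf => by
    rw [lintegral_trim hm hw, lintegral_withDensity_eq_lintegral_mul _ hf hw']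
    exact lintegral_congr fun ω => mul_comm _ _
  rw [key f hf, key g hg, e]

end Conditioning

/-! ### Exponential moments of measures on the line -/

theorem lintegral_exp_gaussianReal (m : ℝ) (v : ℝ≥0) (a b : ℝ) :
    ∫⁻ x, ENNReal.ofReal (Real.exp (a + b * x)) ∂(gaussianReal m v)
      = ENNReal.ofReal (Real.exp (a + b * m + b ^ 2 * v / 2)) := by
  have h := congrFun (mgf_fun_id_gaussianReal (μ := m) (v := v)) b
  simp only [mgf] at h
  simp_rw [Real.exp_add a, ENNReal.ofReal_mul (Real.exp_pos a).le]
  rw [lintegral_const_mul _ (by fun_prop), ← ofReal_integral_eq_lintegral_ofReal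
    (integrable_exp_mul_gaussianReal b) (ae_of_all _ fun x => (Real.exp_pos _).le), h,
    ← ENNReal.ofReal_mul (Real.exp_pos a).le, ← Real.exp_add]
  congr 2
  ring

/-- When all real exponential moments are finite, the complex moment generating function is
determined on the whole plane by its values on the real line, and it characterises the measure. -/
theorem measure_ext_of_lintegral_exp {μ ν : Measure ℝ} [IsFiniteMeasure μ] [IsFiniteMeasure ν]
    (hfin : ∀ b : ℝ, ∫⁻ x, ENNReal.ofReal (Real.exp (b * x)) ∂μ ≠ ∞)
    (h : ∀ b : ℝ, ∫⁻ x, ENNReal.ofReal (Real.exp (b * x)) ∂μ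
      = ∫⁻ x, ENNReal.ofReal (Real.exp (b * x)) ∂ν) : μ = ν := by
  have h0 : μ Set.univ = ν Set.univ := by simpa using h 0
  have hm : mgf id μ = mgf id ν := by
    ext b
    simp only [mgf, id]
    rw [integral_eq_lintegral_of_nonneg_ae (ae_of_all _ fun x => (Real.exp_pos _).le)
      (by fun_prop), integral_eq_lintegral_of_nonneg_ae (ae_of_all _ fun x => (Real.exp_pos _).le)
      (by fun_prop), h b]
  have hset : integrableExpSet id μ = Set.univ := by
    refine Set.eq_univ_of_forall fun b => ?_
    refine ⟨by fun_prop, ?_⟩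
    rw [hasFiniteIntegral_iff_ofReal (ae_of_all _ fun x => (Real.exp_pos _).le)]
    exact (hfin b).lt_top
  have hz : μ = 0 ↔ ν = 0 := by
    rw [← Measure.measure_univ_eq_zero, ← Measure.measure_univ_eq_zero, h0]
  refine Measure.ext_of_complexMGF_id_eq ?_
  ext z
  exact eqOn_complexMGF_of_mgf' hm hz (by simp [hset])

/-! ### Exponential moments of the supremum of a Gaussian process -/

section Envelope

variable {Ω : Type*} [MeasurableSpace Ω] {μ : Measure Ω} [IsProbabilityMeasure μ]

/-- Fernique's theorem for the supremum of a bounded Gaussian sequence. -/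
theorem exists_lintegral_exp_sq_iSup_ne_top {Y : ℕ → Ω → ℝ} (hY : IsGaussianProcess Y μ)
    (hYm : ∀ n, Measurable (Y n)) (hY0 : ∀ n, ∫ ω, Y n ω ∂μ = 0)
    (hb : ∀ ω, BddAbove (Set.range fun n => |Y n ω|)) :
    ∃ C : ℝ, 0 < C ∧ ∫⁻ ω, ENNReal.ofReal (Real.exp (C * (⨆ n, |Y n ω|) ^ 2)) ∂μ ≠ ∞ := by
  set S : Ω → ℝ := fun ω => ⨆ n, |Y n ω| with hS
  have hle : ∀ ω n, |Y n ω| ≤ S ω := fun ω n => le_ciSup (hb ω) n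
  have hS0 : ∀ ω, 0 ≤ S ω := fun ω => (abs_nonneg _).trans (hle ω 0)
  have hSm : Measurable S := Measurable.iSup fun n => (hYm n).abs
  -- Fernique's bound needs a ball of probability at least some `c` with `1/2 < c < 1`; the value
  -- `3/4` is otherwise arbitrary.
  let c : ℝ≥0∞ := ENNReal.ofReal (3 / 4)
  have hc1 : (2 : ℝ≥0∞)⁻¹ < c := by
    have : (2 : ℝ≥0∞)⁻¹ = ENNReal.ofReal (2⁻¹) := by
      rw [ENNReal.ofReal_inv_of_pos (by norm_num)]; simp
    rw [this]
    exact (ENNReal.ofReal_lt_ofReal_iff (by norm_num)).2 (by norm_num)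
  have hc2 : c < 1 := by
    rw [← ENNReal.ofReal_one]
    exact (ENNReal.ofReal_lt_ofReal_iff (by norm_num)).2 (by norm_num)
  obtain ⟨a, ha, hac⟩ : ∃ a : ℝ, 0 < a ∧ c ≤ μ {ω | S ω ≤ a} := by
    have hmono : Monotone fun k : ℕ => {ω | S ω ≤ (k : ℝ)} := fun i j hij ω hω =>
      le_trans (b := (i : ℝ)) hω (by exact_mod_cast hij)
    have hun : ⋃ k : ℕ, {ω | S ω ≤ (k : ℝ)} = Set.univ := by
      refine Set.eq_univ_of_forall fun ω => ?_
      obtain ⟨k, hk⟩ := exists_nat_ge (S ω)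
      exact Set.mem_iUnion.2 ⟨k, hk⟩
    have ht := tendsto_measure_iUnion_atTop (μ := μ) hmono
    rw [hun, measure_univ] at ht
    obtain ⟨k, hk, hk1⟩ := ((ht.eventually (lt_mem_nhds hc2)).and (eventually_gt_atTop 0)).exists
    exact ⟨k, by exact_mod_cast hk1, hk.le⟩
  refine ⟨Fernique.logRatio c * a⁻¹ ^ 2, mul_pos (Fernique.logRatio_pos hc1 hc2) (by positivity), ?_⟩
  set C := Fernique.logRatio c * a⁻¹ ^ 2 with hC
  have hCpos : 0 < C := mul_pos (Fernique.logRatio_pos hc1 hc2) (by positivity)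
  -- The bound given by Fernique's theorem. It depends on `c` alone, not on the dimension, so it
  -- serves all finite subfamilies at once.
  set K : ℝ≥0∞ := .ofReal (Real.exp (Fernique.logRatio c))
        + ∑' n : ℕ, .ofReal (Real.exp (-2⁻¹ * Real.log (c / (1 - c)).toReal * 2 ^ n)) with hK
  have hKtop : K ≠ ∞ := by
    have hlt : 1 - c < c := by
      refine ENNReal.sub_lt_of_lt_add hc2.le ?_
      rw [← two_mul]
      rwa [inv_eq_one_div, ENNReal.div_lt_iff (by simp) (by simp), mul_comm] at hc1
    have h1c : 1 - c < ∞ := tsub_le_self.trans_lt (by simp)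
    refine (ENNReal.add_lt_top.mpr ⟨ENNReal.ofReal_lt_top, Summable.tsum_ofReal_lt_top <|
      Real.summable_exp_nat_mul_of_ge ?_
        (fun i => mod_cast (Nat.lt_pow_self (by simp)).le)⟩).ne
    refine mul_neg_of_neg_of_pos (by simp) (Real.log_pos ?_)
    simp only [ENNReal.toReal_div, one_lt_div_iff, ENNReal.toReal_pos_iff, tsub_pos_iff_lt, hc2,
      h1c, and_self, true_and]
    rw [ENNReal.toReal_lt_toReal h1c.ne hc2.ne_top]
    exact .inl hlt
  -- Finite Gaussian vectors with the sup norm, which tends to `S` from below. Thus the event `S ≤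
  -- a` provides the required ball for every `n`, and Fatou's lemma passes the bound to `S`.
  let X : ∀ n : ℕ, Ω → (Finset.range n → ℝ) := fun n ω => fun i => Y i ω
  have hXm : ∀ n, Measurable (X n) := fun n => measurable_pi_lambda _ fun i => hYm i
  have hXS : ∀ n ω, ‖X n ω‖ ≤ S ω := fun n ω =>
    (pi_norm_le_iff_of_nonneg (hS0 ω)).2 fun i => hle ω i
  have hXY : ∀ n ω, ∀ i < n, |Y i ω| ≤ ‖X n ω‖ := fun n ω i hi =>
    norm_le_pi_norm (ι := {j // j ∈ Finset.range n}) (X n ω) ⟨i, Finset.mem_range.2 hi⟩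
  have bound : ∀ n, ∫⁻ ω, ENNReal.ofReal (Real.exp (C * ‖X n ω‖ ^ 2)) ∂μ ≤ K := fun n => by
    have hG : HasGaussianLaw (X n) μ := hY.hasGaussianLaw (Finset.range n)
    have : IsGaussian (μ.map (X n)) := hG.isGaussian_map
    have h0 : (μ.map (X n))[id] = 0 := by
      rw [integral_map (hXm n).aemeasurable (by fun_prop)]
      ext i
      simp only [id]
      have hi : ∀ j, Integrable (fun ω => X n ω j) μ := fun j =>
        (hY.hasGaussianLaw_eval (j : ℕ)).integrable
      rw [eval_integral hi]
      exact hY0 i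
    have h1 := lintegral_exp_mul_sq_norm_le_of_map_rotation_eq_self (μ := μ.map (X n)) (a := a)
      (IsGaussian.map_rotation_eq_self h0 _) (c := c) ?_ hc1
    · rw [lintegral_map (by fun_prop) (hXm n)] at h1
      exact h1
    · rw [Measure.map_apply (hXm n) (measurableSet_le measurable_norm measurable_const)]
      exact hac.trans (measure_mono fun ω hω => (hXS n ω).trans hω)
  have lim : ∀ ω, Tendsto (fun n => ‖X n ω‖) atTop (𝓝 (S ω)) := fun ω => by
    refine tendsto_order.2 ⟨fun b hb => ?_, fun b hb => Eventually.of_forall fun n =>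
      (hXS n ω).trans_lt hb⟩
    obtain ⟨i, hi⟩ := exists_lt_of_lt_ciSup hb
    filter_upwards [eventually_gt_atTop i] with n hn
    exact hi.trans_le (hXY n ω i hn)
  refine ne_top_of_le_ne_top hKtop ?_
  calc ∫⁻ ω, ENNReal.ofReal (Real.exp (C * S ω ^ 2)) ∂μ
      = ∫⁻ ω, liminf (fun n => ENNReal.ofReal (Real.exp (C * ‖X n ω‖ ^ 2))) atTop ∂μ := by
        refine lintegral_congr fun ω => (Tendsto.liminf_eq ?_).symm
        refine (ENNReal.continuous_ofReal.tendsto _).comp ?_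
        exact (Real.continuous_exp.tendsto _).comp (((lim ω).pow 2).const_mul C)
    _ ≤ liminf (fun n => ∫⁻ ω, ENNReal.ofReal (Real.exp (C * ‖X n ω‖ ^ 2)) ∂μ) atTop :=
        lintegral_liminf_le fun n => by fun_prop
    _ ≤ K := liminf_le_of_le (by isBoundedDefault) fun b hb => by
        obtain ⟨n, hn⟩ := hb.exists
        exact hn.trans (bound n)

/-- A Gaussian process with continuous paths on a compact space is dominated by a random variable
with exponential moments. -/
theorem exists_envelope {Z : Type*} [TopologicalSpace Z] [CompactSpace Z]
    [TopologicalSpace.SeparableSpace Z] [Nonempty Z] {θ : Z → Ω → ℝ} (hθ : IsGaussianProcess θ μ)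
    (hθm : ∀ z, Measurable (θ z)) (hθc : ∀ ω, Continuous fun z => θ z ω)
    (hmc : Continuous fun z => ∫ ω, θ z ω ∂μ) :
    ∃ S : Ω → ℝ, Measurable S ∧ (∀ ω z, |θ z ω| ≤ S ω) ∧
      ∀ c : ℝ, ∫⁻ ω, ENNReal.ofReal (Real.exp (c * S ω)) ∂μ ≠ ∞ := by
  set m₀ : Z → ℝ := fun z => ∫ ω, θ z ω ∂μ with hm₀
  let u := TopologicalSpace.denseSeq Z
  let Y : ℕ → Ω → ℝ := fun n ω => θ (u n) ω - m₀ (u n)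
  obtain ⟨M, hM⟩ := isCompact_univ.exists_bound_of_continuousOn hmc.continuousOn
  have hbz : ∀ ω, ∃ b, ∀ z, |θ z ω - m₀ z| ≤ b := fun ω => by
    obtain ⟨b, hb⟩ := isCompact_univ.exists_bound_of_continuousOn
      ((hθc ω).sub hmc).continuousOn
    exact ⟨b, fun z => hb z (Set.mem_univ z)⟩
  have hb : ∀ ω, BddAbove (Set.range fun n => |Y n ω|) := fun ω => by
    obtain ⟨b, hb⟩ := hbz ω
    exact ⟨b, by rintro _ ⟨n, rfl⟩; exact hb _⟩
  have hYm : ∀ n, Measurable (Y n) := fun n => (hθm _).sub_const _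
  have hYG : IsGaussianProcess Y μ := by
    refine ⟨fun I => ?_⟩
    have hG : HasGaussianLaw (I.restrict fun n => θ (u n) ·) μ :=
      (hθ.comp_right u).hasGaussianLaw I
    have := hG.isGaussian_map
    refine ⟨?_⟩
    have hm : Measurable fun ω => I.restrict (fun n => θ (u n) ω) :=
      measurable_pi_lambda _ fun i => hθm _
    have e : (fun ω => I.restrict (Y · ω))
        = (fun x : I → ℝ => x - fun i : I => m₀ (u i)) ∘ fun ω => I.restrict fun n => θ (u n) ω := by
      ext ω i
      rfl
    rw [e, ← Measure.map_map (by fun_prop) hm]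
    infer_instance
  have hY0 : ∀ n, ∫ ω, Y n ω ∂μ = 0 := fun n => by
    simp only [Y]
    rw [integral_sub (hθ.hasGaussianLaw_eval _).integrable (integrable_const _)]
    simp [hm₀]
  obtain ⟨C, hC, hfin⟩ := exists_lintegral_exp_sq_iSup_ne_top hYG hYm hY0 hb
  set S₀ : Ω → ℝ := fun ω => ⨆ n, |Y n ω| with hS₀
  have hS₀m : Measurable S₀ := Measurable.iSup fun n => (hYm n).abs
  refine ⟨fun ω => S₀ ω + M, hS₀m.add_const _, fun ω z => ?_, fun c => ?_⟩
  · have h1 : |θ z ω - m₀ z| ≤ S₀ ω := by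
      have hcl : IsClosed {z | |θ z ω - m₀ z| ≤ S₀ ω} :=
        isClosed_le ((hθc ω).sub hmc).abs continuous_const
      have : ∀ z, z ∈ {z | |θ z ω - m₀ z| ≤ S₀ ω} := by
        intro z
        refine hcl.closure_subset_iff.2 ?_ (TopologicalSpace.denseRange_denseSeq Z z)
        rintro _ ⟨n, rfl⟩
        exact le_ciSup (hb ω) n
      exact this z
    have h2 := hM z (Set.mem_univ z)
    rw [Real.norm_eq_abs] at h2
    have h3 := abs_add_le (θ z ω - m₀ z) (m₀ z)
    rw [sub_add_cancel] at h3
    linarith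
  · have key : ∀ ω, Real.exp (c * (S₀ ω + M))
        ≤ Real.exp (c * M + c ^ 2 / (4 * C)) * Real.exp (C * S₀ ω ^ 2) := fun ω => by
      rw [← Real.exp_add]
      refine Real.exp_le_exp.2 ?_
      -- Completing the square trades the linear exponent for the quadratic one, whose exponential
      -- is integrable.
      have : c * S₀ ω ≤ c ^ 2 / (4 * C) + C * S₀ ω ^ 2 := by
        have h : c ^ 2 / (4 * C) + C * S₀ ω ^ 2 - c * S₀ ω = C * (S₀ ω - c / (2 * C)) ^ 2 := by
          field_simp
          ring
        have : 0 ≤ C * (S₀ ω - c / (2 * C)) ^ 2 := by positivity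
        linarith
      linarith
    refine ne_top_of_le_ne_top ?_ (lintegral_mono fun ω => ENNReal.ofReal_le_ofReal (key ω))
    simp_rw [ENNReal.ofReal_mul (Real.exp_pos _).le]
    rw [lintegral_const_mul _ (by fun_prop)]
    exact ENNReal.mul_ne_top ENNReal.ofReal_ne_top hfin

end Envelope

/-! ### Covariance kernels -/

section Kernels

variable {Z : Type*}

/-- The linear functional `f ↦ ∑ i, c i * f (u i)`. -/
def lin {n : ℕ} (c : Fin n → ℝ) (u : Fin n → Z) (f : Z → ℝ) : ℝ := ∑ i, c i * f (u i)

/-- The quadratic form `∑ i j, c i * c j * k (u i) (u j)`. -/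
def quad {n : ℕ} (c : Fin n → ℝ) (u : Fin n → Z) (k : Z → Z → ℝ) : ℝ :=
  ∑ i, ∑ j, c i * c j * k (u i) (u j)

theorem lin_cons {n : ℕ} (b : ℝ) (c : Fin n → ℝ) (z : Z) (u : Fin n → Z) (f : Z → ℝ) :
    lin (Fin.cons b c : Fin (n + 1) → ℝ) (Fin.cons z u : Fin (n + 1) → Z) f
      = b * f z + lin c u f := by
  simp [lin, Fin.sum_univ_succ]

theorem quad_cons {n : ℕ} (b : ℝ) (c : Fin n → ℝ) (z : Z) (u : Fin n → Z) {k : Z → Z → ℝ}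
    (hk : ∀ u u', k u u' = k u' u) :
    quad (Fin.cons b c : Fin (n + 1) → ℝ) (Fin.cons z u : Fin (n + 1) → Z) k
      = b ^ 2 * k z z + 2 * b * lin c u (k · z) + quad c u k := by
  simp only [quad, lin, Fin.sum_univ_succ, Fin.cons_zero, Fin.cons_succ, Finset.sum_add_distrib]
  have e1 : ∑ j, b * c j * k z (u j) = b * ∑ j, c j * k (u j) z := by
    rw [Finset.mul_sum]
    exact Finset.sum_congr rfl fun j _ => by rw [hk z]; ring
  have e2 : ∑ j, c j * b * k (u j) z = b * ∑ j, c j * k (u j) z := by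
    rw [Finset.mul_sum]
    exact Finset.sum_congr rfl fun j _ => by ring
  rw [e1, e2]
  ring

theorem quad_sub_div {n : ℕ} (c : Fin n → ℝ) (u : Fin n → Z) (k : Z → Z → ℝ) (f g : Z → ℝ) (a : ℝ) :
    quad c u (fun x y => k x y - f x * g y / a) = quad c u k - lin c u f * lin c u g / a := by
  simp only [quad, lin, Finset.sum_mul_sum, Finset.sum_div, ← Finset.sum_sub_distrib]
  exact Finset.sum_congr rfl fun i _ => Finset.sum_congr rfl fun j _ => by ring

namespace IsCovKernel

variable {k : Z → Z → ℝ} (hk : IsCovKernel k)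
include hk

theorem self_nonneg (z : Z) : 0 ≤ k z z := by
  simpa using hk.nonneg 1 (fun _ => z) fun _ => 1

/-- Cauchy–Schwarz for the semi-inner product of the kernel: adding the point `z` with coefficient
`b` gives a quadratic polynomial in `b` that is nonnegative, so its discriminant is not positive. -/
theorem sq_lin_le {n : ℕ} (c : Fin n → ℝ) (u : Fin n → Z) (z : Z) :
    lin c u (k · z) ^ 2 ≤ quad c u k * k z z := by
  have h : ∀ b : ℝ, 0 ≤ k z z * (b * b) + 2 * lin c u (k · z) * b + quad c u k := fun b => by
    have h := hk.nonneg (n + 1) (Fin.cons z u) (Fin.cons b c)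
    have e := quad_cons b c z u hk.symm
    unfold quad at e
    rw [e] at h
    refine h.trans_eq ?_
    unfold quad
    ring
  have := discrim_le_zero h
  unfold discrim at this
  linarith

theorem sq_le (u z : Z) : k u z ^ 2 ≤ k u u * k z z := by
  simpa [lin, quad] using hk.sq_lin_le (fun _ : Fin 1 => 1) (fun _ => u) z

theorem abs_le {K : ℝ} (hK : ∀ z, k z z ≤ K) (u z : Z) : |k u z| ≤ K := by
  have h0 := hk.self_nonneg u
  have h1 := hk.self_nonneg z
  refine abs_le_of_sq_le_sq ((hk.sq_le u z).trans ?_) (h0.trans (hK u))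
  rw [sq]
  exact mul_le_mul (hK u) (hK z) h1 (h0.trans (hK u))

/-- Positivity of a Schur complement, by Cauchy–Schwarz. If the denominator is zero, the subtracted
term is zero by convention. -/
theorem gpCov_cons {v : ℝ} (hv : 0 ≤ v) (z : Z) :
    IsCovKernel fun u u' => k u u' - k u z * k z u' / (k z z + v) where
  symm u u' := by rw [hk.symm u u', hk.symm u z, hk.symm z u']; ring
  nonneg n u c := by
    have h := quad_sub_div c u k (k · z) (k z ·) (k z z + v)
    have e : lin c u (k z ·) = lin c u (k · z) := by simp only [lin, hk.symm z]
    rw [e, ← sq] at h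
    unfold quad at h
    rw [h, sub_nonneg]
    have h0 : 0 ≤ quad c u k := hk.nonneg n u c
    have h1 := hk.self_nonneg z
    rcases (add_nonneg h1 hv).eq_or_lt with h2 | h2
    · rw [← h2, div_zero]
      exact h0
    · rw [div_le_iff₀ h2]
      exact (hk.sq_lin_le c u z).trans (mul_le_mul_of_nonneg_left (by linarith) h0)

theorem gpCov {v : ℝ} (hv : 0 ≤ v) (F : List (Z × ℝ)) : IsCovKernel (gpCov k v F) := by
  induction F with
  | nil => exact hk
  | cons q F ih => exact ih.gpCov_cons hv q.1

theorem gpCov_cons_self_le {v : ℝ} (hv : 0 ≤ v) (F : List (Z × ℝ)) (q : Z × ℝ) (u : Z) :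
    BICO.gpCov k v (q :: F) u u ≤ BICO.gpCov k v F u u := by
  have h := hk.gpCov hv F
  obtain ⟨z, y⟩ := q
  change BICO.gpCov k v F u u - BICO.gpCov k v F u z * BICO.gpCov k v F z u / _ ≤ _
  rw [h.symm z u, sub_le_self_iff]
  exact div_nonneg (mul_self_nonneg _) (add_nonneg (h.self_nonneg z) hv)

theorem gpCov_self_le {v : ℝ} (hv : 0 ≤ v) (F : List (Z × ℝ)) (u : Z) :
    BICO.gpCov k v F u u ≤ k u u := by
  induction F with
  | nil => exact le_rfl
  | cons q F ih => exact (hk.gpCov_cons_self_le hv F q u).trans ih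

theorem abs_gpCov_le {v : ℝ} (hv : 0 ≤ v) {K : ℝ} (hK : ∀ z, k z z ≤ K) (F : List (Z × ℝ))
    (u u' : Z) : |BICO.gpCov k v F u u'| ≤ K :=
  (hk.gpCov hv F).abs_le (fun z => (hk.gpCov_self_le hv F z).trans (hK z)) u u'

end IsCovKernel

theorem continuous_gpCov [TopologicalSpace Z] {k : Z → Z → ℝ}
    (hk : Continuous (Function.uncurry k)) (v : ℝ) (F : List (Z × ℝ)) :
    Continuous (Function.uncurry (gpCov k v F)) := by
  induction F with
  | nil => exact hk
  | cons q F ih =>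
    have h1 : Continuous fun p : Z × Z => gpCov k v F p.1 q.1 :=
      ih.comp (continuous_fst.prodMk continuous_const)
    have h2 : Continuous fun p : Z × Z => gpCov k v F q.1 p.2 :=
      ih.comp (continuous_const.prodMk continuous_snd)
    exact ih.sub ((h1.mul h2).div_const _)

theorem continuous_gpMean [TopologicalSpace Z] {μ : Z → ℝ} {k : Z → Z → ℝ} (hμ : Continuous μ)
    (hk : Continuous (Function.uncurry k)) (v : ℝ) (F : List (Z × ℝ)) :
    Continuous (gpMean μ k v F) := by
  induction F with
  | nil => exact hμ
  | cons q F ih =>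
    have h1 : Continuous fun u : Z => gpCov k v F u q.1 :=
      (continuous_gpCov hk v F).comp (continuous_id.prodMk continuous_const)
    exact ih.add ((h1.div_const _).mul_const _)

end Kernels

/-! ### Vanishing posterior variance and the value of a simulation run -/

/-- With a limit `l > 0` the sequence would lose at least `l * l / (s 0 + v)` at infinitely many
times, although the increments of a convergent sequence tend to zero. -/
theorem tendsto_zero_of_frequently_sub_sq_div {s : ℕ → ℝ} (hs : Antitone s) (h0 : ∀ t, 0 ≤ s t)
    {v : ℝ} (hv : 0 ≤ v) (h : ∃ᶠ t in atTop, s (t + 1) = s t - s t * s t / (s t + v)) :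
    Tendsto s atTop (𝓝 0) := by
  have hlim := tendsto_atTop_ciInf hs ⟨0, by rintro _ ⟨t, rfl⟩; exact h0 t⟩
  set l := ⨅ t, s t with hl
  have hl0 : 0 ≤ l := le_ciInf h0
  have hle : ∀ t, l ≤ s t := fun t => ciInf_le ⟨0, by rintro _ ⟨t, rfl⟩; exact h0 t⟩ t
  rcases hl0.eq_or_lt with hl1 | hl1
  · rwa [← hl1] at hlim
  exfalso
  have hd : Tendsto (fun t => s t - s (t + 1)) atTop (𝓝 0) := by
    have := hlim.sub (hlim.comp (tendsto_add_atTop_nat 1))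
    rwa [sub_self] at this
  have hpos : 0 < l * l / (s 0 + v) :=
    div_pos (mul_pos hl1 hl1) (add_pos_of_pos_of_nonneg (hl1.trans_le (hle 0)) hv)
  obtain ⟨t, ht1, ht2⟩ := (h.and_eventually (hd.eventually (gt_mem_nhds hpos))).exists
  rw [ht1, sub_sub_cancel] at ht2
  refine ht2.not_ge (div_le_div₀ (mul_self_nonneg _) (mul_self_le_mul_self hl0 (hle t)) ?_ ?_)
  · exact add_pos_of_pos_of_nonneg (hl1.trans_le (hle t)) hv
  · linarith [hs (Nat.zero_le t)]

theorem abs_ciSup_sub_ciSup_le {ι : Type*} [Finite ι] [Nonempty ι] {f g : ι → ℝ} {B : ℝ}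
    (h : ∀ i, |f i - g i| ≤ B) : |(⨆ i, f i) - ⨆ i, g i| ≤ B := by
  have key : ∀ f g : ι → ℝ, (∀ i, |f i - g i| ≤ B) → (⨆ i, f i) - ⨆ i, g i ≤ B := by
    intro f g h
    rw [sub_le_iff_le_add]
    refine ciSup_le fun i => ?_
    have h1 := (abs_le.1 (h i)).2
    have h2 := le_ciSup (Set.finite_range g).bddAbove i
    linarith
  refine abs_le.2 ⟨?_, key f g h⟩
  have := key g f fun i => by rw [abs_sub_comm]; exact h i
  linarith

namespace Problem

variable {D J N : ℕ} {R : Type*} [MeasurableSpace R] (P : Problem D J N R)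

instance : IsProbabilityMeasure P.prior := P.prior_prob

instance (s : Fin N) : SigmaFinite (P.ref s) := P.ref_sigmaFinite s

instance : CompactSpace P.A := isCompact_iff_compactSpace.1 P.A_compact

instance : Nonempty P.X := P.X_nonempty.to_subtype

instance : Nonempty P.A := P.prior.nonempty_of_neZero

theorem posterior_univ_le (Rm : List (Fin N × R)) : P.posterior Rm Set.univ ≤ 1 := by
  rw [posterior, Measure.smul_apply, smul_eq_mul]
  exact ENNReal.inv_mul_le_one _

instance (Rm : List (Fin N × R)) : IsFiniteMeasure (P.posterior Rm) :=
  ⟨(P.posterior_univ_le Rm).trans_lt ENNReal.one_lt_top⟩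

theorem continuous_mean (F : List (P.Point × ℝ)) : Continuous (P.mean F) :=
  continuous_gpMean P.μ₀_continuous P.k₀_continuous _ F

theorem continuous_cov (F : List (P.Point × ℝ)) : Continuous (Function.uncurry (P.cov F)) :=
  continuous_gpCov P.k₀_continuous _ F

theorem integrable_posterior {f : P.A → ℝ} (hf : Continuous f) (Rm : List (Fin N × R)) :
    Integrable f (P.posterior Rm) := by
  have := hf.continuousOn.integrableOn_compact (μ := P.posterior Rm) isCompact_univ
  rwa [integrableOn_univ] at this

theorem abs_integral_posterior_le {f : P.A → ℝ} {B : ℝ} (hf : ∀ a, |f a| ≤ B)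
    (Rm : List (Fin N × R)) : |∫ a, f a ∂(P.posterior Rm)| ≤ B := by
  have hB : 0 ≤ B := (abs_nonneg _).trans (hf (Classical.arbitrary _))
  have h := norm_integral_le_of_norm_le_const (μ := P.posterior Rm) (f := f)
    (ae_of_all _ hf)
  refine h.trans (mul_le_of_le_one_right hB ?_)
  exact ENNReal.toReal_le_of_le_ofReal zero_le_one (by simpa using P.posterior_univ_le Rm)

theorem exists_cov_bound : ∃ K : ℝ, 0 ≤ K ∧ ∀ z, P.k₀ z z ≤ K := by
  have hc : Continuous fun z => P.k₀ z z := P.k₀_continuous.comp (continuous_id.prodMk continuous_id)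
  obtain ⟨K, hK⟩ := isCompact_univ.exists_bound_of_continuousOn hc.continuousOn
  exact ⟨|K|, abs_nonneg K, fun z =>
    ((le_abs_self _).trans (hK z (Set.mem_univ z))).trans (le_abs_self K)⟩

/-- The observation shifts the posterior mean at `u` by the gain times the innovation `y - P.mean F
z`. Averaging over a posterior of mass at most one and maximising over solutions do not enlarge a
uniform bound. -/
theorem abs_Gmax_cons_sub_le {B : ℝ} (Rm : List (Fin N × R)) (F : List (P.Point × ℝ)) (z : P.Point)
    (y : ℝ) (hB : ∀ u, |P.cov F u z / (P.cov F z z + P.noiseVar)| ≤ B) :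
    |P.Gmax Rm ((z, y) :: F) - P.Gmax Rm F| ≤ B * |y - P.mean F z| := by
  refine abs_ciSup_sub_ciSup_le fun x => ?_
  have hx : Continuous fun a : P.A => ((x, a) : P.Point) := continuous_const.prodMk continuous_id
  have hi : ∀ F, Integrable (fun a => P.mean F (x, a)) (P.posterior Rm) := fun F =>
    P.integrable_posterior ((P.continuous_mean F).comp hx) Rm
  rw [G, G, ← integral_sub (hi _) (hi _)]
  refine P.abs_integral_posterior_le (fun a => ?_) Rm
  have e : P.mean ((z, y) :: F) (x, a) - P.mean F (x, a)
      = P.cov F (x, a) z / (P.cov F z z + P.noiseVar) * (y - P.mean F z) :=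
    add_sub_cancel_left _ _
  rw [e, abs_mul]
  exact mul_le_mul_of_nonneg_right (hB _) (abs_nonneg _)

/-- Under the predictive law the innovation has variance `cov z z + noiseVar`, and `|x| ≤ 1 + x ^ 2`
bounds its first absolute moment. The crude bound suffices, since it is the factor `B` that will
tend to zero. -/
theorem abs_VoI_inl_le (hk : IsCovKernel P.k₀) {B : ℝ} (L : List P.Datum) (z : P.Point)
    (hB : ∀ u, |P.cov (P.simData L) u z / (P.cov (P.simData L) z z + P.noiseVar)| ≤ B) :
    |P.VoI L (.inl z)| ≤ B / P.costSim *
      (1 + (P.cov (P.simData L) z z + P.noiseVar)) := by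
  set F := P.simData L with hF
  have hv : (0 : ℝ) ≤ P.noiseVar := P.noiseVar.2
  have h0 : 0 ≤ P.cov F z z + P.noiseVar := add_nonneg ((hk.gpCov hv F).self_nonneg z) hv
  have hB0 : 0 ≤ B := (abs_nonneg _).trans (hB z)
  have : IsProbabilityMeasure (P.predSim F z) := by unfold predSim; infer_instance
  have hint : Integrable (fun y => (y - P.mean F z) ^ 2) (P.predSim F z) := by
    have : MemLp (fun y : ℝ => y) 2 (P.predSim F z) := memLp_id_gaussianReal 2
    exact (this.sub (memLp_const _)).integrable_sq
  have hvar : ∫ y, (y - P.mean F z) ^ 2 ∂(P.predSim F z) = P.cov F z z + P.noiseVar := by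
    have h1 := variance_fun_id_gaussianReal (μ := P.mean F z)
      (v := (P.cov F z z + P.noiseVar).toNNReal)
    rw [variance_eq_integral (by fun_prop), integral_id_gaussianReal, Real.coe_toNNReal _ h0] at h1
    exact h1
  have h := norm_integral_le_of_norm_le (μ := P.predSim F z)
    (f := fun y => (P.Gmax (P.srcData L) ((z, y) :: F) - P.Gmax (P.srcData L) F) / P.costSim)
    (((integrable_const (1 : ℝ)).add hint).const_mul (B / P.costSim)) (ae_of_all _ fun y => ?_)
  · rw [integral_const_mul] at h
    simp only [Pi.add_apply] at h
    rw [integral_add (integrable_const _) hint, hvar] at h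
    simpa [VoI] using h
  · rw [Real.norm_eq_abs, abs_div, abs_of_pos P.costSim_pos, div_mul_eq_mul_div]
    refine div_le_div_of_nonneg_right ?_ P.costSim_pos.le
    refine (P.abs_Gmax_cons_sub_le _ F z y hB).trans (mul_le_mul_of_nonneg_left ?_ hB0)
    simp only [Pi.add_apply]
    rw [← sq_abs (y - _)]
    nlinarith [sq_nonneg (|y - P.mean F z| - 1), abs_nonneg (y - P.mean F z)]

@[simp]
theorem simData_inl (q : P.Point × ℝ) (L : List P.Datum) :
    P.simData (.inl q :: L) = q :: P.simData L := rfl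

@[simp]
theorem simData_inr (q : Fin N × R) (L : List P.Datum) :
    P.simData (.inr q :: L) = P.simData L := rfl

@[simp]
theorem srcData_inl (q : P.Point × ℝ) (L : List P.Datum) :
    P.srcData (.inl q :: L) = P.srcData L := rfl

@[simp]
theorem srcData_inr (q : Fin N × R) (L : List P.Datum) :
    P.srcData (.inr q :: L) = q :: P.srcData L := rfl

theorem simData_history_succ_of_action_eq {δ : ℕ → P.Datum} {t : ℕ} {z : P.Point}
    (h : P.action (δ t) = .inl z) : ∃ y : ℝ, δ t = .inl (z, y) ∧
      P.simData (P.history δ (t + 1)) = (z, y) :: P.simData (P.history δ t) := by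
  rcases hd : δ t with ⟨z', y⟩ | q
  · rw [hd] at h
    obtain rfl : z' = z := by simpa [action] using h
    exact ⟨y, rfl, by simp [history, hd]⟩
  · rw [hd] at h
    simp [action] at h

theorem cov_history_succ_self_le (hk : IsCovKernel P.k₀) (δ : ℕ → P.Datum) (t : ℕ) (u : P.Point) :
    P.cov (P.simData (P.history δ (t + 1))) u u ≤ P.cov (P.simData (P.history δ t)) u u := by
  rcases hd : δ t with q | q
  · have e : P.simData (P.history δ (t + 1)) = q :: P.simData (P.history δ t) := by
      simp [history, hd]
    rw [e]
    exact hk.gpCov_cons_self_le P.noiseVar.2 _ _ _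
  · have e : P.simData (P.history δ (t + 1)) = P.simData (P.history δ t) := by
      simp [history, hd]
    rw [e]

/-- No probability enters: the posterior covariance does not depend on the observed values, and it
determines both the gain and the predictive law of the innovation. -/
theorem tendsto_VoI_inl (hk : IsCovKernel P.k₀) (δ : ℕ → P.Datum) (z : P.Point)
    (h : ∃ᶠ t in atTop, P.action (δ t) = .inl z) :
    Tendsto (fun t => P.VoI (P.history δ t) (.inl z)) atTop (𝓝 0) := by
  obtain ⟨K, hK0, hK⟩ := P.exists_cov_bound
  have hv : (0 : ℝ) ≤ P.noiseVar := P.noiseVar.2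
  set F := fun t => P.simData (P.history δ t) with hF
  have hkt : ∀ t, IsCovKernel (P.cov (F t)) := fun t => hk.gpCov hv _
  have hKt : ∀ t u, P.cov (F t) u u ≤ K := fun t u => (hk.gpCov_self_le hv _ u).trans (hK u)
  set s : ℕ → ℝ := fun t => P.cov (F t) z z with hs
  have hs0 : ∀ t, 0 ≤ s t := fun t => (hkt t).self_nonneg z
  have hanti : Antitone s := antitone_nat_of_succ_le fun t => P.cov_history_succ_self_le hk δ t z
  have hobs : ∃ᶠ t in atTop, s (t + 1) = s t - s t * s t / (s t + P.noiseVar) := by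
    refine h.mono fun t ht => ?_
    obtain ⟨y, -, e⟩ := P.simData_history_succ_of_action_eq ht
    change P.cov (P.simData (P.history δ (t + 1))) z z = _
    rw [e]
    rfl
  have hlim := tendsto_zero_of_frequently_sub_sq_div hanti hs0 hv hobs
  rcases hv.eq_or_lt with hv0 | hv0
  -- Without noise, one observation makes the variance exactly zero and it stays so. The gain is
  -- then a quotient by zero, so the bound `B` can be taken to be zero.
  · have hev : ∀ᶠ t in atTop, s t = 0 := by
      obtain ⟨t, ht⟩ := hobs.exists
      have h1 : s (t + 1) = 0 := by
        rw [ht, ← hv0, add_zero]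
        rcases eq_or_ne (s t) 0 with h2 | h2
        · simp [h2]
        · field_simp
          simp
      filter_upwards [eventually_ge_atTop (t + 1)] with r hr
      exact le_antisymm ((hanti hr).trans h1.le) (hs0 r)
    refine tendsto_const_nhds.congr' ?_
    filter_upwards [hev] with t ht
    have hB : ∀ u, |P.cov (F t) u z / (P.cov (F t) z z + P.noiseVar)| ≤ 0 := fun u => by
      have : P.cov (F t) z z = 0 := ht
      rw [this, ← hv0]
      simp
    have := P.abs_VoI_inl_le hk (P.history δ t) z hB
    rw [zero_div, zero_mul] at this
    exact (abs_nonpos_iff.1 this).symm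
  -- Cauchy–Schwarz and the uniform prior bound `K` in the numerator; the denominator is at least
  -- the noise variance.
  · have hB : ∀ t u, |P.cov (F t) u z / (P.cov (F t) z z + P.noiseVar)|
        ≤ √(K * s t) / P.noiseVar := fun t u => by
      have h1 : 0 < P.cov (F t) z z + P.noiseVar := add_pos_of_nonneg_of_pos (hs0 t) hv0
      rw [abs_div, abs_of_pos h1]
      refine div_le_div₀ (Real.sqrt_nonneg _) ?_ hv0 (le_add_of_nonneg_left (hs0 t))
      refine Real.abs_le_sqrt (((hkt t).sq_le u z).trans ?_)
      exact mul_le_mul_of_nonneg_right (hKt t u) (hs0 t)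
    refine squeeze_zero_norm (fun t => P.abs_VoI_inl_le hk _ z (hB t)) ?_
    have h1 : Tendsto (fun t => √(K * s t) / P.noiseVar / P.costSim
        * (1 + (s t + P.noiseVar))) atTop
        (𝓝 (√(K * 0) / P.noiseVar / P.costSim * (1 + (0 + P.noiseVar)))) :=
      ((((Real.continuous_sqrt.tendsto _).comp (hlim.const_mul K)).div_const _).div_const _).mul
        ((hlim.add_const _).const_add 1)
    simpa using h1

end Problem

/-! ### Measurability of the posterior quantities -/

/-- Histories are lists without a sigma-algebra of their own. Measurability of a function of the
history is proved by recursion on `t`, splitting according to the kind of the last datum. -/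
theorem measurable_of_sum_cases {Ω Ω' α β γ : Type*} [MeasurableSpace Ω] [MeasurableSpace Ω']
    [MeasurableSpace α] [MeasurableSpace β] [MeasurableSpace γ] {f : Ω → α ⊕ β} (hf : Measurable f)
    {X : Ω → Ω'} (hX : Measurable X) {g : Ω' × α → γ} (hg : Measurable g) {h : Ω' × β → γ}
    (hh : Measurable h) {F : Ω → γ} (hF₁ : ∀ ω a, f ω = .inl a → F ω = g (X ω, a))
    (hF₂ : ∀ ω b, f ω = .inr b → F ω = h (X ω, b)) : Measurable F := by
  have e : F = fun ω => Sum.elim g h (MeasurableEquiv.prodSumDistrib Ω' α β (X ω, f ω)) := by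
    funext ω
    rcases h : f ω with a | b
    · exact hF₁ ω a h
    · exact hF₂ ω b h
  rw [e]
  exact (hg.sumElim hh).comp ((MeasurableEquiv.measurable _).comp (hX.prodMk hf))

namespace Problem

variable {D J N : ℕ} {R : Type*} [MeasurableSpace R] (P : Problem D J N R)

section History

variable {Ω : Type*} [MeasurableSpace Ω] {d : ℕ → Ω → P.Datum} {t : ℕ}

/-- The simulation data available at iteration `t`. -/
abbrev simHist (d : ℕ → Ω → P.Datum) (t : ℕ) (ω : Ω) : List (P.Point × ℝ) :=
  P.simData (P.history (fun i => d i ω) t)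

/-- The data-source data available at iteration `t`. -/
abbrev srcHist (d : ℕ → Ω → P.Datum) (t : ℕ) (ω : Ω) : List (Fin N × R) :=
  P.srcData (P.history (fun i => d i ω) t)

omit [MeasurableSpace Ω] in
theorem simHist_succ (d : ℕ → Ω → P.Datum) (t : ℕ) (ω : Ω) :
    P.simHist d (t + 1) ω
      = Sum.elim (fun q => q :: P.simHist d t ω) (fun _ => P.simHist d t ω) (d t ω) := by
  rcases h : d t ω with q | q <;> simp [simHist, history, h]

omit [MeasurableSpace Ω] in
theorem srcHist_succ (d : ℕ → Ω → P.Datum) (t : ℕ) (ω : Ω) :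
    P.srcHist d (t + 1) ω
      = Sum.elim (fun _ => P.srcHist d t ω) (fun q => q :: P.srcHist d t ω) (d t ω) := by
  rcases h : d t ω with q | q <;> simp [srcHist, history, h]

theorem measurable_cov_simHist (hd : ∀ i < t, Measurable (d i)) :
    Measurable fun p : Ω × (P.Point × P.Point) => P.cov (P.simHist d t p.1) p.2.1 p.2.2 := by
  induction t with
  | zero => exact P.k₀_continuous.measurable.comp measurable_snd
  | succ t ih =>
    have ih := ih fun i hi => hd i (hi.trans t.lt_succ_self)
    have hdt : Measurable fun p : Ω × (P.Point × P.Point) => d t p.1 :=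
      (hd t t.lt_succ_self).comp measurable_fst
    let g : (Ω × (P.Point × P.Point)) × (P.Point × ℝ) → ℝ := fun p =>
      P.cov (P.simHist d t p.1.1) p.1.2.1 p.1.2.2
        - P.cov (P.simHist d t p.1.1) p.1.2.1 p.2.1 * P.cov (P.simHist d t p.1.1) p.2.1 p.1.2.2
          / (P.cov (P.simHist d t p.1.1) p.2.1 p.2.1 + P.noiseVar)
    have hg : Measurable g := by
      have h1 := ih.comp (f := fun p : (Ω × (P.Point × P.Point)) × (P.Point × ℝ) => p.1) (by fun_prop)
      have h2 := ih.comp (f := fun p : (Ω × (P.Point × P.Point)) × (P.Point × ℝ) =>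
        (p.1.1, (p.1.2.1, p.2.1))) (by fun_prop)
      have h3 := ih.comp (f := fun p : (Ω × (P.Point × P.Point)) × (P.Point × ℝ) =>
        (p.1.1, (p.2.1, p.1.2.2))) (by fun_prop)
      have h4 := ih.comp (f := fun p : (Ω × (P.Point × P.Point)) × (P.Point × ℝ) =>
        (p.1.1, (p.2.1, p.2.1))) (by fun_prop)
      exact h1.sub ((h2.mul h3).div (h4.add_const _))
    have hh := ih.comp (f := fun p : (Ω × (P.Point × P.Point)) × (Fin N × R) => p.1) (by fun_prop)
    refine measurable_of_sum_cases hdt measurable_id hg hh (fun p q hq => ?_) fun p q hq => ?_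
    · rw [simHist_succ, hq]; rfl
    · rw [simHist_succ, hq]; rfl

theorem measurable_mean_simHist (hd : ∀ i < t, Measurable (d i)) :
    Measurable fun p : Ω × P.Point => P.mean (P.simHist d t p.1) p.2 := by
  induction t with
  | zero => exact P.μ₀_continuous.measurable.comp measurable_snd
  | succ t ih =>
    have hd' := fun i hi => hd i (Nat.lt_succ_of_lt hi)
    have ih := ih hd'
    have hc := P.measurable_cov_simHist hd'
    have hdt : Measurable fun p : Ω × P.Point => d t p.1 :=
      (hd t t.lt_succ_self).comp measurable_fst
    let g : (Ω × P.Point) × (P.Point × ℝ) → ℝ := fun p =>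
      P.mean (P.simHist d t p.1.1) p.1.2
        + P.cov (P.simHist d t p.1.1) p.1.2 p.2.1
          / (P.cov (P.simHist d t p.1.1) p.2.1 p.2.1 + P.noiseVar)
          * (p.2.2 - P.mean (P.simHist d t p.1.1) p.2.1)
    have hg : Measurable g := by
      have h1 := ih.comp (f := fun p : (Ω × P.Point) × (P.Point × ℝ) => p.1) (by fun_prop)
      have h2 := hc.comp (f := fun p : (Ω × P.Point) × (P.Point × ℝ) =>
        (p.1.1, (p.1.2, p.2.1))) (by fun_prop)
      have h3 := hc.comp (f := fun p : (Ω × P.Point) × (P.Point × ℝ) =>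
        (p.1.1, (p.2.1, p.2.1))) (by fun_prop)
      have h4 := ih.comp (f := fun p : (Ω × P.Point) × (P.Point × ℝ) =>
        (p.1.1, p.2.1)) (by fun_prop)
      have h5 : Measurable fun p : (Ω × P.Point) × (P.Point × ℝ) => p.2.2 := by fun_prop
      exact h1.add ((h2.div (h3.add_const _)).mul (h5.sub h4))
    have hh := ih.comp (f := fun p : (Ω × P.Point) × (Fin N × R) => p.1) (by fun_prop)
    refine measurable_of_sum_cases hdt measurable_id hg hh (fun p q hq => ?_) fun p q hq => ?_
    · rw [simHist_succ, hq]; rfl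
    · rw [simHist_succ, hq]; rfl

theorem measurable_lik_uncurry : Measurable fun p : P.A × (Fin N × R) => P.lik p.2.1 p.1 p.2.2 := by
  have h : Measurable fun p : (P.A × R) × Fin N => P.lik p.2 p.1.1 p.1.2 :=
    measurable_from_prod_countable_left fun s => P.lik_measurable s
  exact h.comp (f := fun p : P.A × (Fin N × R) => ((p.1, p.2.2), p.2.1)) (by fun_prop)

theorem measurable_prod_lik_srcHist (hd : ∀ i < t, Measurable (d i)) :
    Measurable fun p : Ω × P.A =>
      ((P.srcHist d t p.1).map fun q => P.lik q.1 p.2 q.2).prod := by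
  induction t with
  | zero => exact measurable_const
  | succ t ih =>
    have ih := ih fun i hi => hd i (Nat.lt_succ_of_lt hi)
    have hdt : Measurable fun p : Ω × P.A => d t p.1 :=
      (hd t t.lt_succ_self).comp measurable_fst
    have hg := ih.comp (f := fun p : (Ω × P.A) × (P.Point × ℝ) => p.1) (by fun_prop)
    have hh : Measurable fun p : (Ω × P.A) × (Fin N × R) => P.lik p.2.1 p.1.2 p.2.2
        * ((P.srcHist d t p.1.1).map fun q => P.lik q.1 p.1.2 q.2).prod :=
      (P.measurable_lik_uncurry.comp (f := fun p : (Ω × P.A) × (Fin N × R) => (p.1.2, p.2))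
        (by fun_prop)).mul (ih.comp measurable_fst)
    refine measurable_of_sum_cases hdt measurable_id hg hh (fun p q hq => ?_) fun p q hq => ?_
    · rw [srcHist_succ, hq]; simp
    · rw [srcHist_succ, hq]; simp

theorem measurable_posterior_srcHist (hd : ∀ i < t, Measurable (d i)) :
    Measurable fun ω => P.posterior (P.srcHist d t ω) := by
  have h := (P.measurable_prod_lik_srcHist hd).coe_nnreal_ennreal
  have hB : ∀ B : Set P.A, MeasurableSet B →
      Measurable fun ω => P.unnormPosterior (P.srcHist d t ω) B := fun B hB => by
    simp only [unnormPosterior, withDensity_apply _ hB]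
    exact h.lintegral_prod_right'
  refine Measure.measurable_of_measurable_coe _ fun B hB' => ?_
  simp only [posterior, Measure.smul_apply, smul_eq_mul]
  exact (hB _ MeasurableSet.univ).inv.mul (hB B hB')

/-- The posterior distribution as a kernel. -/
def posteriorKernel (hd : ∀ i < t, Measurable (d i)) : Kernel Ω P.A :=
  ⟨fun ω => P.posterior (P.srcHist d t ω), P.measurable_posterior_srcHist hd⟩

instance (hd : ∀ i < t, Measurable (d i)) : IsFiniteKernel (P.posteriorKernel hd) :=
  ⟨⟨1, ENNReal.one_lt_top, fun _ => P.posterior_univ_le _⟩⟩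

theorem measurable_lintegral_posterior (hd : ∀ i < t, Measurable (d i)) {S : Type*}
    [MeasurableSpace S] {Φ : (Ω × S) × P.A → ℝ≥0∞} (hΦ : Measurable Φ) :
    Measurable fun p : Ω × S => ∫⁻ a, Φ (p, a) ∂(P.posterior (P.srcHist d t p.1)) :=
  Measurable.lintegral_kernel_prod_right' (κ := (P.posteriorKernel hd).comap Prod.fst measurable_fst)
    hΦ

end History

/-- The simulation point of an action (a default value for a source query). -/
def simPoint (x : P.Action) : P.Point := x.elim id fun _ => Classical.arbitrary _

/-- The performance in a datum (a default value for a source datum). -/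
def simValue (x : P.Datum) : ℝ := x.elim Prod.snd fun _ => 0

theorem measurable_simPoint : Measurable P.simPoint :=
  measurable_id.sumElim measurable_const

theorem measurable_simValue : Measurable P.simValue :=
  measurable_snd.sumElim measurable_const

theorem isProbabilityMeasure_lik (s : Fin N) (a : P.A) :
    IsProbabilityMeasure ((P.ref s).withDensity fun r => (P.lik s a r : ℝ≥0∞)) :=
  ⟨by rw [withDensity_apply _ MeasurableSet.univ, Measure.restrict_univ, P.lik_prob]⟩

instance isProbabilityMeasure_obsLaw (f : P.Point → ℝ) (a : P.A) (x : P.Action) :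
    IsProbabilityMeasure (P.obsLaw f a x) := by
  rcases x with z | s
  · exact Measure.isProbabilityMeasure_map (by fun_prop)
  · have := P.isProbabilityMeasure_lik s a
    exact Measure.isProbabilityMeasure_map (by fun_prop)

theorem lintegral_obsLaw_inl (f : P.Point → ℝ) (a : P.A) (z : P.Point) {Φ : P.Datum → ℝ≥0∞}
    (hΦ : Measurable Φ) :
    ∫⁻ x, Φ x ∂(P.obsLaw f a (.inl z)) = ∫⁻ y, Φ (.inl (z, y)) ∂(gaussianReal (f z) P.noiseVar) :=
  lintegral_map hΦ (by fun_prop)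

theorem lintegral_obsLaw_inr (f : P.Point → ℝ) (a : P.A) (s : Fin N) {Φ : P.Datum → ℝ≥0∞}
    (hΦ : Measurable Φ) :
    ∫⁻ x, Φ x ∂(P.obsLaw f a (.inr s)) = ∫⁻ r, P.lik s a r * Φ (.inr (s, r)) ∂(P.ref s) := by
  have h1 : Measurable fun r => Φ (.inr (s, r)) := hΦ.comp (by fun_prop)
  have h2 : Measurable fun r => (P.lik s a r : ℝ≥0∞) :=
    ((P.lik_measurable s).comp (f := fun r => (a, r)) (by fun_prop)).coe_nnreal_ennreal
  rw [obsLaw, lintegral_map hΦ (by fun_prop), lintegral_withDensity_eq_lintegral_mul _ h2 h1]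
  rfl

/-- The Gaussian law is a translate of a fixed centred one, which moves the dependence on `θ` into
the integrand, where path continuity gives joint measurability. The sigma-algebra on `Ω` is
arbitrary because `fullInfo` and `dataInfo` are inserted later. -/
theorem measurable_obsLaw {Ω : Type*} [MeasurableSpace Ω] {θ : P.Point → Ω → ℝ}
    (hθ : ∀ z, Measurable (θ z)) (hθc : ∀ ω, Continuous fun z => θ z ω) {a : Ω → P.A}
    (ha : Measurable a) {x : Ω → P.Action} (hx : Measurable x) :
    Measurable fun ω => P.obsLaw (fun z => θ z ω) (a ω) (x ω) := by
  refine Measure.measurable_of_measurable_coe _ fun B hB => ?_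
  have hθu : Measurable fun p : Ω × P.Point => θ p.2 p.1 :=
    (measurable_uncurry_of_continuous_of_measurable hθc hθ).comp measurable_swap
  have h1B : Measurable (B.indicator (1 : P.Datum → ℝ≥0∞)) := measurable_one.indicator hB
  have hg : Measurable fun p : Ω × P.Point =>
      ∫⁻ e, B.indicator (1 : P.Datum → ℝ≥0∞) (.inl (p.2, θ p.2 p.1 + e))
        ∂(gaussianReal 0 P.noiseVar) := by
    refine Measurable.lintegral_prod_right' (f := fun p : (Ω × P.Point) × ℝ =>
      B.indicator (1 : P.Datum → ℝ≥0∞) (.inl (p.1.2, θ p.1.2 p.1.1 + p.2))) ?_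
    exact h1B.comp (measurable_inl.comp ((measurable_snd.comp measurable_fst).prodMk
      ((hθu.comp measurable_fst).add measurable_snd)))
  have hh : Measurable fun p : Ω × Fin N => ∫⁻ r, P.lik p.2 (a p.1) r
      * B.indicator (1 : P.Datum → ℝ≥0∞) (.inr (p.2, r)) ∂(P.ref p.2) := by
    refine measurable_from_prod_countable_left fun s => ?_
    refine Measurable.lintegral_prod_right' (ν := P.ref s) (f := fun p : Ω × R => P.lik s (a p.1) p.2
      * B.indicator (1 : P.Datum → ℝ≥0∞) (.inr (s, p.2))) ?_
    refine Measurable.mul ?_ (h1B.comp (by fun_prop))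
    exact ((P.lik_measurable s).comp (f := fun p : Ω × R => (a p.1, p.2))
      (by fun_prop)).coe_nnreal_ennreal
  refine measurable_of_sum_cases hx measurable_id hg hh (fun ω z hz => ?_) fun ω s hs => ?_
  · rw [← lintegral_indicator_one hB, hz, lintegral_obsLaw_inl _ _ _ _ h1B]
    have e : gaussianReal (θ z ω) P.noiseVar
        = (gaussianReal 0 P.noiseVar).map fun e => θ z ω + e := by
      rw [gaussianReal_map_const_add, zero_add]
    have h2 : Measurable fun y : ℝ => B.indicator (1 : P.Datum → ℝ≥0∞) (.inl (z, y)) :=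
      h1B.comp (by fun_prop)
    rw [e, lintegral_map h2 (by fun_prop)]
    rfl
  · rw [← lintegral_indicator_one hB, hs, lintegral_obsLaw_inr _ _ _ _ h1B]
    rfl

end Problem

/-! ### The data collection -/

theorem measurable_indicator_one {Ω : Type*} {m : MeasurableSpace Ω} {A : Set Ω}
    (hA : MeasurableSet A) : Measurable (A.indicator (1 : Ω → ℝ≥0∞)) := measurable_one.indicator hA

/-- For fixed `T` in `m₃`, both sides of the product formula are finite measures, and the two
hypotheses make them agree on the intersections `A ∩ B` that generate `m₁ ⊔ m₂`. -/
theorem indep_sup_of_indep {Ω : Type*} {m₁ m₂ m₃ m₀ : MeasurableSpace Ω} {μ : Measure Ω}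
    [IsProbabilityMeasure μ] (h₁ : m₁ ≤ m₀) (h₂ : m₂ ≤ m₀)
    (h1 : Indep m₁ (m₂ ⊔ m₃) μ) (h2 : Indep m₂ m₃ μ) : Indep (m₁ ⊔ m₂) m₃ μ := by
  rw [Indep_iff]
  intro E T hE hT
  have key := @measure_eq_of_forall_inter_preimage Ω Ω Ω m₀ m₁ m₂ (μ.restrict T) (μ T • μ) _ id
    (measurable_id'' h₁) id (measurable_id'' h₂) (fun A hA B hB => ?_) E
    (by
      have e : MeasurableSpace.comap id m₁ ⊔ MeasurableSpace.comap id m₂ = m₁ ⊔ m₂ := by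
        rw [MeasurableSpace.comap_id, MeasurableSpace.comap_id]
      exact e ▸ hE)
  · rw [Measure.restrict_apply (sup_le h₁ h₂ _ hE), Measure.smul_apply, smul_eq_mul,
      mul_comm] at key
    exact key
  · simp only [Set.preimage_id]
    rw [Indep_iff] at h1 h2
    have hB' : MeasurableSet[m₂ ⊔ m₃] B := le_sup_left (a := m₂) _ hB
    have hT' : MeasurableSet[m₂ ⊔ m₃] T := le_sup_right (a := m₂) _ hT
    rw [Measure.restrict_apply ((h₁ _ hA).inter (h₂ _ hB)), Measure.smul_apply, smul_eq_mul,
      Set.inter_assoc, h1 _ _ hA (hB'.inter hT'), h2 _ _ hB hT, h1 _ _ hA hB']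
    ring

namespace Problem

variable {D J N : ℕ} {R : Type*} [MeasurableSpace R] {P : Problem D J N R}

theorem algInfo_zero {Ω E : Type*} [MeasurableSpace E] (U : Ω → E) (d : ℕ → Ω → P.Datum) :
    P.algInfo U d 0 = MeasurableSpace.comap U inferInstance := by
  simp [algInfo]

theorem algInfo_succ {Ω E : Type*} [MeasurableSpace E] (U : Ω → E) (d : ℕ → Ω → P.Datum) (t : ℕ) :
    P.algInfo U d (t + 1) = P.algInfo U d t ⊔ MeasurableSpace.comap (d t) inferInstance := by
  refine le_antisymm (sup_le (le_sup_left.trans le_sup_left) (iSup₂_le fun i hi => ?_)) (sup_le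
    (sup_le_sup_left (iSup₂_le fun i hi => ?_) _) (le_sup_of_le_right ?_))
  · rcases (Nat.lt_succ_iff_lt_or_eq.1 hi) with hi | rfl
    · exact le_sup_of_le_left (le_sup_of_le_right (le_iSup₂_of_le i hi le_rfl))
    · exact le_sup_right
  · exact le_iSup₂_of_le i (Nat.lt_succ_of_lt hi) le_rfl
  · exact le_iSup₂_of_le t t.lt_succ_self le_rfl

theorem algInfo_mono {Ω E : Type*} [MeasurableSpace E] (U : Ω → E) (d : ℕ → Ω → P.Datum) :
    Monotone (P.algInfo U d) := monotone_nat_of_le_succ fun t => by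
  rw [algInfo_succ]
  exact le_sup_left

theorem measurable_of_lt_algInfo {Ω E : Type*} [MeasurableSpace E] (U : Ω → E)
    (d : ℕ → Ω → P.Datum) {i t : ℕ} (hi : i < t) : Measurable[P.algInfo U d t] (d i) :=
  measurable_iff_comap_le.2 (le_sup_of_le_right (le_iSup₂_of_le i hi le_rfl))

/-- All the information that determines the law of the observation at iteration `t`. -/
abbrev fullInfo (P : Problem D J N R) {Ω E : Type*} [MeasurableSpace E] (θ : P.Point → Ω → ℝ)
    (aStar : Ω → P.A) (U : Ω → E) (d : ℕ → Ω → P.Datum) (t : ℕ) : MeasurableSpace Ω :=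
  P.algInfo U d t ⊔ P.targetInfo θ ⊔ P.paramInfo aStar

namespace IsRun

variable {Ω E : Type*} [mΩ : MeasurableSpace Ω] [MeasurableSpace E] {ℙr : Measure Ω}
  [IsProbabilityMeasure ℙr] {θ : P.Point → Ω → ℝ} {aStar : Ω → P.A} {U : Ω → E}
  {d : ℕ → Ω → P.Datum} (h : P.IsRun ℙr θ aStar U d)
include h

omit [IsProbabilityMeasure ℙr] in
theorem algInfo_le (t : ℕ) : P.algInfo U d t ≤ mΩ :=
  sup_le h.U_measurable.comap_le (iSup₂_le fun i _ => (h.d_measurable i).comap_le)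

omit [IsProbabilityMeasure ℙr] in
theorem targetInfo_le : P.targetInfo θ ≤ mΩ := iSup_le fun z => (h.θ_measurable z).comap_le

omit [IsProbabilityMeasure ℙr] in
theorem paramInfo_le : P.paramInfo aStar ≤ mΩ := h.aStar_measurable.comap_le

omit [IsProbabilityMeasure ℙr] in
theorem fullInfo_le (t : ℕ) : P.fullInfo θ aStar U d t ≤ mΩ :=
  sup_le (sup_le (h.algInfo_le t) h.targetInfo_le) h.paramInfo_le

/-- The conditional-probability clause of `IsRun` in the form of an `ℝ≥0∞`-valued integral, in which
most of the conditioning below is done. -/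
theorem measure_inter_observation (t : ℕ) {A : Set Ω} (hA : MeasurableSet[P.fullInfo θ aStar U d t] A)
    {B : Set P.Datum} (hB : MeasurableSet B) :
    ℙr (A ∩ d t ⁻¹' B)
      = ∫⁻ ω in A, P.obsLaw (fun z => θ z ω) (aStar ω) (P.action (d t ω)) B ∂ℙr := by
  have hA' : MeasurableSet A := h.fullInfo_le t A hA
  have hdB : MeasurableSet (d t ⁻¹' B) := h.d_measurable t hB
  have h1 := setIntegral_condExp (μ := ℙr) (f := (d t ⁻¹' B).indicator fun _ => (1 : ℝ))
    (h.fullInfo_le t) ((integrable_const 1).indicator hdB) hA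
  rw [setIntegral_congr_ae hA' ((h.observation t B hB).mono fun ω hω _ => hω),
    setIntegral_indicator hdB, setIntegral_const, smul_eq_mul, mul_one] at h1
  have hint : IntegrableOn (fun ω => (P.obsLaw (fun z => θ z ω) (aStar ω)
      (P.action (d t ω))).real B) A ℙr :=
    ((integrable_condExp (μ := ℙr)).congr (h.observation t B hB)).integrableOn
  have h2 := ofReal_integral_eq_lintegral_ofReal hint (ae_of_all _ fun ω => measureReal_nonneg)
  rw [h1, ofReal_measureReal] at h2
  rw [h2]
  exact lintegral_congr fun ω => ofReal_measureReal

omit [IsProbabilityMeasure ℙr] in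
theorem measurable_obsLaw_fullInfo (t : ℕ) : Measurable[P.fullInfo θ aStar U d t]
    fun ω => P.obsLaw (fun z => θ z ω) (aStar ω) (P.action (d t ω)) :=
  @measurable_obsLaw D J N R _ P Ω (P.fullInfo θ aStar U d t) θ
    (fun z => measurable_iff_comap_le.2 (le_sup_of_le_left (le_sup_of_le_right (le_iSup_of_le z le_rfl))))
    h.θ_continuous aStar (measurable_iff_comap_le.2 le_sup_right) _
    ((h.nonanticipating t).mono (le_sup_of_le_left le_sup_left) le_rfl)

/-- The identity map, into `Ω` with the smaller sigma-algebra `fullInfo`, serves as the conditioning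
variable, so no random variable generating `fullInfo` is needed. -/
theorem lintegral_observation (t : ℕ) {S : Type*} [MeasurableSpace S] {X : Ω → S}
    (hX : Measurable[P.fullInfo θ aStar U d t] X) {Φ : S × P.Datum → ℝ≥0∞} (hΦ : Measurable Φ) :
    ∫⁻ ω, Φ (X ω, d t ω) ∂ℙr = ∫⁻ ω, ∫⁻ x, Φ (X ω, x)
      ∂(P.obsLaw (fun z => θ z ω) (aStar ω) (P.action (d t ω))) ∂ℙr :=
  @lintegral_comp_eq_lintegral_lintegral Ω Ω P.Datum mΩ (P.fullInfo θ aStar U d t) _ ℙr _ id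
    (measurable_id'' (h.fullInfo_le t)) (d t) (h.d_measurable t) _ (h.measurable_obsLaw_fullInfo t)
    (fun _ => prob_le_one) (fun _ hA _ hB => h.measure_inter_observation t hA hB)
    (fun p => Φ (X p.1, p.2)) (hΦ.comp ((hX.comp (@measurable_fst _ _ (_) _)).prodMk
      (@measurable_snd _ _ (_) _)))

theorem setLIntegral_observation_inl (t : ℕ) {S : Type*} [MeasurableSpace S] {X : Ω → S}
    (hX : Measurable[P.fullInfo θ aStar U d t] X) {Φ : S × ℝ → ℝ≥0∞} (hΦ : Measurable Φ)
    {A : Set Ω} (hA : MeasurableSet[P.fullInfo θ aStar U d t] A)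
    (hAs : ∀ ω ∈ A, ∃ z, P.action (d t ω) = .inl z) :
    ∫⁻ ω in A, Φ (X ω, P.simValue (d t ω)) ∂ℙr = ∫⁻ ω in A, ∫⁻ y, Φ (X ω, y)
      ∂(gaussianReal (θ (P.simPoint (P.action (d t ω))) ω) P.noiseVar) ∂ℙr := by
  have hA' : MeasurableSet A := h.fullInfo_le t A hA
  have h1 := h.lintegral_observation t (X := fun ω => (A.indicator (1 : Ω → ℝ≥0∞) ω, X ω))
    ((measurable_indicator_one hA).prodMk hX)
    (Φ := fun p => p.1.1 * Φ (p.1.2, P.simValue p.2))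
    ((by fun_prop : Measurable fun p : (ℝ≥0∞ × S) × P.Datum => p.1.1).mul (hΦ.comp
      (Measurable.prodMk (by fun_prop) (P.measurable_simValue.comp measurable_snd))))
  rw [← lintegral_indicator hA', ← lintegral_indicator hA']
  refine Eq.trans (lintegral_congr fun ω => ?_) (h1.trans (lintegral_congr fun ω => ?_))
  · by_cases hω : ω ∈ A <;> simp [hω]
  · by_cases hω : ω ∈ A
    · obtain ⟨z, hz⟩ := hAs ω hω
      have hm : Measurable fun x : P.Datum => Φ (X ω, P.simValue x) :=
        hΦ.comp (measurable_const.prodMk P.measurable_simValue)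
      simp only [hω, Set.indicator_of_mem, Pi.one_apply, one_mul]
      rw [hz, lintegral_obsLaw_inl _ _ _ _ hm]
      rfl
    · simp [hω]

theorem setLIntegral_observation_inr (t : ℕ) {S : Type*} [MeasurableSpace S] {X : Ω → S}
    (hX : Measurable[P.fullInfo θ aStar U d t] X) {Φ : S × P.Datum → ℝ≥0∞} (hΦ : Measurable Φ)
    {A : Set Ω} (hA : MeasurableSet[P.fullInfo θ aStar U d t] A) {s : Fin N}
    (hAs : ∀ ω ∈ A, P.action (d t ω) = .inr s) :
    ∫⁻ ω in A, Φ (X ω, d t ω) ∂ℙr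
      = ∫⁻ ω in A, ∫⁻ r, P.lik s (aStar ω) r * Φ (X ω, .inr (s, r)) ∂(P.ref s) ∂ℙr := by
  have hA' : MeasurableSet A := h.fullInfo_le t A hA
  have h1 := h.lintegral_observation t (X := fun ω => (A.indicator (1 : Ω → ℝ≥0∞) ω, X ω))
    ((measurable_indicator_one hA).prodMk hX)
    (Φ := fun p => p.1.1 * Φ (p.1.2, p.2))
    ((by fun_prop : Measurable fun p : (ℝ≥0∞ × S) × P.Datum => p.1.1).mul (hΦ.comp
      (Measurable.prodMk (by fun_prop) measurable_snd)))
  rw [← lintegral_indicator hA', ← lintegral_indicator hA']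
  refine Eq.trans (lintegral_congr fun ω => ?_) (h1.trans (lintegral_congr fun ω => ?_))
  · by_cases hω : ω ∈ A <;> simp [hω]
  · by_cases hω : ω ∈ A
    · have hm : Measurable fun x : P.Datum => Φ (X ω, x) := hΦ.comp (by fun_prop)
      simp only [hω, Set.indicator_of_mem, Pi.one_apply, one_mul]
      rw [hAs ω hω, lintegral_obsLaw_inr _ _ _ _ hm]
    · simp [hω]

theorem indep_target : Indep (P.algInfo U d 0 ⊔ P.paramInfo aStar) (P.targetInfo θ) ℙr := by
  rw [algInfo_zero]
  refine indep_sup_of_indep h.U_measurable.comap_le h.paramInfo_le ?_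
    h.indep_θ_aStar.symm
  rw [sup_comm]
  exact h.indep_U

theorem indep_param : Indep (P.algInfo U d 0 ⊔ P.targetInfo θ) (P.paramInfo aStar) ℙr := by
  rw [algInfo_zero]
  exact indep_sup_of_indep h.U_measurable.comap_le h.targetInfo_le h.indep_U
    h.indep_θ_aStar

/-- The quadratic form is the variance of `∑ i, c i • θ (u i)`: symmetry and positivity of `k₀` are
consequences of the model. -/
theorem isCovKernel : IsCovKernel P.k₀ where
  symm u u' := by rw [← h.θ_cov, ← h.θ_cov, covariance_comm]
  nonneg n u c := by
    have h2 : ∀ i, MemLp (c i • θ (u i)) 2 ℙr := fun i =>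
      ((h.θ_gaussian.hasGaussianLaw_eval (u i)).memLp_two).const_smul (c i)
    have h1 := variance_nonneg (∑ i, c i • θ (u i)) ℙr
    rw [variance_sum h2] at h1
    refine h1.trans_eq (Finset.sum_congr rfl fun i _ => Finset.sum_congr rfl fun j _ => ?_)
    rw [covariance_smul_left, covariance_smul_right, h.θ_cov]
    ring

end IsRun

end Problem

/-! ### The conditional law of the target function -/

section Kernels

variable {Z : Type*}

theorem abs_lin_le {n : ℕ} (c : Fin n → ℝ) (u : Fin n → Z) {f : Z → ℝ} {B : ℝ}
    (hB : ∀ z, |f z| ≤ B) : |lin c u f| ≤ (∑ i, |c i|) * B := by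
  rw [Finset.sum_mul]
  refine (Finset.abs_sum_le_sum_abs _ _).trans (Finset.sum_le_sum fun i _ => ?_)
  rw [abs_mul]
  exact mul_le_mul_of_nonneg_left (hB _) (abs_nonneg _)

theorem abs_quad_le {n : ℕ} (c : Fin n → ℝ) (u : Fin n → Z) {k : Z → Z → ℝ} {K : ℝ}
    (hK : ∀ z z', |k z z'| ≤ K) : |quad c u k| ≤ (∑ i, |c i|) * (∑ i, |c i|) * K := by
  rw [Finset.sum_mul_sum, Finset.sum_mul]
  refine (Finset.abs_sum_le_sum_abs _ _).trans (Finset.sum_le_sum fun i _ => ?_)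
  rw [Finset.sum_mul]
  refine (Finset.abs_sum_le_sum_abs _ _).trans (Finset.sum_le_sum fun j _ => ?_)
  rw [abs_mul, abs_mul]
  exact mul_le_mul_of_nonneg_left (hK _ _) (mul_nonneg (abs_nonneg _) (abs_nonneg _))

theorem measurable_lin {Ω : Type*} [MeasurableSpace Ω] {n : ℕ} (c : Fin n → ℝ) (u : Fin n → Z)
    {f : Ω → Z → ℝ} (hf : ∀ z, Measurable fun ω => f ω z) : Measurable fun ω => lin c u (f ω) :=
  Finset.measurable_sum _ fun i _ => (hf (u i)).const_mul (c i)

theorem measurable_quad {Ω : Type*} [MeasurableSpace Ω] {n : ℕ} (c : Fin n → ℝ) (u : Fin n → Z)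
    {k : Ω → Z → Z → ℝ} (hk : ∀ z z', Measurable fun ω => k ω z z') :
    Measurable fun ω => quad c u (k ω) :=
  Finset.measurable_sum _ fun _ _ => Finset.measurable_sum _ fun _ _ => (hk _ _).const_mul _

end Kernels

namespace Problem

variable {D J N : ℕ} {R : Type*} [MeasurableSpace R] {P : Problem D J N R}

/-- The logarithm of the posterior moment generating function. -/
def logMGF (P : Problem D J N R) {n : ℕ} (c : Fin n → ℝ) (u : Fin n → P.Point)
    (F : List (P.Point × ℝ)) : ℝ :=
  lin c u (P.mean F) + quad c u (P.cov F) / 2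

/-- The expression is affine in `y`, so its exponential integrates in closed form against the
Gaussian noise. -/
theorem logMGF_cons {n : ℕ} (c : Fin n → ℝ) (u : Fin n → P.Point) (F : List (P.Point × ℝ))
    (z : P.Point) (y : ℝ) :
    P.logMGF c u ((z, y) :: F) = lin c u (P.mean F)
      + lin c u (P.cov F · z) / (P.cov F z z + P.noiseVar) * (y - P.mean F z)
      + (quad c u (P.cov F) - lin c u (P.cov F · z) * lin c u (P.cov F z ·)
        / (P.cov F z z + P.noiseVar)) / 2 := by
  rw [logMGF, ← quad_sub_div]
  congr 1
  simp only [lin, Finset.sum_div, Finset.sum_mul, ← Finset.sum_add_distrib]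
  refine Finset.sum_congr rfl fun i _ => ?_
  change c i * (P.mean F (u i) + P.cov F (u i) z / (P.cov F z z + P.noiseVar) * (y - P.mean F z)) = _
  ring

section Mble

variable {Ω : Type*} [MeasurableSpace Ω] {d : ℕ → Ω → P.Datum} {t : ℕ}

theorem measurable_mean_simHist_comp (hd : ∀ i < t, Measurable (d i)) {z : Ω → P.Point}
    (hz : Measurable z) : Measurable fun ω => P.mean (P.simHist d t ω) (z ω) :=
  (P.measurable_mean_simHist hd).comp (measurable_id.prodMk hz)

theorem measurable_cov_simHist_comp (hd : ∀ i < t, Measurable (d i)) {z z' : Ω → P.Point}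
    (hz : Measurable z) (hz' : Measurable z') :
    Measurable fun ω => P.cov (P.simHist d t ω) (z ω) (z' ω) :=
  (P.measurable_cov_simHist hd).comp (measurable_id.prodMk (hz.prodMk hz'))

theorem measurable_logMGF (hd : ∀ i < t, Measurable (d i)) {n : ℕ} (c : Fin n → ℝ)
    (u : Fin n → P.Point) : Measurable fun ω => P.logMGF c u (P.simHist d t ω) :=
  (measurable_lin c u fun _ => measurable_mean_simHist_comp hd measurable_const).add
    ((measurable_quad c u fun _ _ =>
      measurable_cov_simHist_comp hd measurable_const measurable_const).div_const 2)

end Mble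

/-- The information that determines the choices and the data-source observations. -/
abbrev designInfo (P : Problem D J N R) {Ω E : Type*} [MeasurableSpace E] (aStar : Ω → P.A)
    (U : Ω → E) (d : ℕ → Ω → P.Datum) (t : ℕ) : MeasurableSpace Ω :=
  P.algInfo U d t ⊔ P.paramInfo aStar

theorem designInfo_succ {Ω E : Type*} [MeasurableSpace E] (aStar : Ω → P.A) (U : Ω → E)
    (d : ℕ → Ω → P.Datum) (t : ℕ) : P.designInfo aStar U d (t + 1)
      = P.designInfo aStar U d t ⊔ MeasurableSpace.comap (d t) inferInstance := by
  rw [designInfo, algInfo_succ, designInfo, sup_right_comm]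

theorem designInfo_le_fullInfo {Ω E : Type*} [MeasurableSpace E] (θ : P.Point → Ω → ℝ)
    (aStar : Ω → P.A) (U : Ω → E) (d : ℕ → Ω → P.Datum) (t : ℕ) : P.designInfo aStar U d t ≤ P.fullInfo θ aStar U d t :=
  sup_le_sup_right le_sup_left _

theorem measurable_d_designInfo {Ω E : Type*} [MeasurableSpace E] (aStar : Ω → P.A) (U : Ω → E)
    (d : ℕ → Ω → P.Datum) {i t : ℕ} (hi : i < t) :
    Measurable[P.designInfo aStar U d t] (d i) :=
  (measurable_of_lt_algInfo U d hi).mono le_sup_left le_rfl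

namespace IsRun

variable {Ω E : Type*} [mΩ : MeasurableSpace Ω] [MeasurableSpace E] {ℙr : Measure Ω}
  [IsProbabilityMeasure ℙr] {θ : P.Point → Ω → ℝ} {aStar : Ω → P.A} {U : Ω → E}
  {d : ℕ → Ω → P.Datum} (h : P.IsRun ℙr θ aStar U d)
include h

omit [IsProbabilityMeasure ℙr] in
theorem designInfo_le (t : ℕ) : P.designInfo aStar U d t ≤ mΩ :=
  sup_le (h.algInfo_le t) h.paramInfo_le

omit [IsProbabilityMeasure ℙr] in
theorem measurable_lin_θ {n : ℕ} (c : Fin n → ℝ) (u : Fin n → P.Point) :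
    Measurable fun ω => lin c u (θ · ω) := measurable_lin c u h.θ_measurable

theorem lintegral_exp_lin {n : ℕ} (c : Fin n → ℝ) (u : Fin n → P.Point) :
    ∫⁻ ω, ENNReal.ofReal (Real.exp (lin c u (θ · ω))) ∂ℙr
      = ENNReal.ofReal (Real.exp (P.logMGF c u [])) := by
  have hG : IsGaussianProcess (fun i ω => c i • θ (u i) ω) ℙr :=
    (h.θ_gaussian.comp_right u).smul c
  have hL : HasGaussianLaw (fun ω => lin c u (θ · ω)) ℙr :=
    hG.hasGaussianLaw_fun_sum (I := Finset.univ)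
  have h2 : ∀ i, MemLp (c i • θ (u i)) 2 ℙr := fun i =>
    ((h.θ_gaussian.hasGaussianLaw_eval (u i)).memLp_two).const_smul (c i)
  have hmean : ∫ ω, lin c u (θ · ω) ∂ℙr = lin c u (P.mean []) := by
    unfold lin
    rw [integral_finsetSum _ fun i _ =>
      (h.θ_gaussian.hasGaussianLaw_eval (u i)).integrable.const_mul (c i)]
    refine Finset.sum_congr rfl fun i _ => ?_
    rw [integral_const_mul, h.θ_mean]
    rfl
  have hvar : Var[fun ω => lin c u (θ · ω); ℙr] = quad c u (P.cov []) := by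
    have e : (fun ω => lin c u (θ · ω)) = ∑ i, c i • θ (u i) := by
      ext ω
      simp [lin]
    rw [e, variance_sum h2]
    refine Finset.sum_congr rfl fun i _ => Finset.sum_congr rfl fun j _ => ?_
    rw [covariance_smul_left, covariance_smul_right, h.θ_cov]
    change _ = c i * c j * P.k₀ _ _
    ring
  have hm := h.measurable_lin_θ c u
  have h1 := lintegral_exp_gaussianReal (lin c u (P.mean [])) (quad c u (P.cov [])).toNNReal 0 1
  have hq : 0 ≤ quad c u (P.cov []) := hvar ▸ variance_nonneg _ _
  have hlaw := hL.map_eq_gaussianReal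
  rw [hmean, hvar] at hlaw
  rw [← hlaw, lintegral_map (by fun_prop) hm] at h1
  simpa [logMGF, Real.coe_toNNReal _ hq] using h1

theorem setLIntegral_exp_lin_zero {n : ℕ} (c : Fin n → ℝ) (u : Fin n → P.Point) {A : Set Ω}
    (hA : MeasurableSet[P.designInfo aStar U d 0] A) :
    ∫⁻ ω in A, ENNReal.ofReal (Real.exp (lin c u (θ · ω))) ∂ℙr
      = ∫⁻ ω in A, ENNReal.ofReal (Real.exp (P.logMGF c u (P.simHist d 0 ω))) ∂ℙr := by
  have hA' := h.designInfo_le 0 A hA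
  have hm : Measurable[P.targetInfo θ] fun ω => ENNReal.ofReal (Real.exp (lin c u (θ · ω))) := by
    have : Measurable[P.targetInfo θ] fun ω => lin c u (θ · ω) :=
      @measurable_lin _ _ (P.targetInfo θ) _ c u (fun ω z => θ z ω) fun z =>
        measurable_iff_comap_le.2 (le_iSup_of_le z le_rfl)
    exact (Real.measurable_exp.comp this).ennreal_ofReal
  have h1 := lintegral_mul_eq_lintegral_mul_lintegral_of_independent_measurableSpace
    (h.designInfo_le 0) h.targetInfo_le h.indep_target (measurable_indicator_one hA) hm
  have e : ∀ ω, A.indicator (1 : Ω → ℝ≥0∞) ω * ENNReal.ofReal (Real.exp (lin c u (θ · ω)))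
      = A.indicator (fun ω => ENNReal.ofReal (Real.exp (lin c u (θ · ω)))) ω := fun ω => by
    by_cases hω : ω ∈ A <;> simp [hω]
  rw [lintegral_congr e, lintegral_indicator hA', lintegral_indicator_one hA',
    h.lintegral_exp_lin] at h1
  rw [h1]
  change _ = ∫⁻ ω in A, ENNReal.ofReal (Real.exp (P.logMGF c u [])) ∂ℙr
  rw [setLIntegral_const, mul_comm]

end IsRun

end Problem

namespace Problem

variable {D J N : ℕ} {R : Type*} [MeasurableSpace R] {P : Problem D J N R}

/-- Given the information on the design before iteration `t`, the target function has the Gaussian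
finite-dimensional laws with the posterior mean and covariance. -/
def CondMGF (P : Problem D J N R) {Ω E : Type*} [MeasurableSpace Ω] [MeasurableSpace E]
    (ℙr : Measure Ω) (θ : P.Point → Ω → ℝ) (aStar : Ω → P.A) (U : Ω → E) (d : ℕ → Ω → P.Datum)
    (t : ℕ) : Prop :=
  ∀ (n : ℕ) (c : Fin n → ℝ) (u : Fin n → P.Point) (A : Set Ω),
    MeasurableSet[P.designInfo aStar U d t] A →
    ∫⁻ ω in A, ENNReal.ofReal (Real.exp (lin c u (θ · ω))) ∂ℙr
      = ∫⁻ ω in A, ENNReal.ofReal (Real.exp (P.logMGF c u (P.simHist d t ω))) ∂ℙr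

theorem isCovKernel_cov (hk : IsCovKernel P.k₀) (F : List (P.Point × ℝ)) :
    IsCovKernel (P.cov F) := hk.gpCov P.noiseVar.2 F

theorem abs_logMGF_le (hk : IsCovKernel P.k₀) {K : ℝ} (hK : ∀ z, P.k₀ z z ≤ K) {n : ℕ}
    (c : Fin n → ℝ) (u : Fin n → P.Point) {F : List (P.Point × ℝ)} {M : ℝ}
    (hM : ∀ z, |P.mean F z| ≤ M) :
    |P.logMGF c u F| ≤ (∑ i, |c i|) * M + (∑ i, |c i|) * (∑ i, |c i|) * K / 2 := by
  refine (abs_add_le _ _).trans (add_le_add (abs_lin_le c u hM) ?_)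
  rw [abs_div, abs_two]
  exact div_le_div_of_nonneg_right
    (abs_quad_le c u fun z z' => hk.abs_gpCov_le P.noiseVar.2 hK F z z') zero_le_two

namespace IsRun

variable {Ω E : Type*} [mΩ : MeasurableSpace Ω] [MeasurableSpace E] {ℙr : Measure Ω}
  [IsProbabilityMeasure ℙr] {θ : P.Point → Ω → ℝ} {aStar : Ω → P.A} {U : Ω → E}
  {d : ℕ → Ω → P.Datum} (h : P.IsRun ℙr θ aStar U d)
include h

theorem exists_envelope : ∃ S : Ω → ℝ, Measurable S ∧ (∀ ω z, |θ z ω| ≤ S ω) ∧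
    ∀ c : ℝ, ∫⁻ ω, ENNReal.ofReal (Real.exp (c * S ω)) ∂ℙr ≠ ∞ :=
  BICO.exists_envelope h.θ_gaussian h.θ_measurable h.θ_continuous (by
    simp_rw [h.θ_mean]
    exact P.μ₀_continuous)

/-- For constant `z` and `β` this is `CondMGF` with one more point and coefficient.
Design-measurable ones are limits of simple ones; the bounds assumed on `A` are there for dominated
convergence. -/
theorem setLIntegral_exp_random {t : ℕ} (ih : P.CondMGF ℙr θ aStar U d t) {n : ℕ}
    (c : Fin n → ℝ) (u : Fin n → P.Point) {z : Ω → P.Point}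
    (hz : Measurable[P.designInfo aStar U d t] z) {β : Ω → ℝ}
    (hβ : Measurable[P.designInfo aStar U d t] β) {M : ℝ} {A : Set Ω}
    (hA : MeasurableSet[P.designInfo aStar U d t] A) (hAβ : ∀ ω ∈ A, |β ω| ≤ M)
    (hAM : ∀ ω ∈ A, ∀ z, |P.mean (P.simHist d t ω) z| ≤ M) :
    ∫⁻ ω in A, ENNReal.ofReal (Real.exp (β ω * θ (z ω) ω + lin c u (θ · ω))) ∂ℙr
      = ∫⁻ ω in A, ENNReal.ofReal (Real.exp (β ω * P.mean (P.simHist d t ω) (z ω)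
        + lin c u (P.mean (P.simHist d t ω)) + (β ω ^ 2 * P.cov (P.simHist d t ω) (z ω) (z ω)
          + 2 * β ω * lin c u (P.cov (P.simHist d t ω) · (z ω))
          + quad c u (P.cov (P.simHist d t ω))) / 2)) ∂ℙr := by
  obtain ⟨S, hSm, hS, hSexp⟩ := h.exists_envelope
  obtain ⟨K, hK0, hK⟩ := P.exists_cov_bound
  have hk := h.isCovKernel
  have hle := h.designInfo_le t
  have hA' := hle A hA
  have hd : ∀ i < t, Measurable (d i) := fun i _ => h.d_measurable i
  rcases A.eq_empty_or_nonempty with rfl | ⟨ω₀, hω₀⟩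
  · simp
  have hM : 0 ≤ M := (abs_nonneg _).trans (hAβ ω₀ hω₀)
  have hS0 : ∀ ω, 0 ≤ S ω := fun ω => (abs_nonneg _).trans (hS ω (Classical.arbitrary _))
  set C := ∑ i, |c i| with hC
  have hC0 : 0 ≤ C := Finset.sum_nonneg fun i _ => abs_nonneg _
  let F : P.Point × ℝ → Ω → ℝ≥0∞ := fun τ ω =>
    ENNReal.ofReal (Real.exp (τ.2 * θ τ.1 ω + lin c u (θ · ω)))
  let H : P.Point × ℝ → Ω → ℝ≥0∞ := fun τ ω =>
    ENNReal.ofReal (Real.exp (τ.2 * P.mean (P.simHist d t ω) τ.1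
        + lin c u (P.mean (P.simHist d t ω)) + (τ.2 ^ 2 * P.cov (P.simHist d t ω) τ.1 τ.1
          + 2 * τ.2 * lin c u (P.cov (P.simHist d t ω) · τ.1)
          + quad c u (P.cov (P.simHist d t ω))) / 2))
  have eF : ∀ τ ω, F τ ω = ENNReal.ofReal (Real.exp (lin (Fin.cons τ.2 c : Fin (n + 1) → ℝ)
      (Fin.cons τ.1 u : Fin (n + 1) → P.Point) (θ · ω))) := fun τ ω => by rw [lin_cons]
  have eH : ∀ τ ω, H τ ω = ENNReal.ofReal (Real.exp (P.logMGF (Fin.cons τ.2 c : Fin (n + 1) → ℝ)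
      (Fin.cons τ.1 u : Fin (n + 1) → P.Point) (P.simHist d t ω))) := fun τ ω => by
    rw [logMGF, lin_cons, quad_cons _ _ _ _ (isCovKernel_cov hk _).symm]
  have hsum : ∀ τ : P.Point × ℝ, ∑ i, |(Fin.cons τ.2 c : Fin (n + 1) → ℝ) i| = |τ.2| + C :=
    fun τ => by simp [Fin.sum_univ_succ, hC]
  let s : Set (P.Point × ℝ) := {τ | |τ.2| ≤ M}
  -- Clipping `β` to `[-M, M]` keeps the parameter in `s` outside `A` too, and changes nothing on
  -- `A`.
  let Y : Ω → P.Point × ℝ := fun ω => (z ω, max (-M) (min M (β ω)))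
  have hY : Measurable[P.designInfo aStar U d t] Y :=
    hz.prodMk ((measurable_const.max (measurable_const.min measurable_id)).comp hβ)
  have hYs : ∀ ω, Y ω ∈ s := fun ω =>
    abs_le.2 ⟨le_max_left _ _, max_le (neg_le_self hM) (min_le_left _ _)⟩
  have hYA : ∀ ω ∈ A, Y ω = (z ω, β ω) := fun ω hω => by
    have := abs_le.1 (hAβ ω hω)
    simp only [Y, min_eq_right this.2, max_eq_right this.1]
  have key := @setLIntegral_comp_eq_of_forall Ω Ω (P.Point × ℝ) mΩ (P.designInfo aStar U d t)
    _ _ _ _ (ℙr.restrict A) id (measurable_id'' hle) s ⟨Y ω₀, hYs ω₀⟩ F H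
    (fun τ => ?_) (fun τ => ?_) (fun ω => ?_) (fun ω => ?_)
    (fun ω => ENNReal.ofReal (Real.exp ((M + C) * S ω)))
    (fun _ => ENNReal.ofReal (Real.exp ((M + C) * M + (M + C) * (M + C) * K / 2)))
    ?_ ?_ ?_ ?_ ?_ Y hY hYs Set.univ (@MeasurableSet.univ _ (_))
  · simp only [Set.preimage_univ, Measure.restrict_univ, id] at key
    refine Eq.trans (setLIntegral_congr_fun hA' fun ω hω => ?_)
      (key.trans (setLIntegral_congr_fun hA' fun ω hω => ?_))
    · simp only [F, hYA ω hω]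
    · simp only [H, hYA ω hω]
  · rw [show F τ = _ from funext (eF τ)]
    exact (Real.measurable_exp.comp (h.measurable_lin_θ _ _)).ennreal_ofReal
  · rw [show H τ = _ from funext (eH τ)]
    exact (Real.measurable_exp.comp (measurable_logMGF hd _ _)).ennreal_ofReal
  · have h1 := (h.θ_continuous ω).comp (continuous_fst (X := P.Point) (Y := ℝ))
    exact ENNReal.continuous_ofReal.comp (Real.continuous_exp.comp
      ((continuous_snd.mul h1).add continuous_const))
  · have h1 := (P.continuous_mean (P.simHist d t ω)).comp (continuous_fst (X := P.Point) (Y := ℝ))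
    have h2 := (P.continuous_cov (P.simHist d t ω)).comp
      (f := fun τ : P.Point × ℝ => (τ.1, τ.1)) (by fun_prop)
    have h3 : Continuous fun τ : P.Point × ℝ => lin c u (P.cov (P.simHist d t ω) · τ.1) :=
      continuous_finsetSum _ fun i _ => continuous_const.mul
        ((P.continuous_cov (P.simHist d t ω)).comp (f := fun τ : P.Point × ℝ => (u i, τ.1))
          (by fun_prop))
    exact ENNReal.continuous_ofReal.comp (Real.continuous_exp.comp
      (((continuous_snd.mul h1).add continuous_const).add
        (((((continuous_snd.pow 2).mul h2).add ((continuous_const.mul continuous_snd).mul h3)).add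
          continuous_const).div_const 2)))
  · refine ae_of_all _ fun ω τ hτ => ?_
    rw [eF]
    refine ENNReal.ofReal_le_ofReal (Real.exp_le_exp.2 ((le_abs_self _).trans
      ((abs_lin_le _ _ (hS ω)).trans ?_)))
    rw [hsum]
    exact mul_le_mul_of_nonneg_right (add_le_add_left hτ _) (hS0 ω)
  · refine (ae_restrict_iff' hA').2 (ae_of_all _ fun ω hω τ hτ => ?_)
    rw [eH]
    refine ENNReal.ofReal_le_ofReal (Real.exp_le_exp.2 ((le_abs_self _).trans
      ((abs_logMGF_le hk hK _ _ (hAM ω hω)).trans ?_)))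
    rw [hsum]
    have h1 : |τ.2| + C ≤ M + C := add_le_add_left hτ _
    have h2 : 0 ≤ |τ.2| + C := add_nonneg (abs_nonneg _) hC0
    gcongr
  · exact ne_top_of_le_ne_top (hSexp (M + C)) (setLIntegral_le_lintegral _ _)
  · rw [lintegral_const]
    exact ENNReal.mul_ne_top ENNReal.ofReal_ne_top (measure_ne_top _ _)
  · intro τ _ B hB
    simp only [Set.preimage_id, Measure.restrict_restrict (hle B hB), eF, eH]
    exact ih _ _ _ _ (@MeasurableSet.inter _ (_) _ _ hB hA)

/-- The same with a weight. -/
theorem setLIntegral_mul_exp_random {t : ℕ} (ih : P.CondMGF ℙr θ aStar U d t) {n : ℕ}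
    (c : Fin n → ℝ) (u : Fin n → P.Point) {z : Ω → P.Point}
    (hz : Measurable[P.designInfo aStar U d t] z) {β : Ω → ℝ}
    (hβ : Measurable[P.designInfo aStar U d t] β) {M : ℝ} {A : Set Ω}
    (hA : MeasurableSet[P.designInfo aStar U d t] A) (hAβ : ∀ ω ∈ A, |β ω| ≤ M)
    (hAM : ∀ ω ∈ A, ∀ z, |P.mean (P.simHist d t ω) z| ≤ M)
    {w : Ω → ℝ≥0∞} (hw : Measurable[P.designInfo aStar U d t] w) :
    ∫⁻ ω in A, w ω * ENNReal.ofReal (Real.exp (β ω * θ (z ω) ω + lin c u (θ · ω))) ∂ℙr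
      = ∫⁻ ω in A, w ω * ENNReal.ofReal (Real.exp (β ω * P.mean (P.simHist d t ω) (z ω)
        + lin c u (P.mean (P.simHist d t ω)) + (β ω ^ 2 * P.cov (P.simHist d t ω) (z ω) (z ω)
          + 2 * β ω * lin c u (P.cov (P.simHist d t ω) · (z ω))
          + quad c u (P.cov (P.simHist d t ω))) / 2)) ∂ℙr := by
  have hle := h.designInfo_le t
  have hd : ∀ i < t, Measurable (d i) := fun i _ => h.d_measurable i
  have hz' : Measurable z := hz.mono hle le_rfl
  have hβ' : Measurable β := hβ.mono hle le_rfl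
  have hθz : Measurable fun ω => θ (z ω) ω :=
    (measurable_uncurry_of_continuous_of_measurable h.θ_continuous h.θ_measurable).comp
      (hz'.prodMk measurable_id)
  have h1 := measurable_mean_simHist_comp (P := P) hd hz'
  have h2 := measurable_cov_simHist_comp (P := P) hd hz' hz'
  have h3 : Measurable fun ω => lin c u (P.mean (P.simHist d t ω)) :=
    measurable_lin c u fun z => measurable_mean_simHist_comp hd measurable_const
  have h4 : Measurable fun ω => lin c u (P.cov (P.simHist d t ω) · (z ω)) :=
    measurable_lin c u (f := fun ω x => P.cov (P.simHist d t ω) x (z ω)) fun x =>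
      measurable_cov_simHist_comp hd measurable_const hz'
  have h5 : Measurable fun ω => quad c u (P.cov (P.simHist d t ω)) :=
    measurable_quad c u fun _ _ => measurable_cov_simHist_comp hd measurable_const measurable_const
  refine lintegral_mul_eq_of_forall_setLIntegral_eq hle
    (Real.measurable_exp.comp ((hβ'.mul hθz).add (h.measurable_lin_θ c u))).ennreal_ofReal
    (Real.measurable_exp.comp (((hβ'.mul h1).add h3).add (((((hβ'.pow_const 2).mul h2).add
      ((hβ'.const_mul 2).mul h4)).add h5).div_const 2))).ennreal_ofReal (fun B hB => ?_) hw
  rw [Measure.restrict_restrict (hle B hB)]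
  exact h.setLIntegral_exp_random ih c u hz hβ (@MeasurableSet.inter _ (_) _ _ hB hA)
    (fun ω hω => hAβ ω hω.2) fun ω hω => hAM ω hω.2

end IsRun

end Problem

theorem lin_fin_zero {Z : Type*} (c : Fin 0 → ℝ) (u : Fin 0 → Z) (f : Z → ℝ) : lin c u f = 0 := by
  simp [lin]

theorem quad_fin_zero {Z : Type*} (c : Fin 0 → ℝ) (u : Fin 0 → Z) (k : Z → Z → ℝ) :
    quad c u k = 0 := by
  simp [quad]

namespace Problem

variable {D J N : ℕ} {R : Type*} [MeasurableSpace R] {P : Problem D J N R}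

theorem eq_inl_simPoint {x : P.Datum} (hx : ∃ z, P.action x = .inl z) :
    x = .inl (P.simPoint (P.action x), P.simValue x) := by
  rcases x with q | q
  · rfl
  · obtain ⟨z, hz⟩ := hx
    simp [action] at hz

namespace IsRun

variable {Ω E : Type*} [mΩ : MeasurableSpace Ω] [MeasurableSpace E] {ℙr : Measure Ω}
  [IsProbabilityMeasure ℙr] {θ : P.Point → Ω → ℝ} {aStar : Ω → P.A} {U : Ω → E}
  {d : ℕ → Ω → P.Datum} (h : P.IsRun ℙr θ aStar U d)
include h

/-- Gaussian conjugacy, tested against `exp (b * y)`. On both sides the noise is integrated out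
first and the induction hypothesis then replaces `θ` by its posterior moments: with coefficient `b`
at the new point on the left, and on the right with `ℓ + b`, where `ℓ` is the gain of the linear
combination. The two exponents agree because `ℓ` solves the normal equation. -/
theorem lintegral_exp_logMGF_succ_simValue {t : ℕ} (ih : P.CondMGF ℙr θ aStar U d t) {n : ℕ}
    (c : Fin n → ℝ) (u : Fin n → P.Point) {M : ℝ} {A : Set Ω}
    (hA : MeasurableSet[P.designInfo aStar U d t] A)
    (hAs : ∀ ω ∈ A, ∃ z, P.action (d t ω) = .inl z)
    (hAℓ : ∀ ω ∈ A, |lin c u (P.cov (P.simHist d t ω) · (P.simPoint (P.action (d t ω))))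
      / (P.cov (P.simHist d t ω) (P.simPoint (P.action (d t ω)))
        (P.simPoint (P.action (d t ω))) + P.noiseVar)| ≤ M)
    (hAM : ∀ ω ∈ A, ∀ z, |P.mean (P.simHist d t ω) z| ≤ M) (b : ℝ) :
    ∫⁻ ω in A, ENNReal.ofReal (Real.exp (lin c u (θ · ω) + b * P.simValue (d t ω))) ∂ℙr
      = ∫⁻ ω in A, ENNReal.ofReal (Real.exp (P.logMGF c u (P.simHist d (t + 1) ω)
        + b * P.simValue (d t ω))) ∂ℙr := by
  have hle := h.designInfo_le t
  have hlef := designInfo_le_fullInfo (P := P) θ aStar U d t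
  have hA' := hle A hA
  have hk := h.isCovKernel
  set z : Ω → P.Point := fun ω => P.simPoint (P.action (d t ω)) with hz
  have hzm : Measurable[P.designInfo aStar U d t] z :=
    (P.measurable_simPoint.comp (h.nonanticipating t)).mono le_sup_left le_rfl
  have hd : ∀ i < t, Measurable[P.designInfo aStar U d t] (d i) := fun i hi =>
    measurable_d_designInfo aStar U d hi
  set ℓ : Ω → ℝ := fun ω => lin c u (P.cov (P.simHist d t ω) · (z ω))
    / (P.cov (P.simHist d t ω) (z ω) (z ω) + P.noiseVar) with hℓ
  have hL : Measurable[P.designInfo aStar U d t] fun ω => lin c u (P.cov (P.simHist d t ω) · (z ω)) :=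
    @measurable_lin _ _ (P.designInfo aStar U d t) _ c u
      (fun ω x => P.cov (P.simHist d t ω) x (z ω)) fun x =>
      @measurable_cov_simHist_comp _ _ _ _ _ P Ω (P.designInfo aStar U d t) _ _ hd _ _
        (@measurable_const _ _ _ (_) _) hzm
  have hκ : Measurable[P.designInfo aStar U d t] fun ω => P.cov (P.simHist d t ω) (z ω) (z ω) :=
    @measurable_cov_simHist_comp _ _ _ _ _ P Ω (P.designInfo aStar U d t) _ _ hd _ _ hzm hzm
  have hℓm : Measurable[P.designInfo aStar U d t] ℓ := hL.div (hκ.add_const _)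
  have hμz : Measurable[P.designInfo aStar U d t] fun ω => P.mean (P.simHist d t ω) (z ω) :=
    @measurable_mean_simHist_comp _ _ _ _ _ P Ω (P.designInfo aStar U d t) _ _ hd _ hzm
  have hμ : Measurable[P.designInfo aStar U d t] fun ω => lin c u (P.mean (P.simHist d t ω)) :=
    @measurable_lin _ _ (P.designInfo aStar U d t) _ c u
      (fun ω x => P.mean (P.simHist d t ω) x) fun x =>
      @measurable_mean_simHist_comp _ _ _ _ _ P Ω (P.designInfo aStar U d t) _ _ hd _
        (@measurable_const _ _ _ (_) _)
  have hq : Measurable[P.designInfo aStar U d t] fun ω => quad c u (P.cov (P.simHist d t ω)) :=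
    @measurable_quad _ _ (P.designInfo aStar U d t) _ c u
      (fun ω x => P.cov (P.simHist d t ω) x) fun x y =>
      @measurable_cov_simHist_comp _ _ _ _ _ P Ω (P.designInfo aStar U d t) _ _ hd _ _
        (@measurable_const _ _ _ (_) _) (@measurable_const _ _ _ (_) _)
  set a : Ω → ℝ := fun ω => lin c u (P.mean (P.simHist d t ω))
    - ℓ ω * P.mean (P.simHist d t ω) (z ω)
    + (quad c u (P.cov (P.simHist d t ω)) - ℓ ω * lin c u (P.cov (P.simHist d t ω) · (z ω))) / 2
    with ha
  have ham : Measurable[P.designInfo aStar U d t] a :=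
    (hμ.sub (hℓm.mul hμz)).add ((hq.sub (hℓm.mul hL)).div_const 2)
  have hθm : Measurable[P.fullInfo θ aStar U d t] fun ω => lin c u (θ · ω) :=
    @measurable_lin _ _ (P.fullInfo θ aStar U d t) _ c u (fun ω z => θ z ω) fun z =>
      measurable_iff_comap_le.2 (le_sup_of_le_left (le_sup_of_le_right (le_iSup_of_le z le_rfl)))
  -- the left-hand side
  have hΦ : Measurable fun p : (ℝ × ℝ) × ℝ =>
      ENNReal.ofReal (Real.exp (p.1.1 + p.1.2 * p.2)) := by fun_prop
  have l1 := h.setLIntegral_observation_inl t (X := fun ω => (lin c u (θ · ω), b))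
    (hθm.prodMk (@measurable_const _ _ _ (_) _)) hΦ (hlef A hA) hAs
  simp only [lintegral_exp_gaussianReal] at l1
  have l2 := h.setLIntegral_mul_exp_random ih c u hzm (β := fun _ => b)
    (@measurable_const _ _ _ (_) _) (M := max |b| M) hA (fun ω _ => le_max_left _ _)
    (fun ω hω x => (hAM ω hω x).trans (le_max_right _ _))
    (w := fun _ => ENNReal.ofReal (Real.exp (b ^ 2 * P.noiseVar / 2)))
    (@measurable_const _ _ _ (_) _)
  -- the right-hand side
  have hw : Measurable[P.designInfo aStar U d t] fun ω =>
      ENNReal.ofReal (Real.exp (a ω + (ℓ ω + b) ^ 2 * (P.noiseVar : ℝ) / 2)) :=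
    (ENNReal.measurable_ofReal.comp Real.measurable_exp).comp
      (ham.add ((((hℓm.add_const b).pow_const 2).mul_const (P.noiseVar : ℝ)).div_const 2))
  have r1 := h.setLIntegral_observation_inl t (X := fun ω => (a ω, ℓ ω + b))
    ((ham.prodMk (hℓm.add_const b)).mono hlef le_rfl) hΦ (hlef A hA) hAs
  simp only [lintegral_exp_gaussianReal] at r1
  -- The updated exponent involves `θ` only through `y`. After the noise is integrated out, only `θ
  -- (z ω)` remains, hence the empty linear combination; everything else is a design-measurable
  -- weight.
  have r2 := h.setLIntegral_mul_exp_random ih (fun i : Fin 0 => i.elim0) (fun i : Fin 0 => i.elim0)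
    hzm (β := fun ω => ℓ ω + b) (hℓm.add_const b) (M := M + |b|) hA
    (fun ω hω => (abs_add_le _ _).trans (add_le_add_left (hAℓ ω hω) _))
    (fun ω hω x => (hAM ω hω x).trans (le_add_of_nonneg_right (abs_nonneg _)))
    (w := fun ω => ENNReal.ofReal (Real.exp (a ω + (ℓ ω + b) ^ 2 * P.noiseVar / 2)))
    hw
  simp only [← ENNReal.ofReal_mul (Real.exp_pos _).le, ← Real.exp_add] at l2 r2
  refine l1.trans (Eq.trans ?_ (l2.trans (Eq.trans ?_ (r2.symm.trans (Eq.trans ?_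
    (r1.symm.trans ?_))))))
  · refine setLIntegral_congr_fun hA' fun ω _ => ?_
    change ENNReal.ofReal (Real.exp (lin c u (θ · ω) + b * θ (z ω) ω + b ^ 2 * P.noiseVar / 2)) = _
    congr 2
    ring
  · refine setLIntegral_congr_fun hA' fun ω _ => ?_
    congr 2
    simp only [lin_fin_zero, quad_fin_zero, ha]
    have hkt := isCovKernel_cov hk (P.simHist d t ω)
    -- The normal equation also holds for a vanishing denominator: the variance at `z ω` is then
    -- zero, and Cauchy–Schwarz makes the right-hand side zero.
    have hkey : ℓ ω * (P.cov (P.simHist d t ω) (z ω) (z ω) + P.noiseVar)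
        = lin c u (P.cov (P.simHist d t ω) · (z ω)) := by
      rcases eq_or_ne (P.cov (P.simHist d t ω) (z ω) (z ω) + P.noiseVar) 0 with h0 | h0
      · have h1 := hkt.self_nonneg (z ω)
        have h2 : (0 : ℝ) ≤ P.noiseVar := P.noiseVar.2
        have h3 : P.cov (P.simHist d t ω) (z ω) (z ω) = 0 := by linarith
        have h4 := hkt.sq_lin_le c u (z ω)
        rw [h3, mul_zero] at h4
        rw [h0, mul_zero, pow_eq_zero_iff two_ne_zero |>.1 (le_antisymm h4 (sq_nonneg _))]
      · exact div_mul_cancel₀ _ h0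
    linear_combination (-b - ℓ ω / 2) * hkey
  · refine setLIntegral_congr_fun hA' fun ω _ => ?_
    change _ = ENNReal.ofReal (Real.exp (a ω + (ℓ ω + b) * θ (z ω) ω
      + (ℓ ω + b) ^ 2 * P.noiseVar / 2))
    congr 2
    simp only [lin_fin_zero]
    ring
  · refine setLIntegral_congr_fun hA' fun ω hω => ?_
    congr 2
    have hdt := eq_inl_simPoint (hAs ω hω)
    have e : P.simHist d (t + 1) ω = (z ω, P.simValue (d t ω)) :: P.simHist d t ω := by
      rw [simHist_succ, hdt]
      rfl
    have e2 : lin c u (P.cov (P.simHist d t ω) (z ω) ·)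
        = lin c u (P.cov (P.simHist d t ω) · (z ω)) := by
      simp only [lin, (isCovKernel_cov hk (P.simHist d t ω)).symm (z ω)]
    rw [e, logMGF_cons, e2]
    simp only [ha, hℓ]
    ring

end IsRun

end Problem

/-- A form of the generating-class argument localised to `A`, which lets an induction step treat
each kind of action on its own event. -/
theorem measure_inter_eq_of_forall_inter_preimage {Ω T : Type*} {m m₀ : MeasurableSpace Ω}
    [MeasurableSpace T] (hm : m ≤ m₀) {ν₁ ν₂ : Measure[m₀] Ω} [IsFiniteMeasure ν₁] {Y : Ω → T}
    (hY : Measurable[m₀] Y) {A : Set Ω} (hA : MeasurableSet[m] A)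
    (h : ∀ A', MeasurableSet[m] A' → A' ⊆ A → ∀ B, MeasurableSet B →
      ν₁ (A' ∩ Y ⁻¹' B) = ν₂ (A' ∩ Y ⁻¹' B))
    {E : Set Ω} (hE : MeasurableSet[m ⊔ MeasurableSpace.comap Y inferInstance] E) :
    ν₁ (A ∩ E) = ν₂ (A ∩ E) := by
  have hYm := hY.comap_le
  have hE' := sup_le hm hYm E hE
  have e : MeasurableSpace.comap id m = m := MeasurableSpace.comap_id
  have key := @measure_eq_of_forall_inter_preimage Ω Ω T m₀ m _ (ν₁.restrict A) (ν₂.restrict A) _ id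
    (measurable_id'' hm) Y hY (fun A' hA' B hB => ?_) E (e.symm ▸ hE)
  · rwa [Measure.restrict_apply hE', Measure.restrict_apply hE', Set.inter_comm] at key
  · have h1 : MeasurableSet[m₀] (A' ∩ Y ⁻¹' B) := (hm _ hA').inter (hY hB)
    rw [Set.preimage_id, Measure.restrict_apply h1, Measure.restrict_apply h1, Set.inter_right_comm]
    exact h _ (@MeasurableSet.inter _ (_) _ _ hA' hA) Set.inter_subset_right B hB

namespace Problem

variable {D J N : ℕ} {R : Type*} [MeasurableSpace R] {P : Problem D J N R}

namespace IsRun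

variable {Ω E : Type*} [mΩ : MeasurableSpace Ω] [MeasurableSpace E] {ℙr : Measure Ω}
  [IsProbabilityMeasure ℙr] {θ : P.Point → Ω → ℝ} {aStar : Ω → P.A} {U : Ω → E}
  {d : ℕ → Ω → P.Datum} (h : P.IsRun ℙr θ aStar U d)
include h

theorem lintegral_exp_lin_add_simValue_ne_top (t : ℕ) {n : ℕ} (c : Fin n → ℝ)
    (u : Fin n → P.Point) {A : Set Ω} (hA : MeasurableSet[P.designInfo aStar U d t] A)
    (hAs : ∀ ω ∈ A, ∃ z, P.action (d t ω) = .inl z) (b : ℝ) :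
    ∫⁻ ω in A, ENNReal.ofReal (Real.exp (lin c u (θ · ω) + b * P.simValue (d t ω))) ∂ℙr ≠ ∞ := by
  obtain ⟨S, hSm, hS, hSexp⟩ := h.exists_envelope
  have hθm : Measurable[P.fullInfo θ aStar U d t] fun ω => lin c u (θ · ω) :=
    @measurable_lin _ _ (P.fullInfo θ aStar U d t) _ c u (fun ω z => θ z ω) fun z =>
      measurable_iff_comap_le.2 (le_sup_of_le_left (le_sup_of_le_right (le_iSup_of_le z le_rfl)))
  have hΦ : Measurable fun p : (ℝ × ℝ) × ℝ =>
      ENNReal.ofReal (Real.exp (p.1.1 + p.1.2 * p.2)) := by fun_prop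
  have l1 := h.setLIntegral_observation_inl t (X := fun ω => (lin c u (θ · ω), b))
    (hθm.prodMk (@measurable_const _ _ _ (_) _)) hΦ (designInfo_le_fullInfo θ aStar U d t A hA) hAs
  simp only [lintegral_exp_gaussianReal] at l1
  rw [l1]
  have h2 : ∫⁻ ω, ENNReal.ofReal (Real.exp (b ^ 2 * P.noiseVar / 2)) *
      ENNReal.ofReal (Real.exp ((∑ i, |c i| + |b|) * S ω)) ∂ℙr ≠ ∞ := by
    rw [lintegral_const_mul' _ _ ENNReal.ofReal_ne_top]
    exact ENNReal.mul_ne_top ENNReal.ofReal_ne_top (hSexp _)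
  refine ne_top_of_le_ne_top h2 ((setLIntegral_le_lintegral _ _).trans (lintegral_mono fun ω => ?_))
  rw [← ENNReal.ofReal_mul (Real.exp_pos _).le, ← Real.exp_add]
  refine ENNReal.ofReal_le_ofReal (Real.exp_le_exp.2 ?_)
  have h3 := (le_abs_self _).trans (abs_lin_le c u (hS ω))
  have h4 : b * θ (P.simPoint (P.action (d t ω))) ω ≤ |b| * S ω :=
    (le_abs_self _).trans ((abs_mul _ _).trans_le
      (mul_le_mul_of_nonneg_left (hS ω _) (abs_nonneg b)))
  linarith

theorem lintegral_exp_lin_ne_top {n : ℕ} (c : Fin n → ℝ) (u : Fin n → P.Point) :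
    ∫⁻ ω, ENNReal.ofReal (Real.exp (lin c u (θ · ω))) ∂ℙr ≠ ∞ := by
  rw [h.lintegral_exp_lin]
  exact ENNReal.ofReal_ne_top

/-- On `A` the iteration adds only the value `y` to the design information, the point being already
determined. It is enough to compare, on each design event, the image measures under `y`, and these
have equal exponential moments by the conjugacy computation. -/
theorem withDensity_logMGF_succ_of_bound {t : ℕ} (ih : P.CondMGF ℙr θ aStar U d t) {n : ℕ}
    (c : Fin n → ℝ) (u : Fin n → P.Point) {M : ℝ} {A : Set Ω}
    (hA : MeasurableSet[P.designInfo aStar U d t] A)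
    (hAs : ∀ ω ∈ A, ∃ z, P.action (d t ω) = .inl z)
    (hAℓ : ∀ ω ∈ A, |lin c u (P.cov (P.simHist d t ω) · (P.simPoint (P.action (d t ω))))
      / (P.cov (P.simHist d t ω) (P.simPoint (P.action (d t ω)))
        (P.simPoint (P.action (d t ω))) + P.noiseVar)| ≤ M)
    (hAM : ∀ ω ∈ A, ∀ z, |P.mean (P.simHist d t ω) z| ≤ M)
    {E : Set Ω} (hE : MeasurableSet[P.designInfo aStar U d (t + 1)] E) :
    ℙr.withDensity (fun ω => ENNReal.ofReal (Real.exp (lin c u (θ · ω)))) (A ∩ E)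
      = ℙr.withDensity (fun ω => ENNReal.ofReal (Real.exp (P.logMGF c u (P.simHist d (t + 1) ω))))
        (A ∩ E) := by
  have hle := h.designInfo_le t
  set y : Ω → ℝ := fun ω => P.simValue (d t ω) with hy
  have hym : Measurable y := P.measurable_simValue.comp (h.d_measurable t)
  set f₁ : Ω → ℝ≥0∞ := fun ω => ENNReal.ofReal (Real.exp (lin c u (θ · ω))) with hf₁
  set f₂ : Ω → ℝ≥0∞ := fun ω =>
    ENNReal.ofReal (Real.exp (P.logMGF c u (P.simHist d (t + 1) ω))) with hf₂
  have hm₁ : Measurable f₁ := (Real.measurable_exp.comp (h.measurable_lin_θ c u)).ennreal_ofReal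
  have hm₂ : Measurable f₂ :=
    (Real.measurable_exp.comp (measurable_logMGF (fun i _ => h.d_measurable i) c u)).ennreal_ofReal
  have : IsFiniteMeasure (ℙr.withDensity f₁) :=
    isFiniteMeasure_withDensity (h.lintegral_exp_lin_ne_top c u)
  -- On `A` the datum is a function of the design and of `y`, so `E` has the same trace on `A` as a
  -- set generated by these two.
  have hE2 : ∃ E', MeasurableSet[P.designInfo aStar U d t ⊔ MeasurableSpace.comap y inferInstance] E'
      ∧ A ∩ E = A ∩ E' := by
    have hE3 : MeasurableSet[P.designInfo aStar U d t
        ⊔ MeasurableSpace.comap (d t) inferInstance] E := designInfo_succ aStar U d t ▸ hE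
    have e : MeasurableSpace.comap id (P.designInfo aStar U d t) = P.designInfo aStar U d t :=
      MeasurableSpace.comap_id
    rw [← e, ← @MeasurableSpace.comap_prodMk _ _ _ (P.designInfo aStar U d t) _ id (d t)] at hE3
    obtain ⟨B, hB, rfl⟩ := hE3
    refine ⟨(fun ω => (ω, (.inl (P.simPoint (P.action (d t ω)), y ω) : P.Datum))) ⁻¹' B, ?_, ?_⟩
    · have hz : Measurable[P.designInfo aStar U d t] fun ω => P.simPoint (P.action (d t ω)) :=
        (P.measurable_simPoint.comp (h.nonanticipating t)).mono le_sup_left le_rfl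
      have h1 : Measurable[P.designInfo aStar U d t ⊔ MeasurableSpace.comap y inferInstance,
          P.designInfo aStar U d t] (id : Ω → Ω) := measurable_id'' le_sup_left
      exact @Measurable.prodMk _ (_) _ _ (P.designInfo aStar U d t) _ _ _ h1
        (measurable_inl.comp ((hz.mono le_sup_left le_rfl).prodMk
          (measurable_iff_comap_le.2 le_sup_right))) B hB
    · ext ω
      simp only [Set.mem_inter_iff, Set.mem_preimage, id]
      refine and_congr_right fun hω => ?_
      conv_lhs => rw [eq_inl_simPoint (hAs ω hω)]
  obtain ⟨E', hE', e⟩ := hE2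
  rw [e]
  refine measure_inter_eq_of_forall_inter_preimage hle hym hA (fun A' hA' hA'A B hB => ?_) hE'
  have hA'm := hle A' hA'
  have key : ((ℙr.restrict A').withDensity f₁).map y = ((ℙr.restrict A').withDensity f₂).map y := by
    have hmul : ∀ (F : Ω → ℝ) (b : ℝ) (f : Ω → ℝ≥0∞), Measurable f →
        (∀ ω, f ω = ENNReal.ofReal (Real.exp (F ω))) →
        ∫⁻ x, ENNReal.ofReal (Real.exp (b * x)) ∂(((ℙr.restrict A').withDensity f).map y)
          = ∫⁻ ω in A', ENNReal.ofReal (Real.exp (F ω + b * y ω)) ∂ℙr := fun F b f hf hfF => by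
      have hg : Measurable fun x : ℝ => ENNReal.ofReal (Real.exp (b * x)) := by fun_prop
      have hgy : Measurable fun ω => ENNReal.ofReal (Real.exp (b * y ω)) := hg.comp hym
      rw [lintegral_map hg hym, lintegral_withDensity_eq_lintegral_mul _ hf hgy]
      refine lintegral_congr fun ω => ?_
      rw [Pi.mul_apply, hfF, ← ENNReal.ofReal_mul (Real.exp_pos _).le, ← Real.exp_add]
    have heq : ∀ b : ℝ, ∫⁻ x, ENNReal.ofReal (Real.exp (b * x))
        ∂(((ℙr.restrict A').withDensity f₁).map y) = ∫⁻ x, ENNReal.ofReal (Real.exp (b * x))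
        ∂(((ℙr.restrict A').withDensity f₂).map y) := fun b => by
      rw [hmul _ b f₁ hm₁ fun _ => rfl, hmul _ b f₂ hm₂ fun _ => rfl]
      exact h.lintegral_exp_logMGF_succ_simValue ih c u hA' (fun ω hω => hAs ω (hA'A hω))
        (fun ω hω => hAℓ ω (hA'A hω)) (fun ω hω => hAM ω (hA'A hω)) b
    have hfin : ∀ b : ℝ, ∫⁻ x, ENNReal.ofReal (Real.exp (b * x))
        ∂(((ℙr.restrict A').withDensity f₁).map y) ≠ ∞ := fun b => by
      rw [hmul _ b f₁ hm₁ fun _ => rfl]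
      exact h.lintegral_exp_lin_add_simValue_ne_top t c u hA' (fun ω hω => hAs ω (hA'A hω)) b
    have i1 : IsFiniteMeasure (((ℙr.restrict A').withDensity f₁).map y) :=
      ⟨by simpa using (hfin 0).lt_top⟩
    have i2 : IsFiniteMeasure (((ℙr.restrict A').withDensity f₂).map y) :=
      ⟨by have := heq 0 ▸ hfin 0; simpa using this.lt_top⟩
    exact measure_ext_of_lintegral_exp hfin heq
  have hB' : MeasurableSet (y ⁻¹' B) := hym hB
  have := congrArg (· B) key
  simp only [Measure.map_apply hym hB, withDensity_apply _ hB', Measure.restrict_restrict hB'] at this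
  rw [withDensity_apply _ (hA'm.inter hB'), withDensity_apply _ (hA'm.inter hB'), Set.inter_comm]
  exact this

/-- The boundedness assumptions are removed by exhausting `Ω` with the events on which the gain and
the posterior mean are at most `M`. A dense sequence of points makes these events measurable;
compactness makes them cover `Ω`. -/
theorem withDensity_logMGF_succ_inl {t : ℕ} (ih : P.CondMGF ℙr θ aStar U d t) {n : ℕ}
    (c : Fin n → ℝ) (u : Fin n → P.Point) {A : Set Ω}
    (hA : MeasurableSet[P.designInfo aStar U d t] A)
    (hAs : ∀ ω ∈ A, ∃ z, P.action (d t ω) = .inl z)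
    {E : Set Ω} (hE : MeasurableSet[P.designInfo aStar U d (t + 1)] E) :
    ℙr.withDensity (fun ω => ENNReal.ofReal (Real.exp (lin c u (θ · ω)))) (A ∩ E)
      = ℙr.withDensity (fun ω => ENNReal.ofReal (Real.exp (P.logMGF c u (P.simHist d (t + 1) ω))))
        (A ∩ E) := by
  have hd : ∀ i < t, Measurable[P.designInfo aStar U d t] (d i) := fun i hi =>
    measurable_d_designInfo aStar U d hi
  set z : Ω → P.Point := fun ω => P.simPoint (P.action (d t ω)) with hz
  have hzm : Measurable[P.designInfo aStar U d t] z :=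
    (P.measurable_simPoint.comp (h.nonanticipating t)).mono le_sup_left le_rfl
  set ℓ : Ω → ℝ := fun ω => lin c u (P.cov (P.simHist d t ω) · (z ω))
    / (P.cov (P.simHist d t ω) (z ω) (z ω) + P.noiseVar) with hℓ
  have hL : Measurable[P.designInfo aStar U d t] fun ω => lin c u (P.cov (P.simHist d t ω) · (z ω)) :=
    @measurable_lin _ _ (P.designInfo aStar U d t) _ c u
      (fun ω x => P.cov (P.simHist d t ω) x (z ω)) fun x =>
      @measurable_cov_simHist_comp _ _ _ _ _ P Ω (P.designInfo aStar U d t) _ _ hd _ _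
        (@measurable_const _ _ _ (_) _) hzm
  have hκ : Measurable[P.designInfo aStar U d t] fun ω => P.cov (P.simHist d t ω) (z ω) (z ω) :=
    @measurable_cov_simHist_comp _ _ _ _ _ P Ω (P.designInfo aStar U d t) _ _ hd _ _ hzm hzm
  have hℓm : Measurable[P.designInfo aStar U d t] ℓ := hL.div (hκ.add_const _)
  let u' : ℕ → P.Point := TopologicalSpace.denseSeq P.Point
  have hμ : ∀ j, Measurable[P.designInfo aStar U d t] fun ω => P.mean (P.simHist d t ω) (u' j) :=
    fun j => @measurable_mean_simHist_comp _ _ _ _ _ P Ω (P.designInfo aStar U d t) _ _ hd _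
      (@measurable_const _ _ _ (_) _)
  let T : ℕ → Set Ω := fun M => {ω | |ℓ ω| ≤ M} ∩ ⋂ j, {ω | |P.mean (P.simHist d t ω) (u' j)| ≤ M}
  have hTm : ∀ M, MeasurableSet[P.designInfo aStar U d t] (T M) := fun M =>
    @MeasurableSet.inter _ (_) _ _
      ((continuous_abs.measurable.comp hℓm) measurableSet_Iic)
      (@MeasurableSet.iInter _ _ (_) _ _ fun j =>
        (continuous_abs.measurable.comp (hμ j)) measurableSet_Iic)
  have hT : ∀ M, ∀ ω ∈ T M, ∀ x, |P.mean (P.simHist d t ω) x| ≤ M := fun M ω hω x => by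
    have hc : IsClosed {x | |P.mean (P.simHist d t ω) x| ≤ (M : ℝ)} :=
      isClosed_le (P.continuous_mean _).abs continuous_const
    have h1 : Set.range u' ⊆ {x | |P.mean (P.simHist d t ω) x| ≤ (M : ℝ)} := by
      rintro _ ⟨j, rfl⟩
      exact Set.mem_iInter.1 hω.2 j
    exact hc.closure_subset_iff.2 h1 (TopologicalSpace.denseRange_denseSeq P.Point x)
  have hTU : ⋃ M, T M = Set.univ := by
    refine Set.eq_univ_of_forall fun ω => ?_
    obtain ⟨K, hK⟩ := isCompact_univ.exists_bound_of_continuousOn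
      (P.continuous_mean (P.simHist d t ω)).continuousOn
    obtain ⟨M, hM⟩ := exists_nat_ge (max |ℓ ω| K)
    exact Set.mem_iUnion.2 ⟨M, (le_max_left _ _).trans hM, Set.mem_iInter.2 fun j =>
      (hK _ trivial).trans ((le_max_right _ _).trans hM)⟩
  have hTmono : Monotone T := fun M M' hMM ω hω => by
    have h1 : (M : ℝ) ≤ M' := Nat.cast_le.2 hMM
    exact ⟨le_trans (show |ℓ ω| ≤ _ from hω.1) h1, Set.mem_iInter.2 fun j =>
      le_trans (show |P.mean (P.simHist d t ω) (u' j)| ≤ _ from Set.mem_iInter.1 hω.2 j) h1⟩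
  have e : A ∩ E = ⋃ M, (A ∩ T M) ∩ E := by
    rw [← Set.iUnion_inter, ← Set.inter_iUnion, hTU, Set.inter_univ]
  have hmono : Monotone fun M => (A ∩ T M) ∩ E := fun M M' hMM =>
    Set.inter_subset_inter_left _ (Set.inter_subset_inter_right _ (hTmono hMM))
  rw [e, hmono.measure_iUnion, hmono.measure_iUnion]
  exact iSup_congr fun M => h.withDensity_logMGF_succ_of_bound ih c u
    (@MeasurableSet.inter _ (_) _ _ hA (hTm M)) (fun ω hω => hAs ω hω.1)
    (fun ω hω => hω.2.1) (fun ω hω => hT M ω hω.2) hE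

theorem setLIntegral_mul_indicator_observation {t : ℕ} {s : Fin N} {A : Set Ω}
    (hA : MeasurableSet[P.fullInfo θ aStar U d t] A) (hAs : ∀ ω ∈ A, P.action (d t ω) = .inr s)
    {B : Set P.Datum} (hB : MeasurableSet B) {f : Ω → ℝ≥0∞}
    (hf : Measurable[P.fullInfo θ aStar U d t] f) :
    ∫⁻ ω in A ∩ d t ⁻¹' B, f ω ∂ℙr = ∫⁻ ω in A, (∫⁻ r, P.lik s (aStar ω) r
      * B.indicator 1 (.inr (s, r) : P.Datum) ∂(P.ref s)) * f ω ∂ℙr := by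
  have hB' : MeasurableSet (d t ⁻¹' B) := h.d_measurable t hB
  have h1B : Measurable (B.indicator (1 : P.Datum → ℝ≥0∞)) := measurable_one.indicator hB
  have h1 := h.setLIntegral_observation_inr t hf (Φ := fun p => p.1 * B.indicator 1 p.2)
    (measurable_fst.mul (h1B.comp measurable_snd)) hA hAs
  rw [Set.inter_comm, ← Measure.restrict_restrict hB', ← lintegral_indicator hB']
  refine Eq.trans (lintegral_congr fun ω => ?_) (h1.trans (lintegral_congr fun ω => ?_))
  · by_cases hω : d t ω ∈ B <;> simp [hω]
  · have h2 : Measurable fun r => (P.lik s (aStar ω) r : ℝ≥0∞)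
        * B.indicator 1 (.inr (s, r) : P.Datum) :=
      (((P.lik_measurable s).comp (f := fun r => (aStar ω, r)) (by fun_prop)).coe_nnreal_ennreal).mul
        (h1B.comp (by fun_prop))
    rw [mul_comm, ← lintegral_const_mul _ h2]
    exact lintegral_congr fun r => by ring

omit h in
theorem measurable_lintegral_lik {Ω : Type*} [MeasurableSpace Ω] {a : Ω → P.A} (ha : Measurable a)
    (s : Fin N) {g : Ω × R → ℝ≥0∞} (hg : Measurable g) :
    Measurable fun ω => ∫⁻ r, P.lik s (a ω) r * g (ω, r) ∂(P.ref s) := by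
  refine Measurable.lintegral_prod_right' (ν := P.ref s) (f := fun p : Ω × R => P.lik s (a p.1) p.2
    * g p) (Measurable.mul ?_ hg)
  exact ((P.lik_measurable s).comp (f := fun p : Ω × R => (a p.1, p.2))
      (by fun_prop)).coe_nnreal_ennreal

/-- A query leaves the simulation data unchanged, and the law of its result depends on `aStar`
alone. It enters as a design-measurable weight, which the induction hypothesis tolerates. -/
theorem withDensity_logMGF_succ_inr {t : ℕ} (ih : P.CondMGF ℙr θ aStar U d t) {n : ℕ}
    (c : Fin n → ℝ) (u : Fin n → P.Point) {s : Fin N} {A : Set Ω}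
    (hA : MeasurableSet[P.designInfo aStar U d t] A)
    (hAs : ∀ ω ∈ A, P.action (d t ω) = .inr s)
    {E : Set Ω} (hE : MeasurableSet[P.designInfo aStar U d (t + 1)] E) :
    ℙr.withDensity (fun ω => ENNReal.ofReal (Real.exp (lin c u (θ · ω)))) (A ∩ E)
      = ℙr.withDensity (fun ω => ENNReal.ofReal (Real.exp (P.logMGF c u (P.simHist d (t + 1) ω))))
        (A ∩ E) := by
  have hle := h.designInfo_le t
  have hlef := designInfo_le_fullInfo (P := P) θ aStar U d t
  have : IsFiniteMeasure (ℙr.withDensity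
      (fun ω => ENNReal.ofReal (Real.exp (lin c u (θ · ω))))) :=
    isFiniteMeasure_withDensity (h.lintegral_exp_lin_ne_top c u)
  refine measure_inter_eq_of_forall_inter_preimage hle (h.d_measurable t) hA
    (fun A' hA' hA'A B hB => ?_) (designInfo_succ aStar U d t ▸ hE)
  have hAB : MeasurableSet (A' ∩ d t ⁻¹' B) := (hle _ hA').inter (h.d_measurable t hB)
  have h1B : Measurable (B.indicator (1 : P.Datum → ℝ≥0∞)) := measurable_one.indicator hB
  have hA's : ∀ ω ∈ A', P.action (d t ω) = .inr s := fun ω hω => hAs ω (hA'A hω)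
  rw [withDensity_apply _ hAB, withDensity_apply _ hAB]
  have e : ∀ ω ∈ A' ∩ d t ⁻¹' B,
      ENNReal.ofReal (Real.exp (P.logMGF c u (P.simHist d (t + 1) ω)))
      = ENNReal.ofReal (Real.exp (P.logMGF c u (P.simHist d t ω))) := fun ω hω => by
    have := hA's ω hω.1
    rcases hdt : d t ω with q | q
    · rw [hdt] at this
      simp [action] at this
    · rw [simHist_succ, hdt]
      rfl
  rw [setLIntegral_congr_fun hAB e]
  have hθm : Measurable[P.fullInfo θ aStar U d t] fun ω => lin c u (θ · ω) :=
    @measurable_lin _ _ (P.fullInfo θ aStar U d t) _ c u (fun ω z => θ z ω) fun z =>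
      measurable_iff_comap_le.2 (le_sup_of_le_left (le_sup_of_le_right (le_iSup_of_le z le_rfl)))
  have hlm : Measurable[P.designInfo aStar U d t] fun ω => P.logMGF c u (P.simHist d t ω) :=
    @measurable_logMGF _ _ _ _ _ P Ω (P.designInfo aStar U d t) _ _
      (fun i hi => measurable_d_designInfo aStar U d hi) _ c u
  have hexp : Measurable fun x : ℝ => ENNReal.ofReal (Real.exp x) :=
    Real.measurable_exp.ennreal_ofReal
  have h1 := h.setLIntegral_mul_indicator_observation (hlef _ hA') hA's hB (hexp.comp hθm)
  have h2 := h.setLIntegral_mul_indicator_observation (hlef _ hA') hA's hB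
    ((hexp.comp hlm).mono hlef le_rfl)
  refine h1.trans (Eq.trans ?_ h2.symm)
  refine lintegral_mul_eq_of_forall_setLIntegral_eq (μ := ℙr.restrict A') hle
    (hexp.comp (h.measurable_lin_θ c u)) ((hexp.comp hlm).mono hle le_rfl) (fun C hC => ?_) ?_
  · rw [Measure.restrict_restrict (hle C hC)]
    exact ih n c u _ (@MeasurableSet.inter _ (_) _ _ hC hA')
  · exact @measurable_lintegral_lik _ _ _ _ _ P Ω (P.designInfo aStar U d t) aStar
      (measurable_iff_comap_le.2 le_sup_right) s _
      (h1B.comp (measurable_inr.comp (measurable_const.prodMk (@measurable_snd _ _ (_) _))))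

end IsRun

/-- The sets of histories on which a given source, or the simulator (`none`), is chosen. -/
def choiceSet (P : Problem D J N R) {Ω : Type*} (x : Ω → P.Action) : Option (Fin N) → Set Ω
  | none => {ω | ∃ z, x ω = .inl z}
  | some s => {ω | x ω = .inr s}

theorem iUnion_choiceSet {Ω : Type*} (x : Ω → P.Action) : ⋃ o, P.choiceSet x o = Set.univ := by
  refine Set.eq_univ_of_forall fun ω => Set.mem_iUnion.2 ?_
  rcases hx : x ω with z | s
  · exact ⟨none, z, hx⟩
  · exact ⟨some s, hx⟩

theorem measurableSet_choiceSet {Ω : Type*} [MeasurableSpace Ω] {x : Ω → P.Action}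
    (hx : Measurable x) (o : Option (Fin N)) : MeasurableSet (P.choiceSet x o) := by
  rcases o with _ | s
  · have : P.choiceSet x none = x ⁻¹' (Set.range Sum.inl) := by
      ext ω
      simp only [choiceSet, Set.mem_ofPred_eq, Set.mem_preimage, Set.mem_range, eq_comm]
    rw [this]
    exact hx measurableSet_range_inl
  · have : P.choiceSet x (some s) = x ⁻¹' (Sum.inr '' {s}) := by
      ext ω
      simp [choiceSet]
    rw [this]
    exact hx (measurableSet_inr_image.2 (measurableSet_singleton s))

/-- The kind of action gives a countable partition. All simulation points are put in one class,
since there may be uncountably many. -/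
theorem measure_eq_of_forall_choiceSet {Ω : Type*} {m m₀ : MeasurableSpace Ω} (hm : m ≤ m₀)
    {ν₁ ν₂ : Measure[m₀] Ω} {x : Ω → P.Action} (hx : Measurable[m] x)
    (h : ∀ o E, MeasurableSet[m] E → ν₁ (P.choiceSet x o ∩ E) = ν₂ (P.choiceSet x o ∩ E))
    {E : Set Ω} (hE : MeasurableSet[m] E) : ν₁ E = ν₂ E := by
  have hc := fun o => @measurableSet_choiceSet _ _ _ _ _ P Ω m x hx o
  have key : ν₁.trim hm = ν₂.trim hm := by
    refine (@Measure.ext_iff_of_iUnion_eq_univ _ _ m _ _ _ _ (iUnion_choiceSet x)).2 fun o => ?_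
    refine @Measure.ext _ m _ _ fun E hE => ?_
    have h1 := @MeasurableSet.inter _ m _ _ hE (hc o)
    rw [Measure.restrict_apply hE, Measure.restrict_apply hE, trim_measurableSet_eq hm h1,
      trim_measurableSet_eq hm h1, Set.inter_comm]
    exact h o E hE
  rw [← trim_measurableSet_eq hm hE, key, trim_measurableSet_eq hm hE]

namespace IsRun

variable {Ω E : Type*} [mΩ : MeasurableSpace Ω] [MeasurableSpace E] {ℙr : Measure Ω}
  [IsProbabilityMeasure ℙr] {θ : P.Point → Ω → ℝ} {aStar : Ω → P.A} {U : Ω → E}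
  {d : ℕ → Ω → P.Datum} (h : P.IsRun ℙr θ aStar U d)
include h

/-- The parameter belongs to the design information so that the law of a source observation is known
given the design; initially `θ` is independent of this information. -/
theorem condMGF (t : ℕ) : P.CondMGF ℙr θ aStar U d t := by
  induction t with
  | zero => exact fun n c u A hA => h.setLIntegral_exp_lin_zero c u hA
  | succ t ih =>
    intro n c u A hA
    have hle := h.designInfo_le (t + 1)
    have ha : Measurable[P.designInfo aStar U d t] fun ω => P.action (d t ω) :=
      (h.nonanticipating t).mono le_sup_left le_rfl
    have hmono : P.designInfo aStar U d t ≤ P.designInfo aStar U d (t + 1) := by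
      rw [designInfo_succ]
      exact le_sup_left
    rw [← withDensity_apply _ (hle A hA), ← withDensity_apply _ (hle A hA)]
    refine measure_eq_of_forall_choiceSet hle (ha.mono hmono le_rfl) (fun o E hE => ?_) hA
    have hc := @measurableSet_choiceSet _ _ _ _ _ P Ω (P.designInfo aStar U d t) _ ha o
    rcases o with _ | s
    · exact h.withDensity_logMGF_succ_inl ih c u hc (fun ω hω => hω) hE
    · exact h.withDensity_logMGF_succ_inr ih c u hc (fun ω hω => hω) hE

end IsRun

end Problem

/-! ### The conditional law of the parameter -/

namespace Problem

variable {D J N : ℕ} {R : Type*} [MeasurableSpace R] {P : Problem D J N R}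

theorem measurable_lik (s : Fin N) (r : R) : Measurable fun a => (P.lik s a r : ℝ≥0∞) :=
  ((P.lik_measurable s).comp (f := fun a => (a, r)) (by fun_prop)).coe_nnreal_ennreal

theorem measurable_prod_lik (Rm : List (Fin N × R)) :
    Measurable fun a => ((Rm.map fun q => P.lik q.1 a q.2).prod : ℝ≥0) := by
  induction Rm with
  | nil => exact measurable_const
  | cons q Rm ih =>
    simp only [List.map_cons, List.prod_cons]
    exact ((P.lik_measurable q.1).comp (f := fun a => (a, q.2)) (by fun_prop)).mul ih

theorem posterior_nil : P.posterior [] = P.prior := by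
  simp [posterior, unnormPosterior]

theorem unnormPosterior_cons (s : Fin N) (r : R) (Rm : List (Fin N × R)) :
    P.unnormPosterior ((s, r) :: Rm)
      = (P.unnormPosterior Rm).withDensity fun a => (P.lik s a r : ℝ≥0∞) := by
  rw [unnormPosterior, unnormPosterior, ← withDensity_mul _
    (measurable_prod_lik Rm).coe_nnreal_ennreal (measurable_lik s r)]
  congr 1
  ext a
  simp [mul_comm]

/-- The predictive density of the next data point of a source. -/
def predDensity (P : Problem D J N R) (Rm : List (Fin N × R)) (s : Fin N) (r : R) : ℝ≥0∞ :=
  ∫⁻ a, P.lik s a r ∂(P.posterior Rm)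

/-- Bayes' rule. -/
theorem posterior_cons_mul_predDensity (Rm : List (Fin N × R)) (s : Fin N) {r : R}
    (hq : P.predDensity Rm s r ≠ ∞) {C : Set P.A} (hC : MeasurableSet C) :
    P.posterior ((s, r) :: Rm) C * P.predDensity Rm s r
      = ∫⁻ a in C, P.lik s a r ∂(P.posterior Rm) := by
  have h1 : P.predDensity Rm s r = (P.unnormPosterior Rm Set.univ)⁻¹
      * P.unnormPosterior ((s, r) :: Rm) Set.univ := by
    rw [predDensity, posterior, lintegral_smul_measure, unnormPosterior_cons,
      withDensity_apply _ MeasurableSet.univ, Measure.restrict_univ, smul_eq_mul]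
  have h2 : ∫⁻ a in C, P.lik s a r ∂(P.posterior Rm) = (P.unnormPosterior Rm Set.univ)⁻¹
      * P.unnormPosterior ((s, r) :: Rm) C := by
    rw [posterior, Measure.restrict_smul, lintegral_smul_measure, unnormPosterior_cons,
      withDensity_apply _ hC, smul_eq_mul]
  have h3 : P.unnormPosterior ((s, r) :: Rm) C ≤ P.unnormPosterior ((s, r) :: Rm) Set.univ :=
    measure_mono (Set.subset_univ _)
  rw [h2, h1, posterior, Measure.smul_apply, smul_eq_mul]
  rw [h1] at hq
  set Z' := P.unnormPosterior ((s, r) :: Rm) Set.univ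
  -- Multiplying out the predictive density covers degenerate evidence. If `Z'` is zero, both sides
  -- vanish; if `Z'` is infinite, finiteness of the predictive density forces the inverse evidence
  -- of `Rm` to be zero.
  rcases eq_or_ne Z' 0 with h0 | h0
  · rw [h0, nonpos_iff_eq_zero] at h3
    simp [h3]
  · rcases eq_or_ne Z' ∞ with ht | ht
    · have : (P.unnormPosterior Rm Set.univ)⁻¹ = 0 := by
        by_contra hne
        exact hq (by rw [ht, ENNReal.mul_top hne])
      simp [this]
    · rw [show ∀ a b c : ℝ≥0∞, a * b * (c * Z') = Z' * a * (c * b) by intros; ring,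
        ENNReal.mul_inv_cancel h0 ht, one_mul]

theorem lintegral_predDensity (Rm : List (Fin N × R)) (s : Fin N) :
    ∫⁻ r, P.predDensity Rm s r ∂(P.ref s) = P.posterior Rm Set.univ := by
  unfold predDensity
  rw [lintegral_lintegral_swap
    ((P.lik_measurable s).comp measurable_swap).coe_nnreal_ennreal.aemeasurable]
  simp [P.lik_prob]

theorem ae_predDensity_ne_top (Rm : List (Fin N × R)) (s : Fin N) :
    ∀ᵐ r ∂(P.ref s), P.predDensity Rm s r ≠ ∞ := by
  have hm : Measurable fun r => P.predDensity Rm s r :=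
    ((P.lik_measurable s).comp measurable_swap).coe_nnreal_ennreal.lintegral_prod_right'
  refine (ae_lt_top hm ?_).mono fun r hr => hr.ne
  rw [lintegral_predDensity]
  exact measure_ne_top _ _

section Mble

/-- The posterior probability of `C` after the datum `x`. -/
def nextPosterior (P : Problem D J N R) (C : Set P.A) (Rm : List (Fin N × R)) (x : P.Datum) : ℝ≥0∞ :=
  x.elim (fun _ => P.posterior Rm C) fun q => P.posterior (q :: Rm) C

variable {Ω : Type*} [MeasurableSpace Ω] {d : ℕ → Ω → P.Datum} {t : ℕ}

theorem measurable_posterior_cons_srcHist (hd : ∀ i < t, Measurable (d i)) (s : Fin N) {C : Set P.A}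
    (hC : MeasurableSet C) :
    Measurable fun p : Ω × R => P.posterior ((s, p.2) :: P.srcHist d t p.1) C := by
  have h : Measurable fun p : (Ω × R) × P.A =>
      ((((s, p.1.2) :: P.srcHist d t p.1.1).map fun q => P.lik q.1 p.2 q.2).prod : ℝ≥0) := by
    simp only [List.map_cons, List.prod_cons]
    exact ((P.lik_measurable s).comp (f := fun p : (Ω × R) × P.A => (p.2, p.1.2)) (by fun_prop)).mul
      ((P.measurable_prod_lik_srcHist hd).comp (f := fun p : (Ω × R) × P.A => (p.1.1, p.2))
        (by fun_prop))
  have hB : ∀ B : Set P.A, MeasurableSet B →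
      Measurable fun p : Ω × R => P.unnormPosterior ((s, p.2) :: P.srcHist d t p.1) B := fun B hB => by
    simp only [unnormPosterior, withDensity_apply _ hB]
    exact h.coe_nnreal_ennreal.lintegral_prod_right'
  simp only [posterior, Measure.smul_apply, smul_eq_mul]
  exact (hB _ MeasurableSet.univ).inv.mul (hB C hC)

theorem measurable_posterior_srcHist_apply (hd : ∀ i < t, Measurable (d i)) {C : Set P.A}
    (hC : MeasurableSet C) : Measurable fun ω => P.posterior (P.srcHist d t ω) C :=
  (Measure.measurable_coe hC).comp (P.measurable_posterior_srcHist hd)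

theorem measurable_nextPosterior_srcHist (hd : ∀ i < t, Measurable (d i)) {C : Set P.A}
    (hC : MeasurableSet C) :
    Measurable fun p : Ω × P.Datum => P.nextPosterior C (P.srcHist d t p.1) p.2 := by
  have h1 : Measurable fun p : (Ω × R) × Fin N =>
      P.posterior ((p.2, p.1.2) :: P.srcHist d t p.1.1) C :=
    measurable_from_prod_countable_left fun s => measurable_posterior_cons_srcHist hd s hC
  refine measurable_of_sum_cases measurable_snd measurable_fst
    (g := fun p : Ω × (P.Point × ℝ) => P.posterior (P.srcHist d t p.1) C)
    ((measurable_posterior_srcHist_apply hd hC).comp measurable_fst)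
    (h := fun p : Ω × (Fin N × R) => P.posterior (p.2 :: P.srcHist d t p.1) C)
    (h1.comp (f := fun p : Ω × (Fin N × R) => ((p.1, p.2.2), p.2.1)) (by fun_prop))
    (fun p q hq => ?_) fun p q hq => ?_
  · rw [hq]; rfl
  · rw [hq]; rfl

theorem measurable_predDensity_srcHist (hd : ∀ i < t, Measurable (d i)) (s : Fin N) :
    Measurable fun p : Ω × R => P.predDensity (P.srcHist d t p.1) s p.2 :=
  P.measurable_lintegral_posterior hd (S := R) (Φ := fun p => P.lik s p.2 p.1.2)
    ((P.lik_measurable s).comp (f := fun p : (Ω × R) × P.A => (p.2, p.1.2))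
      (by fun_prop)).coe_nnreal_ennreal

end Mble

/-- The information on the target function and the data. -/
abbrev dataInfo (P : Problem D J N R) {Ω E : Type*} [MeasurableSpace E] (θ : P.Point → Ω → ℝ)
    (U : Ω → E) (d : ℕ → Ω → P.Datum) (t : ℕ) : MeasurableSpace Ω :=
  P.algInfo U d t ⊔ P.targetInfo θ

theorem dataInfo_succ {Ω E : Type*} [MeasurableSpace E] (θ : P.Point → Ω → ℝ) (U : Ω → E)
    (d : ℕ → Ω → P.Datum) (t : ℕ) : P.dataInfo θ U d (t + 1)
      = P.dataInfo θ U d t ⊔ MeasurableSpace.comap (d t) inferInstance := by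
  rw [dataInfo, algInfo_succ, dataInfo, sup_right_comm]

theorem dataInfo_le_fullInfo {Ω E : Type*} [MeasurableSpace E] (θ : P.Point → Ω → ℝ)
    (aStar : Ω → P.A) (U : Ω → E) (d : ℕ → Ω → P.Datum) (t : ℕ) :
    P.dataInfo θ U d t ≤ P.fullInfo θ aStar U d t :=
  le_sup_left

theorem measurable_d_dataInfo {Ω E : Type*} [MeasurableSpace E] (θ : P.Point → Ω → ℝ) (U : Ω → E)
    (d : ℕ → Ω → P.Datum) {i t : ℕ} (hi : i < t) :
    Measurable[P.dataInfo θ U d t] (d i) :=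
  (measurable_of_lt_algInfo U d hi).mono le_sup_left le_rfl

/-- Given the data and the target function, the true parameter has the posterior law. -/
def PosteriorLaw (P : Problem D J N R) {Ω E : Type*} [MeasurableSpace Ω] [MeasurableSpace E]
    (ℙr : Measure Ω) (θ : P.Point → Ω → ℝ) (aStar : Ω → P.A) (U : Ω → E) (d : ℕ → Ω → P.Datum)
    (t : ℕ) : Prop :=
  ∀ A, MeasurableSet[P.dataInfo θ U d t] A → ∀ C, MeasurableSet C →
    ℙr (A ∩ aStar ⁻¹' C) = ∫⁻ ω in A, P.posterior (P.srcHist d t ω) C ∂ℙr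

namespace IsRun

variable {Ω E : Type*} [mΩ : MeasurableSpace Ω] [MeasurableSpace E] {ℙr : Measure Ω}
  [IsProbabilityMeasure ℙr] {θ : P.Point → Ω → ℝ} {aStar : Ω → P.A} {U : Ω → E}
  {d : ℕ → Ω → P.Datum} (h : P.IsRun ℙr θ aStar U d)
include h

omit [IsProbabilityMeasure ℙr] in
theorem dataInfo_le (t : ℕ) : P.dataInfo θ U d t ≤ mΩ := sup_le (h.algInfo_le t) h.targetInfo_le

theorem setLIntegral_posterior {t : ℕ} (hlaw : P.PosteriorLaw ℙr θ aStar U d t) {S : Type*}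
    [MeasurableSpace S] {X : Ω → S} (hX : Measurable[P.dataInfo θ U d t] X) {Φ : S × P.A → ℝ≥0∞}
    (hΦ : Measurable Φ) {A : Set Ω} (hA : MeasurableSet[P.dataInfo θ U d t] A) :
    ∫⁻ ω in A, Φ (X ω, aStar ω) ∂ℙr
      = ∫⁻ ω in A, ∫⁻ a, Φ (X ω, a) ∂(P.posterior (P.srcHist d t ω)) ∂ℙr := by
  have hle := h.dataInfo_le t
  have hA' := hle A hA
  have hind : Measurable[P.dataInfo θ U d t] (A.indicator (1 : Ω → ℝ≥0∞)) :=
    measurable_indicator_one hA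
  have key := @lintegral_comp_eq_lintegral_lintegral Ω Ω P.A mΩ (P.dataInfo θ U d t) _ ℙr _ id
    (measurable_id'' hle) aStar h.aStar_measurable (fun ω => P.posterior (P.srcHist d t ω))
    (@measurable_posterior_srcHist _ _ _ _ _ P Ω (P.dataInfo θ U d t) _ _ fun i hi =>
      measurable_d_dataInfo θ U d hi)
    (fun _ => P.posterior_univ_le _) (fun A hA C hC => hlaw A hA C hC)
    (fun p => A.indicator (1 : Ω → ℝ≥0∞) p.1 * Φ (X p.1, p.2))
    ((hind.comp (@measurable_fst _ _ (_) _)).mul (hΦ.comp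
      ((hX.comp (@measurable_fst _ _ (_) _)).prodMk (@measurable_snd _ _ (_) _))))
  rw [← lintegral_indicator hA', ← lintegral_indicator hA']
  refine Eq.trans (lintegral_congr fun ω => ?_) (key.trans (lintegral_congr fun ω => ?_))
  · by_cases hω : ω ∈ A <;> simp [hω]
  · by_cases hω : ω ∈ A <;> simp [hω]

theorem setLIntegral_inter_observation {t : ℕ} {A : Set Ω}
    (hA : MeasurableSet[P.fullInfo θ aStar U d t] A) {B : Set P.Datum} (hB : MeasurableSet B)
    {f : Ω → ℝ≥0∞} (hf : Measurable[P.fullInfo θ aStar U d t] f) :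
    ∫⁻ ω in A ∩ d t ⁻¹' B, f ω ∂ℙr
      = ∫⁻ ω in A, f ω * P.obsLaw (fun z => θ z ω) (aStar ω) (P.action (d t ω)) B ∂ℙr := by
  have hle := h.fullInfo_le (t := t)
  have hB' : MeasurableSet (d t ⁻¹' B) := h.d_measurable t hB
  have h1 := lintegral_mul_eq_of_forall_setLIntegral_eq (μ := ℙr.restrict A) hle
    (f := (d t ⁻¹' B).indicator 1)
    (g := fun ω => P.obsLaw (fun z => θ z ω) (aStar ω) (P.action (d t ω)) B)
    (measurable_indicator_one hB')
    (((Measure.measurable_coe hB).comp (h.measurable_obsLaw_fullInfo t)).mono hle le_rfl)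
    (fun C hC => ?_) hf
  · rw [← h1, Set.inter_comm, ← Measure.restrict_restrict hB', ← lintegral_indicator hB']
    refine lintegral_congr fun ω => ?_
    by_cases hω : ω ∈ d t ⁻¹' B <;> simp only [hω, Set.indicator_of_mem, Set.indicator_of_notMem,
      not_false_eq_true, Pi.one_apply, mul_one, mul_zero]
  · rw [Measure.restrict_restrict (hle C hC), lintegral_indicator_one hB',
      Measure.restrict_apply hB', Set.inter_comm]
    exact h.measure_inter_observation t (@MeasurableSet.inter _ (_) _ _ hC hA) hB

theorem posteriorLaw_zero : P.PosteriorLaw ℙr θ aStar U d 0 := fun A hA C hC => by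
  have h1 := (Indep_iff _ _ _).1 h.indep_param A (aStar ⁻¹' C) hA ⟨C, hC, rfl⟩
  have h2 : ∀ ω, P.posterior (P.srcHist d 0 ω) C = P.prior C := fun ω =>
    congrArg (· C) P.posterior_nil
  simp only [h2, setLIntegral_const]
  rw [h1, ← h.aStar_law, Measure.map_apply h.aStar_measurable hC, mul_comm]

/-- Given the past and the target function, the law of a simulation output does not involve the
parameter, so it is a `dataInfo`-measurable weight and the posterior stays as it is. -/
theorem posteriorLaw_succ_inl {t : ℕ} (ih : P.PosteriorLaw ℙr θ aStar U d t) {C : Set P.A}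
    (hC : MeasurableSet C) {A : Set Ω} (hA : MeasurableSet[P.dataInfo θ U d t] A)
    (hAs : ∀ ω ∈ A, ∃ z, P.action (d t ω) = .inl z) {B : Set P.Datum} (hB : MeasurableSet B) :
    ∫⁻ ω in A ∩ d t ⁻¹' B, (aStar ⁻¹' C).indicator 1 ω ∂ℙr
      = ∫⁻ ω in A ∩ d t ⁻¹' B, P.posterior (P.srcHist d (t + 1) ω) C ∂ℙr := by
  have hle := h.dataInfo_le t
  have hlef := dataInfo_le_fullInfo (P := P) θ aStar U d t
  have hA' := hle A hA
  have hAB : MeasurableSet (A ∩ d t ⁻¹' B) := hA'.inter (h.d_measurable t hB)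
  have e : ∀ ω ∈ A ∩ d t ⁻¹' B, P.posterior (P.srcHist d (t + 1) ω) C
      = P.posterior (P.srcHist d t ω) C := fun ω hω => by
    rw [srcHist_succ, eq_inl_simPoint (hAs ω hω.1)]
    rfl
  have hp : Measurable[P.dataInfo θ U d t] fun ω => P.posterior (P.srcHist d t ω) C :=
    @measurable_posterior_srcHist_apply _ _ _ _ _ P Ω (P.dataInfo θ U d t) _ _
      (fun i hi => measurable_d_dataInfo θ U d hi) _ hC
  have hf : Measurable[P.fullInfo θ aStar U d t] ((aStar ⁻¹' C).indicator (1 : Ω → ℝ≥0∞)) :=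
    measurable_indicator_one (le_sup_right (a := P.dataInfo θ U d t) _ ⟨C, hC, rfl⟩)
  rw [setLIntegral_congr_fun hAB e, h.setLIntegral_inter_observation (hlef A hA) hB hf,
    h.setLIntegral_inter_observation (hlef A hA) hB (hp.mono hlef le_rfl)]
  -- For a simulation action every parameter gives the same observation law; a fixed one makes it
  -- visibly measurable with respect to `dataInfo`.
  let a₀ : P.A := Classical.arbitrary _
  have eκ : ∀ ω ∈ A, P.obsLaw (fun z => θ z ω) (aStar ω) (P.action (d t ω)) B
      = P.obsLaw (fun z => θ z ω) a₀ (P.action (d t ω)) B := fun ω hω => by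
    obtain ⟨z, hz⟩ := hAs ω hω
    rw [hz]
    rfl
  have hκ : Measurable[P.dataInfo θ U d t] fun ω =>
      P.obsLaw (fun z => θ z ω) a₀ (P.action (d t ω)) B :=
    (Measure.measurable_coe hB).comp (@measurable_obsLaw D J N R _ P Ω (P.dataInfo θ U d t) θ
      (fun z => measurable_iff_comap_le.2 (le_sup_of_le_right (le_iSup_of_le z le_rfl)))
      h.θ_continuous (fun _ => a₀) (@measurable_const _ _ _ (_) _) _
      ((h.nonanticipating t).mono le_sup_left le_rfl))
  have h1 := h.setLIntegral_posterior ih hκ (Φ := fun p => C.indicator 1 p.2 * p.1)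
    (((measurable_indicator_one hC).comp measurable_snd).mul measurable_fst) hA
  refine (setLIntegral_congr_fun hA' fun ω hω => ?_).trans (h1.trans
    (setLIntegral_congr_fun hA' fun ω hω => ?_))
  · simp only [eκ ω hω]
    rfl
  · simp only [eκ ω hω]
    rw [lintegral_mul_const _ (measurable_indicator_one hC), lintegral_indicator_one hC]

/-- By Tonelli both sides are integrals over `r`: on the left of the likelihood over `a ∈ C`, on the
right of the updated posterior of `C` times the predictive density. Bayes' rule equates the
integrands wherever the predictive density is finite. -/
theorem posteriorLaw_succ_inr {t : ℕ} (ih : P.PosteriorLaw ℙr θ aStar U d t) {C : Set P.A}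
    (hC : MeasurableSet C) {s : Fin N} {A : Set Ω} (hA : MeasurableSet[P.dataInfo θ U d t] A)
    (hAs : ∀ ω ∈ A, P.action (d t ω) = .inr s) {B : Set P.Datum} (hB : MeasurableSet B) :
    ∫⁻ ω in A ∩ d t ⁻¹' B, (aStar ⁻¹' C).indicator 1 ω ∂ℙr
      = ∫⁻ ω in A ∩ d t ⁻¹' B, P.posterior (P.srcHist d (t + 1) ω) C ∂ℙr := by
  have hle := h.dataInfo_le t
  have hlef := dataInfo_le_fullInfo (P := P) θ aStar U d t
  have hA' := hle A hA
  have hB' : MeasurableSet (d t ⁻¹' B) := h.d_measurable t hB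
  have hf : Measurable[P.fullInfo θ aStar U d t] ((aStar ⁻¹' C).indicator (1 : Ω → ℝ≥0∞)) :=
    measurable_indicator_one (le_sup_right (a := P.dataInfo θ U d t) _ ⟨C, hC, rfl⟩)
  let b : R → ℝ≥0∞ := fun r => B.indicator 1 (.inr (s, r) : P.Datum)
  have hb : Measurable b := (measurable_indicator_one hB).comp (by fun_prop)
  have hC1 : Measurable (C.indicator (1 : P.A → ℝ≥0∞)) := measurable_indicator_one hC
  -- both sides equal the mean of the integral over `r` of the joint density
  have lhs : ∫⁻ ω in A ∩ d t ⁻¹' B, (aStar ⁻¹' C).indicator 1 ω ∂ℙr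
      = ∫⁻ ω in A, ∫⁻ r, b r * ∫⁻ a in C, P.lik s a r ∂(P.posterior (P.srcHist d t ω)) ∂(P.ref s)
        ∂ℙr := by
    rw [h.setLIntegral_mul_indicator_observation (hlef A hA) hAs hB hf]
    have h1 := h.setLIntegral_posterior ih (X := fun _ => ()) (@measurable_const _ _ _ (_) _)
      (Φ := fun p => (∫⁻ r, P.lik s p.2 r * b r ∂(P.ref s)) * C.indicator 1 p.2)
      ((measurable_lintegral_lik measurable_snd s (hb.comp measurable_snd)).mul (hC1.comp measurable_snd)) hA
    refine h1.trans (setLIntegral_congr_fun hA' fun ω _ => ?_)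
    have e1 : ∀ a, (∫⁻ r, P.lik s a r * b r ∂(P.ref s)) * C.indicator (1 : P.A → ℝ≥0∞) a
        = ∫⁻ r, b r * C.indicator (fun a => (P.lik s a r : ℝ≥0∞)) a ∂(P.ref s) := fun a => by
      by_cases ha : a ∈ C
      · simp [ha, mul_comm]
      · simp [ha]
    simp only [e1]
    rw [lintegral_lintegral_swap]
    · refine lintegral_congr fun r => ?_
      rw [lintegral_const_mul _ ((measurable_lik s r).indicator hC), lintegral_indicator hC]
    · refine Measurable.aemeasurable ?_
      have h3 : Measurable fun p : P.A × R => b p.2 * (C.indicator 1 p.1 * (P.lik s p.1 p.2 : ℝ≥0∞)) :=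
        (hb.comp measurable_snd).mul ((hC1.comp measurable_fst).mul
          (P.lik_measurable s).coe_nnreal_ennreal)
      convert h3 using 1
      funext p
      by_cases hp : p.1 ∈ C <;> simp [hp, Function.uncurry]
  have rhs : ∫⁻ ω in A ∩ d t ⁻¹' B, P.posterior (P.srcHist d (t + 1) ω) C ∂ℙr
      = ∫⁻ ω in A, ∫⁻ r, b r * (P.posterior ((s, r) :: P.srcHist d t ω) C
        * P.predDensity (P.srcHist d t ω) s r) ∂(P.ref s) ∂ℙr := by
    let Q : Ω × P.Datum → ℝ≥0∞ := fun p => P.nextPosterior C (P.srcHist d t p.1) p.2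
    let q : Ω × R → ℝ≥0∞ := fun p => b p.2 * P.posterior ((s, p.2) :: P.srcHist d t p.1) C
    have hQ : Measurable[(P.fullInfo θ aStar U d t).prod inferInstance] Q :=
      @measurable_nextPosterior_srcHist _ _ _ _ _ P Ω (P.fullInfo θ aStar U d t) _ _
        (fun i hi => (measurable_d_dataInfo θ U d hi).mono hlef le_rfl) _ hC
    have hq0 : Measurable[(P.dataInfo θ U d t).prod inferInstance] fun p : Ω × R =>
        P.posterior ((s, p.2) :: P.srcHist d t p.1) C :=
      @measurable_posterior_cons_srcHist _ _ _ _ _ P Ω (P.dataInfo θ U d t) _ _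
        (fun i hi => measurable_d_dataInfo θ U d hi) s _ hC
    have hq : Measurable[(P.dataInfo θ U d t).prod inferInstance] q :=
      (hb.comp (@measurable_snd _ _ (_) _)).mul hq0
    have h1 := @setLIntegral_observation_inr D J N R _ P Ω E mΩ _ ℙr _ θ aStar U d h t Ω
      (P.fullInfo θ aStar U d t) id measurable_id
      (fun p => B.indicator 1 p.2 * Q p)
      (((measurable_indicator_one hB).comp (@measurable_snd _ _ (_) _)).mul hQ) A (hlef A hA) s hAs
    have h2 := @setLIntegral_posterior D J N R _ P Ω E mΩ _ ℙr _ θ aStar U d h t ih Ω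
      (P.dataInfo θ U d t) id measurable_id
      (fun p => ∫⁻ r, P.lik s p.2 r * q (p.1, r) ∂(P.ref s))
      (@measurable_lintegral_lik _ _ _ _ _ P (Ω × P.A) ((P.dataInfo θ U d t).prod inferInstance)
        Prod.snd (@measurable_snd _ _ (_) _) s (fun p => q (p.1.1, p.2))
        (@Measurable.comp _ _ _ (_) (_) _ _ _ hq (@Measurable.prodMk _ (_) _ _ (_) _ _ _
          ((@measurable_fst _ _ (_) _).comp (@measurable_fst _ _ (_) _)) (@measurable_snd _ _ (_) _)))) A hA
    rw [Set.inter_comm, ← Measure.restrict_restrict hB', ← lintegral_indicator hB']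
    refine Eq.trans ?_ (h1.trans (h2.trans ?_))
    · refine setLIntegral_congr_fun hA' fun ω hω => ?_
      by_cases hω : ω ∈ d t ⁻¹' B
      · have hdB : d t ω ∈ B := hω
        simp only [hω, Set.indicator_of_mem, Pi.one_apply, one_mul, id, Q, hdB]
        rw [srcHist_succ]
        rcases d t ω <;> rfl
      · have hdB : d t ω ∉ B := hω
        simp [hω, hdB]
    · refine setLIntegral_congr_fun hA' fun ω _ => ?_
      have hqm : Measurable q := hq.mono (sup_le_sup_right (MeasurableSpace.comap_mono hle) _) le_rfl
      have h3 : ∀ r, ∫⁻ a, P.lik s a r * q (ω, r) ∂(P.posterior (P.srcHist d t ω))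
          = P.predDensity (P.srcHist d t ω) s r * q (ω, r) := fun r =>
        lintegral_mul_const _ (measurable_lik s r)
      simp only [id]
      rw [lintegral_lintegral_swap]
      · refine lintegral_congr fun r => ?_
        rw [h3]
        simp only [q]
        ring
      · exact ((P.lik_measurable s).coe_nnreal_ennreal.mul
          (hqm.comp (measurable_const.prodMk measurable_snd))).aemeasurable
  rw [lhs, rhs]
  refine lintegral_congr fun ω => lintegral_congr_ae ?_
  filter_upwards [ae_predDensity_ne_top (P.srcHist d t ω) s] with r hr
  rw [posterior_cons_mul_predDensity _ _ hr hC]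

theorem posteriorLaw (t : ℕ) : P.PosteriorLaw ℙr θ aStar U d t := by
  induction t with
  | zero => exact h.posteriorLaw_zero
  | succ t ih =>
    intro A hA C hC
    have hle := h.dataInfo_le t
    have hle1 := h.dataInfo_le (t + 1)
    have hC' : MeasurableSet (aStar ⁻¹' C) := h.aStar_measurable hC
    have ha : Measurable[P.dataInfo θ U d t] fun ω => P.action (d t ω) :=
      (h.nonanticipating t).mono le_sup_left le_rfl
    have hmono : P.dataInfo θ U d t ≤ P.dataInfo θ U d (t + 1) := by
      rw [dataInfo_succ]
      exact le_sup_left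
    have e : ℙr (A ∩ aStar ⁻¹' C) = ℙr.withDensity ((aStar ⁻¹' C).indicator 1) A := by
      rw [withDensity_indicator_one hC', Measure.restrict_apply (hle1 A hA)]
    rw [← withDensity_apply _ (hle1 A hA), e]
    refine measure_eq_of_forall_choiceSet hle1 (ha.mono hmono le_rfl) (fun o E hE => ?_) hA
    have hc := @measurableSet_choiceSet _ _ _ _ _ P Ω (P.dataInfo θ U d t) _ ha o
    have : IsFiniteMeasure (ℙr.withDensity ((aStar ⁻¹' C).indicator 1)) := by
      rw [withDensity_indicator_one hC']
      infer_instance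
    refine measure_inter_eq_of_forall_inter_preimage hle (h.d_measurable t) hc
      (fun A' hA' hA'A B hB => ?_) (dataInfo_succ θ U d t ▸ hE)
    have hAB : MeasurableSet (A' ∩ d t ⁻¹' B) := (hle _ hA').inter (h.d_measurable t hB)
    rw [withDensity_apply _ hAB, withDensity_apply _ hAB]
    rcases o with _ | s
    · exact h.posteriorLaw_succ_inl ih hC hA' (fun ω hω => hA'A hω) hB
    · exact h.posteriorLaw_succ_inr ih hC hA' (fun ω hω => hA'A hω) hB

end IsRun

end Problem

/-! ### Conditional expectations and a convergence criterion -/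

section Martingale

variable {Ω : Type*} {m₀ : MeasurableSpace Ω} {μ : Measure Ω}

theorem integral_mul_condExp [IsFiniteMeasure μ] {m : MeasurableSpace Ω} (hm : m ≤ m₀) {Z Y : Ω → ℝ}
    (hZ : StronglyMeasurable[m] Z) (hZ' : MemLp Z ∞ μ) (hY : MemLp Y ∞ μ) :
    ∫ ω, (Z * μ[Y | m]) ω ∂μ = ∫ ω, (Z * Y) ω ∂μ := by
  have h1 : Integrable (Z * Y) μ := (hY.mul (r := ∞) hZ').integrable le_top
  rw [← integral_congr_ae (condExp_mul_of_stronglyMeasurable_left hZ h1 (hY.integrable le_top)),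
    integral_condExp hm]

theorem memLp_top_condExp [IsFiniteMeasure μ] (m : MeasurableSpace Ω) {Y : Ω → ℝ} {C : ℝ}
    (hY : ∀ ω, |Y ω| ≤ C) : MemLp (μ[Y | m]) ∞ μ :=
  memLp_top_of_bound integrable_condExp.aestronglyMeasurable C
    (ae_bdd_abs_condExp_of_ae_bdd_abs (ae_of_all _ hY))

/-- Write `Xᵢ` for the conditional expectation of `Y` given `mᵢ`, and `ξ` for the conditional
variance given `m₁`, restricted to `S`. Since `J` has conditional mean `Y` on `S`, `E[ξ²] = E[ξ (Y -
X₁) J]`, and since `J` is known at `m₂`, this is `E[ξ J (X₂ - X₁)]`. From `2ab ≤ a² + b²` and `|J| ≤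
1` follows `E[ξ²] ≤ E[(X₂ - X₁)²]`, which is the right-hand side by orthogonality. -/
theorem integral_sq_condVar_le [IsFiniteMeasure μ] {m₁ m₂ k : MeasurableSpace Ω} (h12 : m₁ ≤ m₂)
    (hm₂ : m₂ ≤ m₀) (hk : k ≤ m₀) (h1k : m₁ ≤ k) {Y J : Ω → ℝ} (hYm : Measurable[m₀] Y)
    (hY : ∀ ω, |Y ω| ≤ 1) (hYk : StronglyMeasurable[k] Y) {S : Set Ω} (hS : MeasurableSet[m₁] S)
    (hJm : StronglyMeasurable[m₂] J) (hJ : ∀ ω, |J ω| ≤ 1) (hJY : μ[J | k] =ᵐ[μ] S.indicator Y) :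
    ∫ ω, (S.indicator (μ[Y * Y | m₁] - μ[Y | m₁] * μ[Y | m₁]) ω) ^ 2 ∂μ
      ≤ ∫ ω, (μ[Y | m₂] ω) ^ 2 ∂μ - ∫ ω, (μ[Y | m₁] ω) ^ 2 ∂μ := by
  have hm₁ := h12.trans hm₂
  set X₁ := μ[Y | m₁] with hX₁
  set X₂ := μ[Y | m₂] with hX₂
  set W := μ[Y * Y | m₁] with hW
  set ξ := S.indicator (W - X₁ * X₁) with hξ
  have hY2 : ∀ ω, |(Y * Y) ω| ≤ 1 := fun ω => by
    rw [Pi.mul_apply, abs_mul]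
    exact mul_le_one₀ (hY ω) (abs_nonneg _) (hY ω)
  have bY : MemLp Y ∞ μ := memLp_top_of_bound hYm.aestronglyMeasurable 1 (ae_of_all _ hY)
  have bY2 : MemLp (Y * Y) ∞ μ := bY.mul bY
  have bX₁ : MemLp X₁ ∞ μ := memLp_top_condExp m₁ hY
  have bX₂ : MemLp X₂ ∞ μ := memLp_top_condExp m₂ hY
  have bW : MemLp W ∞ μ := memLp_top_condExp m₁ hY2
  have bV : MemLp (W - X₁ * X₁) ∞ μ := bW.sub (bX₁.mul bX₁)
  have bξ : MemLp ξ ∞ μ := bV.indicator (hm₁ S hS)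
  have bJ : MemLp J ∞ μ :=
    memLp_top_of_bound (hJm.mono hm₂).aestronglyMeasurable 1 (ae_of_all _ hJ)
  have sX₁ : StronglyMeasurable[m₁] X₁ := stronglyMeasurable_condExp
  have sX₂ : StronglyMeasurable[m₂] X₂ := stronglyMeasurable_condExp
  have sξ : StronglyMeasurable[m₁] ξ :=
    (stronglyMeasurable_condExp.sub (sX₁.mul sX₁)).indicator hS
  have int : ∀ {f : Ω → ℝ}, MemLp f ∞ μ → Integrable f μ := fun hf => hf.integrable le_top
  have bmul : ∀ {f g : Ω → ℝ}, MemLp f ∞ μ → MemLp g ∞ μ → MemLp (f * g) ∞ μ :=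
    fun hf hg => hg.mul hf
  -- the increments of the martingale are orthogonal
  have o : ∫ ω, (X₁ * X₂) ω ∂μ = ∫ ω, (X₁ * X₁) ω ∂μ :=
    (integral_mul_condExp hm₂ (sX₁.mono h12) bX₁ bY).trans
      (integral_mul_condExp hm₁ sX₁ bX₁ bY).symm
  -- the conditional variance as a covariance with `J`
  have e1 : ∫ ω, (ξ * W) ω ∂μ = ∫ ω, (ξ * (Y * Y)) ω ∂μ :=
    integral_mul_condExp hm₁ sξ bξ bY2
  have e2 : ∫ ω, (ξ * X₁ * X₁) ω ∂μ = ∫ ω, (ξ * X₁ * Y) ω ∂μ :=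
    integral_mul_condExp hm₁ (sξ.mul sX₁) (bmul bξ bX₁) bY
  have e3 : ∫ ω, (ξ * (Y - X₁) * μ[J | k]) ω ∂μ = ∫ ω, (ξ * (Y - X₁) * J) ω ∂μ :=
    integral_mul_condExp hk ((sξ.mono h1k).mul (hYk.sub (sX₁.mono h1k))) (bmul bξ (bY.sub bX₁)) bJ
  have e4 : ∫ ω, (ξ * J * X₂) ω ∂μ = ∫ ω, (ξ * J * Y) ω ∂μ :=
    integral_mul_condExp hm₂ ((sξ.mono h12).mul hJm) (bmul bξ bJ) bY
  have e5 : ∫ ω, (ξ * (Y - X₁) * μ[J | k]) ω ∂μ = ∫ ω, (ξ * (Y * Y) - ξ * X₁ * Y) ω ∂μ := by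
    refine integral_congr_ae (hJY.mono fun ω hω => ?_)
    simp only [Pi.mul_apply, Pi.sub_apply, hω]
    by_cases hωS : ω ∈ S
    · simp only [hωS, Set.indicator_of_mem]
      ring
    · simp [hξ, hωS]
  have e6 : ∫ ω, (ξ * (Y - X₁) * J) ω ∂μ = ∫ ω, (ξ * J * X₂ - ξ * J * X₁) ω ∂μ := by
    have : ξ * (Y - X₁) * J = ξ * J * Y - ξ * J * X₁ := by ring
    rw [this, integral_sub' (int (bmul (bmul bξ bJ) bY)) (int (bmul (bmul bξ bJ) bX₁)), ← e4,
      integral_sub' (int (bmul (bmul bξ bJ) bX₂)) (int (bmul (bmul bξ bJ) bX₁))]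
  have e7 : ∫ ω, ξ ω ^ 2 ∂μ = ∫ ω, (ξ * J * X₂ - ξ * J * X₁) ω ∂μ := by
    have : ∀ ω, ξ ω ^ 2 = (ξ * W - ξ * X₁ * X₁) ω := fun ω => by
      by_cases hωS : ω ∈ S
      · simp only [hξ, hωS, Set.indicator_of_mem, Pi.mul_apply, Pi.sub_apply]
        ring
      · simp [hξ, hωS]
    simp only [this]
    rw [integral_sub' (int (bmul bξ bW)) (int (bmul (bmul bξ bX₁) bX₁)), e1, e2,
      ← integral_sub' (int (bmul bξ bY2)) (int (bmul (bmul bξ bX₁) bY)), ← e5, e3, e6]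
  have iA := int ((bmul (bmul bξ bJ) bX₂).sub (bmul (bmul bξ bJ) bX₁))
  have i12 := int (bmul bX₁ bX₂)
  have e8 : ∫ ω, ((ξ * J * X₂ - ξ * J * X₁) + (ξ * J * X₂ - ξ * J * X₁)) ω ∂μ
      ≤ ∫ ω, (ξ * ξ + X₂ * X₂ - (X₁ * X₂ + X₁ * X₂) + X₁ * X₁) ω ∂μ := by
    refine integral_mono (iA.add iA) ((((int (bmul bξ bξ)).add (int (bmul bX₂ bX₂))).sub
      (i12.add i12)).add (int (bmul bX₁ bX₁))) fun ω => ?_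
    simp only [Pi.mul_apply, Pi.sub_apply, Pi.add_apply]
    have h1 : J ω ^ 2 ≤ 1 := (sq_le_one_iff_abs_le_one _).2 (hJ ω)
    nlinarith [sq_nonneg (ξ ω - J ω * (X₂ ω - X₁ ω)), sq_nonneg (X₂ ω - X₁ ω)]
  have e9 : ∀ X : Ω → ℝ, ∫ ω, X ω ^ 2 ∂μ = ∫ ω, (X * X) ω ∂μ := fun X =>
    integral_congr_ae (ae_of_all _ fun ω => by simp only [Pi.mul_apply]; ring)
  rw [integral_add' iA iA, integral_add' (((int (bmul bξ bξ)).add (int (bmul bX₂ bX₂))).sub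
      (i12.add i12)) (int (bmul bX₁ bX₁)), integral_sub' ((int (bmul bξ bξ)).add
      (int (bmul bX₂ bX₂))) (i12.add i12), integral_add' (int (bmul bξ bξ)) (int (bmul bX₂ bX₂)),
    integral_add' i12 i12, o, ← e7] at e8
  have e10 := e9 ξ
  rw [e9 X₁, e9 X₂]
  linarith

/-- If `Y` is the conditional probability, given the past, of the events `J t` that are observed at the
times `t` with `ω ∈ S t`, then `Y` is known in the limit where there are infinitely many of them. -/
theorem ae_eq_condExp_iSup_of_frequently [IsProbabilityMeasure μ] (ℱ : Filtration ℕ m₀) {Y : Ω → ℝ}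
    (hYm : Measurable Y) (hY : ∀ ω, |Y ω| ≤ 1) {S : ℕ → Set Ω} (hS : ∀ t, MeasurableSet[ℱ t] (S t))
    {J : ℕ → Ω → ℝ} (hJm : ∀ t, StronglyMeasurable[ℱ (t + 1)] (J t)) (hJ : ∀ t ω, |J t ω| ≤ 1)
    {k : ℕ → MeasurableSpace Ω} (hk : ∀ t, k t ≤ m₀) (hℱk : ∀ t, ℱ t ≤ k t)
    (hYk : ∀ t, StronglyMeasurable[k t] Y)
    (hJY : ∀ t, μ[J t | k t] =ᵐ[μ] (S t).indicator Y) :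
    ∀ᵐ ω ∂μ, (∃ᶠ t in atTop, ω ∈ S t) → Y ω = (μ[Y | ⨆ t, ℱ t]) ω := by
  have hℱ : ⨆ t, ℱ t ≤ m₀ := iSup_le fun t => ℱ.le t
  set X : ℕ → Ω → ℝ := fun t => μ[Y | ℱ t] with hX
  set V : ℕ → Ω → ℝ := fun t => μ[Y * Y | ℱ t] - μ[Y | ℱ t] * μ[Y | ℱ t] with hV
  set ξ : ℕ → Ω → ℝ := fun t => (S t).indicator (V t) with hξ
  have hY2 : ∀ ω, |(Y * Y) ω| ≤ 1 := fun ω => by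
    rw [Pi.mul_apply, abs_mul]
    exact mul_le_one₀ (hY ω) (abs_nonneg _) (hY ω)
  have bY : MemLp Y ∞ μ := memLp_top_of_bound hYm.aestronglyMeasurable 1 (ae_of_all _ hY)
  have bX : ∀ m : MeasurableSpace Ω, MemLp (μ[Y | m]) ∞ μ := fun m => memLp_top_condExp m hY
  have bW : ∀ m : MeasurableSpace Ω, MemLp (μ[Y * Y | m]) ∞ μ := fun m => memLp_top_condExp m hY2
  have bV : ∀ m : MeasurableSpace Ω, MemLp (μ[Y * Y | m] - μ[Y | m] * μ[Y | m]) ∞ μ := fun m =>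
    (bW m).sub ((bX m).mul (bX m))
  have bξ : ∀ t, MemLp (ξ t) ∞ μ := fun t => (bV _).indicator (ℱ.le t _ (hS t))
  have iξ : ∀ t, Integrable (fun ω => ξ t ω ^ 2) μ := fun t =>
    (((bξ t).mul (r := ∞) (bξ t)).integrable le_top).congr
      (ae_of_all _ fun ω => by simp only [Pi.mul_apply]; ring)
  have step : ∀ t, ∫ ω, ξ t ω ^ 2 ∂μ ≤ ∫ ω, X (t + 1) ω ^ 2 ∂μ - ∫ ω, X t ω ^ 2 ∂μ := fun t =>
    integral_sq_condVar_le (ℱ.mono t.le_succ) (ℱ.le _) (hk t) (hℱk t) hYm hY (hYk t) (hS t) (hJm t)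
      (hJ t) (hJY t)
  -- The bounds telescope, and a conditional expectation of `Y` has second moment at most one. Hence
  -- the `ξ t ^ 2` are almost surely summable.
  have hsum : ∀ n, ∑ t ∈ Finset.range n, ∫ ω, ξ t ω ^ 2 ∂μ ≤ 1 := fun n => by
    refine (Finset.sum_le_sum fun t _ => step t).trans ?_
    rw [Finset.sum_range_sub (fun t => ∫ ω, X t ω ^ 2 ∂μ)]
    have h0 : 0 ≤ ∫ ω, X 0 ω ^ 2 ∂μ := integral_nonneg fun ω => sq_nonneg _
    have h1 : ∫ ω, X n ω ^ 2 ∂μ ≤ ∫ _, (1 : ℝ) ∂μ := by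
      refine integral_mono_of_nonneg (ae_of_all _ fun ω => sq_nonneg _) (integrable_const _) ?_
      have := ae_bdd_abs_condExp_of_ae_bdd_abs (m := ℱ n) (ae_of_all μ hY)
      exact this.mono fun ω hω => (sq_le_one_iff_abs_le_one _).2 hω
    rw [integral_const, probReal_univ, one_smul] at h1
    linarith
  have hsum' : ∫⁻ ω, ∑' t, ENNReal.ofReal (ξ t ω ^ 2) ∂μ ≠ ∞ := by
    rw [lintegral_tsum fun t => (iξ t).aestronglyMeasurable.aemeasurable.ennreal_ofReal]
    have e : ∀ t, ∫⁻ ω, ENNReal.ofReal (ξ t ω ^ 2) ∂μ = ENNReal.ofReal (∫ ω, ξ t ω ^ 2 ∂μ) :=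
      fun t => (ofReal_integral_eq_lintegral_ofReal (iξ t) (ae_of_all _ fun ω => sq_nonneg _)).symm
    simp only [e]
    refine ne_top_of_le_ne_top ENNReal.one_ne_top (ENNReal.tsum_le_of_sum_range_le fun n => ?_)
    rw [← ENNReal.ofReal_sum_of_nonneg fun t _ => integral_nonneg fun ω => sq_nonneg _]
    exact (ENNReal.ofReal_le_ofReal (hsum n)).trans_eq ENNReal.ofReal_one
  have hlim : ∀ᵐ ω ∂μ, Tendsto (fun t => ξ t ω) atTop (𝓝 0) := by
    refine (ae_lt_top' (AEMeasurable.tsum fun t =>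
      (iξ t).aestronglyMeasurable.aemeasurable.ennreal_ofReal) hsum').mono fun ω hω => ?_
    have h1 := ENNReal.tendsto_atTop_zero_of_tsum_ne_top hω.ne
    have h2 := (ENNReal.tendsto_toReal ENNReal.zero_ne_top).comp h1
    simp only [Function.comp_def, ENNReal.toReal_zero, ENNReal.toReal_ofReal (sq_nonneg _)] at h2
    have h3 := (Real.continuous_sqrt.tendsto _).comp h2
    simp only [Function.comp_def, Real.sqrt_sq_eq_abs, Real.sqrt_zero] at h3
    exact (tendsto_zero_iff_abs_tendsto_zero _).2 h3
  set X' := μ[Y | ⨆ t, ℱ t] with hX'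
  set W' := μ[Y * Y | ⨆ t, ℱ t] with hW'
  set D := {ω | ∃ᶠ t in atTop, ω ∈ S t} with hD
  have hDm : MeasurableSet[⨆ t, ℱ t] D := by
    have : D = limsup S atTop := by
      rw [limsup_eq_iInf_iSup_of_nat]
      ext ω
      simp [hD, frequently_atTop]
    rw [this]
    exact @MeasurableSet.measurableSet_limsup _ (⨆ t, ℱ t) _ fun t => le_iSup ℱ t _ (hS t)
  -- The conditional variances converge by Lévy's theorem. On `D` they coincide with `ξ t → 0` along
  -- a subsequence, so their limit is zero.
  have hV' : ∀ᵐ ω ∂μ, ω ∈ D → W' ω - X' ω * X' ω = 0 := by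
    filter_upwards [hlim, tendsto_ae_condExp (ℱ := ℱ) (μ := μ) Y,
      tendsto_ae_condExp (ℱ := ℱ) (μ := μ) (Y * Y)] with ω h1 h2 h3 hω
    have h4 : Tendsto (fun t => V t ω) atTop (𝓝 (W' ω - X' ω * X' ω)) := h3.sub (h2.mul h2)
    by_contra hne
    have h5 : ∀ᶠ t in atTop, V t ω ≠ 0 ∧ |ξ t ω| < |W' ω - X' ω * X' ω| / 2
        ∧ |W' ω - X' ω * X' ω| / 2 < |V t ω| := by
      have hpos := abs_pos.2 hne
      refine (h4.eventually_ne hne).and (((h1.abs.eventually_lt_const ?_)).and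
        (h4.abs.eventually_const_lt ?_))
      · rw [abs_zero]; linarith
      · linarith
    obtain ⟨t, htS, -, h6, h7⟩ := (hω.and_eventually h5).exists
    have : ξ t ω = V t ω := Set.indicator_of_mem htS _
    rw [this] at h6
    linarith
  have hDm' := hℱ D hDm
  have sX' : StronglyMeasurable[⨆ t, ℱ t] X' := stronglyMeasurable_condExp
  have s1 : StronglyMeasurable[⨆ t, ℱ t] (D.indicator fun _ => (1 : ℝ)) :=
    stronglyMeasurable_const.indicator hDm
  have b1 : MemLp (D.indicator fun _ => (1 : ℝ)) ∞ μ := (memLp_const 1).indicator hDm'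
  have bY2 : MemLp (Y * Y) ∞ μ := bY.mul bY
  have bX' := bX (⨆ t, ℱ t)
  have f1 := integral_mul_condExp hℱ s1 b1 bY2
  have f2 := integral_mul_condExp hℱ (s1.mul sX') (bX'.mul (r := ∞) b1) bY
  have bmul : ∀ {f g : Ω → ℝ}, MemLp f ∞ μ → MemLp g ∞ μ → MemLp (f * g) ∞ μ :=
    fun hf hg => hg.mul hf
  have int : ∀ {f : Ω → ℝ}, MemLp f ∞ μ → Integrable f μ := fun hf => hf.integrable le_top
  -- As `D` is known in the limit, the mean square of `Y - X'` over `D` is the integral over `D` of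
  -- the limiting conditional variance.
  have hzero : ∫ ω, D.indicator (fun ω => (Y ω - X' ω) ^ 2) ω ∂μ = 0 := by
    set I : Ω → ℝ := D.indicator fun _ => (1 : ℝ) with hI
    have e1 : ∀ ω, D.indicator (fun ω => (Y ω - X' ω) ^ 2) ω
        = (I * (Y * Y) - (I * X' * Y + I * X' * Y) + I * X' * X') ω := fun ω => by
      by_cases hω : ω ∈ D
      · simp only [hω, Set.indicator_of_mem, hI, Pi.mul_apply, Pi.sub_apply, Pi.add_apply]
        ring
      · simp [hω, hI]
    simp only [e1]
    have iW := int (bmul b1 (bW (⨆ t, ℱ t)))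
    have iXX := int (bmul (bmul b1 bX') bX')
    have iXY := int (bmul (bmul b1 bX') bY)
    have e2 : ∫ ω, (I * W' - I * X' * X') ω ∂μ = 0 := by
      refine integral_eq_zero_of_ae (hV'.mono fun ω hω => ?_)
      by_cases hωD : ω ∈ D
      · have := hω hωD
        simp only [hωD, Set.indicator_of_mem, hI, Pi.mul_apply, Pi.sub_apply, Pi.zero_apply]
        linarith
      · simp [hωD, hI]
    rw [integral_sub' iW iXX] at e2
    rw [integral_add' ((int (bmul b1 bY2)).sub (iXY.add iXY)) iXX,
      integral_sub' (int (bmul b1 bY2)) (iXY.add iXY), integral_add' iXY iXY, ← f1, ← f2]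
    linarith
  have hint : Integrable (D.indicator fun ω => (Y ω - X' ω) ^ 2) μ := by
    refine Integrable.indicator ((int (bmul (bY.sub bX') (bY.sub bX'))).congr
      (ae_of_all _ fun ω => ?_)) hDm'
    simp only [Pi.mul_apply, Pi.sub_apply]
    ring
  rw [integral_eq_zero_iff_of_nonneg (Set.indicator_nonneg fun ω _ => sq_nonneg _) hint] at hzero
  filter_upwards [hzero] with ω hω hωD
  rw [Set.indicator_of_mem (show ω ∈ D from hωD), Pi.zero_apply, sq_eq_zero_iff, sub_eq_zero] at hω
  exact hω

theorem toReal_ae_eq_condExp [IsFiniteMeasure μ] {m : MeasurableSpace Ω} (hm : m ≤ m₀)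
    {f g : Ω → ℝ≥0∞} (hf : Measurable[m₀] f) (hf' : ∫⁻ ω, f ω ∂μ ≠ ∞) (hg : Measurable[m] g)
    (h : ∀ A, MeasurableSet[m] A → ∫⁻ ω in A, g ω ∂μ = ∫⁻ ω in A, f ω ∂μ) :
    (fun ω => (g ω).toReal) =ᵐ[μ] μ[fun ω => (f ω).toReal | m] := by
  have hg' : ∫⁻ ω, g ω ∂μ ≠ ∞ := by
    have := h Set.univ (@MeasurableSet.univ _ m)
    rw [Measure.restrict_univ] at this
    rwa [this]
  have hgm : Measurable[m₀] g := hg.mono hm le_rfl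
  refine ae_eq_condExp_of_forall_setIntegral_eq hm (integrable_toReal_of_lintegral_ne_top
    hf.aemeasurable hf') (fun A _ _ => (integrable_toReal_of_lintegral_ne_top
    hgm.aemeasurable hg').integrableOn) (fun A hA _ => ?_)
    hg.ennreal_toReal.stronglyMeasurable.aestronglyMeasurable
  rw [integral_toReal hgm.aemeasurable.restrict (ae_restrict_of_ae (ae_lt_top hgm hg')),
    integral_toReal hf.aemeasurable.restrict (ae_restrict_of_ae (ae_lt_top hf hf')), h A hA]

theorem ae_le_ofReal_condExp [IsFiniteMeasure μ] {m : MeasurableSpace Ω} (hm : m ≤ m₀)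
    {f : Ω → ℝ} (hf : Integrable f μ) (hf0 : ∀ ω, 0 ≤ f ω) {g : Ω → ℝ≥0∞} (hg : Measurable[m] g)
    (h : ∀ A, MeasurableSet[m] A → ∫⁻ ω in A, g ω ∂μ ≤ ∫⁻ ω in A, ENNReal.ofReal (f ω) ∂μ) :
    ∀ᵐ ω ∂μ, g ω ≤ ENNReal.ofReal (μ[f | m] ω) := by
  have hc : Measurable[m] fun ω => ENNReal.ofReal (μ[f | m] ω) :=
    stronglyMeasurable_condExp.measurable.ennreal_ofReal
  refine ae_le_of_ae_le_trim (hm := hm) (ae_le_of_forall_setLIntegral_le_of_sigmaFinite hg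
    fun A hA _ => ?_)
  rw [setLIntegral_trim hm hg hA, setLIntegral_trim hm hc hA]
  refine (h A hA).trans_eq ?_
  rw [← ofReal_integral_eq_lintegral_ofReal hf.integrableOn (ae_of_all _ hf0),
    ← setIntegral_condExp hm hf hA, ofReal_integral_eq_lintegral_ofReal
      integrable_condExp.integrableOn
      (ae_restrict_of_ae (condExp_nonneg (ae_of_all _ hf0)))]

end Martingale

/-! ### Consistency of the posterior -/

theorem condExp_eq_self_of_eqOn {Ω : Type*} {m m₀ : MeasurableSpace Ω} {μ : Measure Ω}
    [IsFiniteMeasure μ] (hm : m ≤ m₀) {D : Set Ω} (hD : MeasurableSet[m] D) {Z Z' : Ω → ℝ}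
    (hZ : Integrable Z μ) (hZ' : Measurable[m] Z') (h : ∀ᵐ ω ∂μ, ω ∈ D → Z ω = Z' ω) :
    ∀ᵐ ω ∂μ, ω ∈ D → (μ[Z | m]) ω = Z ω := by
  have e : D.indicator Z =ᵐ[μ] D.indicator Z' := h.mono fun ω hω => by
    by_cases hωD : ω ∈ D
    · simp [hωD, hω hωD]
    · simp [hωD]
  have hi : Integrable (D.indicator Z') μ := (hZ.indicator (hm D hD)).congr e
  have h1 := condExp_of_stronglyMeasurable hm ((hZ'.indicator hD).stronglyMeasurable) hi
  filter_upwards [condExp_indicator hZ hD, condExp_congr_ae (m := m) e, h] with ω h2 h3 h4 hω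
  rw [h3, h1, Set.indicator_of_mem hω, Set.indicator_of_mem hω] at h2
  rw [← h2, h4 hω]

namespace Problem

variable {D J N : ℕ} {R : Type*} [MeasurableSpace R] {P : Problem D J N R}

theorem dataInfo_mono {Ω E : Type*} [MeasurableSpace E] (θ : P.Point → Ω → ℝ) (U : Ω → E)
    (d : ℕ → Ω → P.Datum) : Monotone (P.dataInfo θ U d) :=
  fun _ _ hst => sup_le_sup_right (algInfo_mono U d hst) _

/-- The information on the target function and all data. -/
abbrev limitInfo (P : Problem D J N R) {Ω E : Type*} [MeasurableSpace E] (θ : P.Point → Ω → ℝ)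
    (U : Ω → E) (d : ℕ → Ω → P.Datum) : MeasurableSpace Ω :=
  ⨆ t, P.dataInfo θ U d t

theorem measurable_d_limitInfo {Ω E : Type*} [MeasurableSpace E] (θ : P.Point → Ω → ℝ) (U : Ω → E)
    (d : ℕ → Ω → P.Datum) (i : ℕ) : Measurable[P.limitInfo θ U d] (d i) :=
  (measurable_d_dataInfo θ U d i.lt_succ_self).mono (le_iSup (P.dataInfo θ U d) _) le_rfl

theorem measurableSet_action_eq {Ω : Type*} [MeasurableSpace Ω] {x : Ω → P.Action}
    (hx : Measurable x) (s : Fin N) : MeasurableSet {ω | x ω = .inr s} :=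
  measurableSet_choiceSet hx (some s)

namespace IsRun

variable {Ω E : Type*} [mΩ : MeasurableSpace Ω] [MeasurableSpace E] {ℙr : Measure Ω}
  [IsProbabilityMeasure ℙr] {θ : P.Point → Ω → ℝ} {aStar : Ω → P.A} {U : Ω → E}
  {d : ℕ → Ω → P.Datum} (h : P.IsRun ℙr θ aStar U d)
include h

omit [IsProbabilityMeasure ℙr] in
theorem limitInfo_le : P.limitInfo θ U d ≤ mΩ := iSup_le h.dataInfo_le

/-- By `condMGF` with a single point and coefficient `±1`, the exponential of `±` the posterior mean
is at most the conditional expectation of `exp S` given the design. This martingale converges, so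
one constant bounds it for all `t`; a dense sequence of points and continuity give all `z`. -/
theorem ae_exists_bound_mean :
    ∀ᵐ ω ∂ℙr, ∃ M, ∀ t z, |P.mean (P.simHist d t ω) z| ≤ M := by
  obtain ⟨S, hSm, hS, hSexp⟩ := h.exists_envelope
  have hk := h.isCovKernel
  let 𝒢 : Filtration ℕ mΩ := ⟨P.designInfo aStar U d,
    fun _ _ hst => sup_le_sup_right (algInfo_mono U d hst) _, h.designInfo_le⟩
  have hSi : Integrable (fun ω => Real.exp (S ω)) ℙr := by
    refine ⟨(Real.measurable_exp.comp hSm).aestronglyMeasurable, ?_⟩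
    rw [hasFiniteIntegral_iff_ofReal (ae_of_all _ fun ω => (Real.exp_pos _).le)]
    simpa using (hSexp 1).lt_top
  let u : ℕ → P.Point := TopologicalSpace.denseSeq P.Point
  have key : ∀ (c : ℝ), |c| ≤ 1 → ∀ t j, ∀ᵐ ω ∂ℙr,
      ENNReal.ofReal (Real.exp (P.logMGF (fun _ : Fin 1 => c) (fun _ => u j) (P.simHist d t ω)))
        ≤ ENNReal.ofReal (ℙr[fun ω => Real.exp (S ω) | 𝒢 t] ω) := fun c hc t j => by
    refine ae_le_ofReal_condExp (𝒢.le t) hSi (fun ω => (Real.exp_pos _).le) ?_ fun A hA => ?_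
    · have hlm : Measurable[P.designInfo aStar U d t] fun ω =>
          P.logMGF (fun _ : Fin 1 => c) (fun _ => u j) (P.simHist d t ω) :=
        @measurable_logMGF _ _ _ _ _ P Ω (P.designInfo aStar U d t) _ _
          (fun i hi => measurable_d_designInfo aStar U d hi) _ _ _
      exact (ENNReal.measurable_ofReal.comp Real.measurable_exp).comp hlm
    · rw [← h.condMGF t 1 _ _ A hA]
      refine lintegral_mono fun ω => ENNReal.ofReal_le_ofReal (Real.exp_le_exp.2 ?_)
      simp only [lin, Finset.univ_unique, Finset.sum_singleton]
      refine (le_abs_self _).trans ((abs_mul _ _).trans_le ?_)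
      exact (mul_le_of_le_one_left (abs_nonneg _) hc).trans (hS ω _)
  have hpos := fun t j => key 1 (by simp) t j
  have hneg := fun t j => key (-1) (by simp) t j
  filter_upwards [ae_all_iff.2 fun t => ae_all_iff.2 (hpos t),
    ae_all_iff.2 fun t => ae_all_iff.2 (hneg t),
    tendsto_ae_condExp (ℱ := 𝒢) (μ := ℙr) fun ω => Real.exp (S ω)] with ω h1 h2 h3
  obtain ⟨K, hK⟩ := h3.bddAbove_range
  have hle : ∀ (c : ℝ) (t j : ℕ), ENNReal.ofReal (Real.exp (P.logMGF (fun _ : Fin 1 => c)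
      (fun _ => u j) (P.simHist d t ω))) ≤ ENNReal.ofReal (ℙr[fun ω => Real.exp (S ω) | 𝒢 t] ω) →
      c * P.mean (P.simHist d t ω) (u j) ≤ K := fun c t j hle => by
    have h4 : Real.exp (P.logMGF (fun _ : Fin 1 => c) (fun _ => u j) (P.simHist d t ω)) ≤ K := by
      by_contra! hlt
      refine absurd hle (not_le.2 ?_)
      exact (ENNReal.ofReal_lt_ofReal_iff (Real.exp_pos _)).2
        ((hK ⟨t, rfl⟩ : _ ≤ K).trans_lt hlt)
    -- The variance term of the exponent is nonnegative and may be dropped.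
    have h5 : c * P.mean (P.simHist d t ω) (u j)
        ≤ P.logMGF (fun _ : Fin 1 => c) (fun _ => u j) (P.simHist d t ω) := by
      have h6 := (isCovKernel_cov hk (P.simHist d t ω)).nonneg 1 (fun _ => u j) fun _ => c
      rw [logMGF, lin, Finset.univ_unique, Finset.sum_singleton]
      have : 0 ≤ quad (fun _ : Fin 1 => c) (fun _ => u j) (P.cov (P.simHist d t ω)) := h6
      linarith
    have h7 := Real.add_one_le_exp (P.logMGF (fun _ : Fin 1 => c) (fun _ => u j) (P.simHist d t ω))
    linarith
  refine ⟨K, fun t z => ?_⟩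
  have hc : IsClosed {x | |P.mean (P.simHist d t ω) x| ≤ K} :=
    isClosed_le (P.continuous_mean _).abs continuous_const
  have hr : Set.range u ⊆ {x | |P.mean (P.simHist d t ω) x| ≤ K} := by
    rintro _ ⟨j, rfl⟩
    have h8 := hle 1 t j (h1 t j)
    have h9 := hle (-1) t j (h2 t j)
    rw [one_mul] at h8
    rw [neg_one_mul] at h9
    exact abs_le.2 ⟨neg_le.1 h9, h8⟩
  exact hc.closure_subset_iff.2 hr (TopologicalSpace.denseRange_denseSeq P.Point z)

/-- The mass is at most one by definition, and `PosteriorLaw` on the whole space says that its mean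
is one. -/
theorem ae_posterior_univ : ∀ᵐ ω ∂ℙr, ∀ t, P.posterior (P.srcHist d t ω) Set.univ = 1 := by
  refine ae_all_iff.2 fun t => ?_
  have hd : ∀ i < t, Measurable (d i) := fun i _ => h.d_measurable i
  have h1 := h.posteriorLaw t Set.univ (@MeasurableSet.univ _ (_)) Set.univ MeasurableSet.univ
  rw [Set.preimage_univ, Set.inter_self, measure_univ, Measure.restrict_univ] at h1
  have h2 : ∫⁻ ω, P.posterior (P.srcHist d t ω) Set.univ ∂ℙr = ∫⁻ _, 1 ∂ℙr := by
    rw [← h1, lintegral_const, measure_univ, one_mul]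
  refine ae_eq_of_ae_le_of_lintegral_le (ae_of_all _ fun ω => P.posterior_univ_le _) ?_
    aemeasurable_const h2.ge
  rw [h2, lintegral_const, measure_univ, one_mul]
  exact ENNReal.one_ne_top

theorem setLIntegral_lintegral_posterior (t : ℕ) {g : P.A → ℝ≥0∞} (hg : Measurable g) {A : Set Ω}
    (hA : MeasurableSet[P.dataInfo θ U d t] A) :
    ∫⁻ ω in A, g (aStar ω) ∂ℙr = ∫⁻ ω in A, ∫⁻ a, g a ∂(P.posterior (P.srcHist d t ω)) ∂ℙr :=
  h.setLIntegral_posterior (h.posteriorLaw t) (X := fun _ => ()) (@measurable_const _ _ _ (_) _)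
    (Φ := fun p => g p.2) (hg.comp measurable_snd) hA

/-- The posterior integrals are versions of the martingale `E[g (aStar) | dataInfo t]`, to which
Lévy's theorem applies. -/
theorem tendsto_lintegral_posterior {g : P.A → ℝ≥0∞} (hg : Measurable g)
    (hfin : ∫⁻ ω, g (aStar ω) ∂ℙr ≠ ∞) :
    ∀ᵐ ω ∂ℙr, Tendsto (fun t => ∫⁻ a, g a ∂(P.posterior (P.srcHist d t ω))) atTop
      (𝓝 (ENNReal.ofReal ((ℙr[fun ω => (g (aStar ω)).toReal | P.limitInfo θ U d]) ω))) := by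
  let ℱ : Filtration ℕ mΩ := ⟨P.dataInfo θ U d, dataInfo_mono θ U d, h.dataInfo_le⟩
  have hgm : ∀ t, Measurable[P.dataInfo θ U d t] fun ω =>
      ∫⁻ a, g a ∂(P.posterior (P.srcHist d t ω)) := fun t =>
    (Measure.measurable_lintegral hg).comp
      (@measurable_posterior_srcHist _ _ _ _ _ P Ω (P.dataInfo θ U d t) _ _ fun i hi =>
        measurable_d_dataInfo θ U d hi)
  have h1 : ∀ t, (fun ω => (∫⁻ a, g a ∂(P.posterior (P.srcHist d t ω))).toReal)
      =ᵐ[ℙr] ℙr[fun ω => (g (aStar ω)).toReal | ℱ t] := fun t =>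
    toReal_ae_eq_condExp (ℱ.le t) (hg.comp h.aStar_measurable) hfin (hgm t) fun A hA =>
      (h.setLIntegral_lintegral_posterior t hg hA).symm
  have h2 : ∀ t, ∀ᵐ ω ∂ℙr, ∫⁻ a, g a ∂(P.posterior (P.srcHist d t ω)) < ∞ := fun t => by
    refine ae_lt_top ((hgm t).mono (ℱ.le t) le_rfl) ?_
    have h3 := h.setLIntegral_lintegral_posterior t hg (@MeasurableSet.univ _ (_))
    rw [Measure.restrict_univ] at h3
    rwa [← h3]
  filter_upwards [ae_all_iff.2 h1, ae_all_iff.2 h2, tendsto_ae_condExp (ℱ := ℱ) (μ := ℙr)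
    fun ω => (g (aStar ω)).toReal] with ω h4 h5 h6
  refine (ENNReal.tendsto_ofReal h6).congr fun t => ?_
  rw [← h4 t, ENNReal.ofReal_toReal (h5 t).ne]

omit [IsProbabilityMeasure ℙr] h in
theorem setLIntegral_lik_le (s : Fin N) (C : Set R) (a : P.A) :
    ∫⁻ r in C, P.lik s a r ∂(P.ref s) ≤ 1 :=
  (setLIntegral_le_lintegral _ _).trans_eq (P.lik_prob s a)

omit [IsProbabilityMeasure ℙr] h in
theorem measurable_setLIntegral_lik {Ω : Type*} [MeasurableSpace Ω] {a : Ω → P.A}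
    (ha : Measurable a) (s : Fin N) (C : Set R) :
    Measurable fun ω => ∫⁻ r in C, P.lik s (a ω) r ∂(P.ref s) :=
  ((P.lik_measurable s).comp (f := fun p : Ω × R => (a p.1, p.2))
    (by fun_prop)).coe_nnreal_ennreal.lintegral_prod_right'

/-- The convergence criterion is applied to the events that the next datum comes from `s` and falls
in `C`. Given the past, the target and the parameter, their probability is that of `C` under `lik s
aStar` if `s` is chosen, and zero otherwise. -/
theorem toReal_setLIntegral_lik_eq_condExp (s : Fin N) {C : Set R} (hC : MeasurableSet C) :
    ∀ᵐ ω ∂ℙr, (∃ᶠ t in atTop, P.action (d t ω) = .inr s) →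
      (∫⁻ r in C, P.lik s (aStar ω) r ∂(P.ref s)).toReal
        = (ℙr[fun ω => (∫⁻ r in C, P.lik s (aStar ω) r ∂(P.ref s)).toReal | P.limitInfo θ U d]) ω := by
  let ℱ : Filtration ℕ mΩ := ⟨P.dataInfo θ U d, dataInfo_mono θ U d, h.dataInfo_le⟩
  let B : Set P.Datum := Sum.inr '' ({s} ×ˢ C)
  have hB : MeasurableSet B := measurableSet_inr_image.2 ((measurableSet_singleton s).prod hC)
  have hB1 : Measurable (B.indicator (1 : P.Datum → ℝ≥0∞)) := measurable_indicator_one hB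
  refine ae_eq_condExp_iSup_of_frequently ℱ
    (measurable_setLIntegral_lik h.aStar_measurable s C).ennreal_toReal (fun ω => ?_)
    (S := fun t => {ω | P.action (d t ω) = .inr s})
    (fun t => @measurableSet_action_eq _ _ _ _ _ P Ω (P.dataInfo θ U d t) _
      ((h.nonanticipating t).mono le_sup_left le_rfl) s)
    (J := fun t => (d t ⁻¹' B).indicator fun _ => (1 : ℝ)) (fun t => ?_) (fun t ω => ?_)
    (k := P.fullInfo θ aStar U d) h.fullInfo_le (fun t => le_sup_left) (fun t => ?_) fun t => ?_
  · rw [abs_of_nonneg ENNReal.toReal_nonneg]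
    exact ENNReal.toReal_le_of_le_ofReal zero_le_one
      ((setLIntegral_lik_le s C _).trans_eq ENNReal.ofReal_one.symm)
  · exact stronglyMeasurable_const.indicator (measurable_d_dataInfo θ U d t.lt_succ_self hB)
  · by_cases hω : ω ∈ d t ⁻¹' B <;> simp [hω]
  · exact (@measurable_setLIntegral_lik _ _ _ _ _ P Ω (P.fullInfo θ aStar U d t) aStar
      (measurable_iff_comap_le.2 le_sup_right) s C).ennreal_toReal.stronglyMeasurable
  · refine (h.observation t B hB).trans (ae_of_all _ fun ω => ?_)
    have e : ∀ s' r, B.indicator (1 : P.Datum → ℝ≥0∞) (.inr (s', r))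
        = if s' = s then C.indicator 1 r else 0 := fun s' r => by
      by_cases h1 : s' = s <;> by_cases h2 : r ∈ C <;> simp [B, h1, h2]
    simp only [measureReal_def, ← lintegral_indicator_one hB]
    rcases hx : P.action (d t ω) with z | s'
    · rw [lintegral_obsLaw_inl _ _ _ _ hB1]
      simp [B, hx]
    · rw [lintegral_obsLaw_inr _ _ _ _ hB1]
      simp only [e]
      by_cases h1 : s' = s
      · subst h1
        have h3 : ω ∈ {ω | P.action (d t ω) = .inr s'} := hx
        rw [Set.indicator_of_mem h3, ← lintegral_indicator hC]
        congr 1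
        refine lintegral_congr fun r => ?_
        by_cases h2 : r ∈ C <;> simp [h2]
      · simp [h1, hx]

end IsRun

end Problem

/-! ### Limits of predictive densities and of overlaps -/

namespace Problem

variable {D J N : ℕ} {R : Type*} [MeasurableSpace R] {P : Problem D J N R}

/-- The limit of the predictive density of a source. -/
def limitDensity (P : Problem D J N R) {Ω : Type*} (d : ℕ → Ω → P.Datum) (s : Fin N)
    (ω : Ω) (r : R) : ℝ≥0∞ :=
  limsup (fun t => P.predDensity (P.srcData (P.history (fun i => d i ω) t)) s r) atTop

/-- The integral of the smaller one of the density of the next datum and the predictive density. -/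
def overlap (P : Problem D J N R) (Rm : List (Fin N × R)) (s : Fin N) (r : R) : ℝ≥0∞ :=
  ∫⁻ a, min (P.lik s a r : ℝ≥0∞) (P.predDensity Rm s r) ∂(P.posterior Rm)

section Mble

variable {Ω : Type*} [MeasurableSpace Ω] {d : ℕ → Ω → P.Datum}

theorem measurable_limitDensity (hd : ∀ i, Measurable (d i)) (s : Fin N) :
    Measurable fun p : Ω × R => P.limitDensity d s p.1 p.2 :=
  Measurable.limsup fun _ => measurable_predDensity_srcHist (fun i _ => hd i) s

theorem measurable_limitDensity_left (hd : ∀ i, Measurable (d i)) (s : Fin N) (r : R) :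
    Measurable fun ω => P.limitDensity d s ω r := by
  have h := (measurable_limitDensity hd s).comp (f := fun ω : Ω => (ω, r)) (by fun_prop)
  simpa only [Function.comp_def] using h

theorem measurable_overlap_srcHist (hd : ∀ i, Measurable (d i)) (s : Fin N) (t : ℕ) :
    Measurable fun p : Ω × R => P.overlap (P.srcHist d t p.1) s p.2 :=
  P.measurable_lintegral_posterior (fun i _ => hd i) (S := R)
    (Φ := fun p => min (P.lik s p.2 p.1.2 : ℝ≥0∞) (P.predDensity (P.srcHist d t p.1.1) s p.1.2))
    (((P.lik_measurable s).comp (f := fun p : (Ω × R) × P.A => (p.2, p.1.2))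
      (by fun_prop)).coe_nnreal_ennreal.min
      ((measurable_predDensity_srcHist (fun i _ => hd i) s).comp measurable_fst))

theorem measurable_liminf_overlap (hd : ∀ i, Measurable (d i)) (s : Fin N) :
    Measurable fun p : R × Ω => liminf (fun t => P.overlap (P.srcHist d t p.2) s p.1) atTop := by
  have h : ∀ t, Measurable fun p : R × Ω => P.overlap (P.srcHist d t p.2) s p.1 := fun t => by
    have h := (measurable_overlap_srcHist hd s t).comp (measurable_swap (α := R) (β := Ω))
    simpa only [Function.comp_def, Prod.swap] using h
  exact Measurable.liminf h

theorem measurable_lik_comp {a : Ω → P.A} (ha : Measurable a) (s : Fin N) :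
    Measurable fun p : Ω × R => (P.lik s (a p.1) p.2 : ℝ≥0∞) :=
  ((P.lik_measurable s).comp (f := fun p : Ω × R => (a p.1, p.2)) (by fun_prop)).coe_nnreal_ennreal

end Mble

namespace IsRun

variable {Ω E : Type*} [mΩ : MeasurableSpace Ω] [MeasurableSpace E] {ℙr : Measure Ω}
  [IsProbabilityMeasure ℙr] {θ : P.Point → Ω → ℝ} {aStar : Ω → P.A} {U : Ω → E}
  {d : ℕ → Ω → P.Datum} (h : P.IsRun ℙr θ aStar U d)
include h

theorem ae_lintegral_lik_ne_top (s : Fin N) :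
    ∀ᵐ r ∂(P.ref s), ∫⁻ ω, P.lik s (aStar ω) r ∂ℙr ≠ ∞ := by
  have hm := measurable_lik_comp h.aStar_measurable s
  refine (ae_lt_top (hm.comp measurable_swap).lintegral_prod_right' ?_).mono fun r hr => hr.ne
  simp only [Function.comp_def, Prod.swap]
  rw [← lintegral_lintegral_swap hm.aemeasurable]
  simp [P.lik_prob]

/-- The predictive density at `r` is a martingale in `t`. Taking a limsup in `limitDensity` keeps it
jointly measurable also where the limit does not exist. -/
theorem limitDensity_ae_eq (s : Fin N) {r : R} (hr : ∫⁻ ω, P.lik s (aStar ω) r ∂ℙr ≠ ∞) :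
    ∀ᵐ ω ∂ℙr, P.limitDensity d s ω r = ENNReal.ofReal
      ((ℙr[fun ω => (P.lik s (aStar ω) r : ℝ≥0∞).toReal | P.limitInfo θ U d]) ω) :=
  (h.tendsto_lintegral_posterior (measurable_lik s r) hr).mono fun _ hω => hω.limsup_eq

theorem setLIntegral_limitDensity (s : Fin N) {r : R} (hr : ∫⁻ ω, P.lik s (aStar ω) r ∂ℙr ≠ ∞)
    {A : Set Ω} (hA : MeasurableSet[P.limitInfo θ U d] A) :
    ∫⁻ ω in A, P.limitDensity d s ω r ∂ℙr = ∫⁻ ω in A, P.lik s (aStar ω) r ∂ℙr := by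
  have hm : Measurable fun ω => (P.lik s (aStar ω) r : ℝ≥0∞) :=
    (measurable_lik s r).comp h.aStar_measurable
  have hi := integrable_toReal_of_lintegral_ne_top hm.aemeasurable hr
  rw [lintegral_congr_ae (ae_restrict_of_ae (h.limitDensity_ae_eq s hr)),
    ← ofReal_integral_eq_lintegral_ofReal integrable_condExp.integrableOn
      (ae_restrict_of_ae (condExp_nonneg (ae_of_all _ fun _ => ENNReal.toReal_nonneg))),
    setIntegral_condExp h.limitInfo_le hi hA, ofReal_integral_eq_lintegral_ofReal hi.integrableOn
      (ae_of_all _ fun _ => ENNReal.toReal_nonneg)]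
  exact lintegral_congr fun ω => ENNReal.ofReal_toReal ENNReal.coe_ne_top

theorem setLIntegral_setLIntegral_limitDensity (s : Fin N) (C : Set R)
    {A : Set Ω} (hA : MeasurableSet[P.limitInfo θ U d] A) :
    ∫⁻ ω in A, ∫⁻ r in C, P.limitDensity d s ω r ∂(P.ref s) ∂ℙr
      = ∫⁻ ω in A, ∫⁻ r in C, P.lik s (aStar ω) r ∂(P.ref s) ∂ℙr := by
  refine (lintegral_lintegral_swap (measurable_limitDensity h.d_measurable s).aemeasurable).trans
    (Eq.trans ?_ (lintegral_lintegral_swap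
      (measurable_lik_comp h.aStar_measurable s).aemeasurable).symm)
  exact lintegral_congr_ae (ae_restrict_of_ae ((h.ae_lintegral_lik_ne_top s).mono fun r hr =>
    h.setLIntegral_limitDensity s hr hA))

omit [IsProbabilityMeasure ℙr] in
theorem measurableSet_frequently (s : Fin N) :
    MeasurableSet[P.limitInfo θ U d] {ω | ∃ᶠ t in atTop, P.action (d t ω) = .inr s} := by
  have : {ω | ∃ᶠ t in atTop, P.action (d t ω) = .inr s}
      = limsup (fun t => {ω | P.action (d t ω) = .inr s}) atTop := by
    rw [limsup_eq_iInf_iSup_of_nat]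
    ext ω
    simp [frequently_atTop]
  rw [this]
  exact @MeasurableSet.measurableSet_limsup _ (P.limitInfo θ U d) _ fun t =>
    le_iSup (P.dataInfo θ U d) t _ (@measurableSet_action_eq _ _ _ _ _ P Ω (P.dataInfo θ U d t) _
      ((h.nonanticipating t).mono le_sup_left le_rfl) s)

/-- The right-hand side is, by Tonelli, a version of the conditional expectation of the left-hand
side given `limitInfo`; on the event of infinitely many queries the left-hand side equals that
conditional expectation. -/
theorem setLIntegral_lik_eq_limitDensity (s : Fin N) {C : Set R} (hC : MeasurableSet C) :
    ∀ᵐ ω ∂ℙr, (∃ᶠ t in atTop, P.action (d t ω) = .inr s) →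
      ∫⁻ r in C, P.lik s (aStar ω) r ∂(P.ref s) = ∫⁻ r in C, P.limitDensity d s ω r ∂(P.ref s) := by
  have hm : Measurable fun ω => ∫⁻ r in C, P.lik s (aStar ω) r ∂(P.ref s) :=
    measurable_setLIntegral_lik h.aStar_measurable s C
  have hfin : ∫⁻ ω, ∫⁻ r in C, P.lik s (aStar ω) r ∂(P.ref s) ∂ℙr ≠ ∞ :=
    ne_top_of_le_ne_top ENNReal.one_ne_top ((lintegral_mono fun ω =>
      setLIntegral_lik_le s C (aStar ω)).trans_eq (by simp))
  have hlm : Measurable[P.limitInfo θ U d] fun ω => ∫⁻ r in C, P.limitDensity d s ω r ∂(P.ref s) :=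
    @Measurable.lintegral_prod_right' Ω R (P.limitInfo θ U d) _ _ _ _
      (@measurable_limitDensity _ _ _ _ _ P Ω (P.limitInfo θ U d) _
        (measurable_d_limitInfo θ U d) s)
  have h1 := toReal_ae_eq_condExp h.limitInfo_le hm hfin hlm fun A hA =>
    h.setLIntegral_setLIntegral_limitDensity s C hA
  have hfin' : ∀ᵐ ω ∂ℙr, ∫⁻ r in C, P.limitDensity d s ω r ∂(P.ref s) < ∞ := by
    refine ae_lt_top (hlm.mono h.limitInfo_le le_rfl) ?_
    have h2 := h.setLIntegral_setLIntegral_limitDensity s C (@MeasurableSet.univ _ (_))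
    rw [Measure.restrict_univ] at h2
    rwa [h2]
  filter_upwards [h1, h.toReal_setLIntegral_lik_eq_condExp s hC, hfin'] with ω h3 h4 h5 hω
  exact (ENNReal.toReal_eq_toReal_iff' (ne_top_of_le_ne_top ENNReal.one_ne_top
    (setLIntegral_lik_le s C _)) h5.ne).1 ((h4 hω).trans h3.symm)

/-- The null set in `setLIntegral_lik_eq_limitDensity` depends on `C`. Comparing the two densities
as measures on `Ω × R` only requires rectangles, hence one `C` at a time, and no countability
assumption on the data space. -/
theorem lik_ae_eq_limitDensity (s : Fin N) : ∀ᵐ r ∂(P.ref s), ∀ᵐ ω ∂ℙr,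
    (∃ᶠ t in atTop, P.action (d t ω) = .inr s) →
      (P.lik s (aStar ω) r : ℝ≥0∞) = P.limitDensity d s ω r := by
  set B := {ω | ∃ᶠ t in atTop, P.action (d t ω) = .inr s} with hB
  have hBm : MeasurableSet B := h.limitInfo_le _ (h.measurableSet_frequently s)
  have hm₁ := measurable_lik_comp h.aStar_measurable s
  have hm₂ := measurable_limitDensity h.d_measurable s
  let ν := (ℙr.restrict B).prod (P.ref s)
  have hfin : IsFiniteMeasure (ν.withDensity fun p => (P.lik s (aStar p.1) p.2 : ℝ≥0∞)) := by
    refine isFiniteMeasure_withDensity ?_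
    rw [lintegral_prod _ hm₁.aemeasurable]
    simp only [P.lik_prob, lintegral_one]
    exact measure_ne_top _ _
  have key : ν.withDensity (fun p => (P.lik s (aStar p.1) p.2 : ℝ≥0∞))
      = ν.withDensity fun p => P.limitDensity d s p.1 p.2 := by
    refine Measure.ext_prod fun {A C} hA hC => ?_
    rw [withDensity_apply _ (hA.prod hC), withDensity_apply _ (hA.prod hC),
      setLIntegral_prod _ hm₁.aemeasurable, setLIntegral_prod _ hm₂.aemeasurable]
    refine lintegral_congr_ae (ae_restrict_of_ae ?_)
    exact (ae_restrict_iff' hBm).2 (h.setLIntegral_lik_eq_limitDensity s hC)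
  rw [withDensity_eq_iff_of_sigmaFinite hm₁.aemeasurable hm₂.aemeasurable] at key
  have hset : MeasurableSet {p : Ω × R | (P.lik s (aStar p.1) p.2 : ℝ≥0∞)
      = P.limitDensity d s p.1 p.2} := measurableSet_eq_fun hm₁ hm₂
  have h2 := (Measure.ae_prod_iff_ae_ae hset).1 key
  have h3 := (Measure.ae_ae_comm hset).1 h2
  exact h3.mono fun r hr => (ae_restrict_iff' hBm).1 hr

/-- On the event in question the likelihood at `aStar` agrees with a `limitInfo`-measurable
function, so conditioning a function of it on `limitInfo` does nothing. Truncations `φ` are needed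
for the overlap. -/
theorem tendsto_lintegral_posterior_of_frequently (s : Fin N) {r : R}
    (hr : ∀ᵐ ω ∂ℙr, (∃ᶠ t in atTop, P.action (d t ω) = .inr s) →
      (P.lik s (aStar ω) r : ℝ≥0∞) = P.limitDensity d s ω r)
    {φ : ℝ≥0∞ → ℝ≥0∞} (hφ : Measurable φ) (hφ' : ∀ x, φ x ≤ x)
    (hfin : ∫⁻ ω, P.lik s (aStar ω) r ∂ℙr ≠ ∞) :
    ∀ᵐ ω ∂ℙr, (∃ᶠ t in atTop, P.action (d t ω) = .inr s) →
      Tendsto (fun t => ∫⁻ a, φ (P.lik s a r) ∂(P.posterior (P.srcHist d t ω))) atTop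
        (𝓝 (φ (P.lik s (aStar ω) r))) := by
  have hg : Measurable fun a => φ (P.lik s a r) := hφ.comp (measurable_lik s r)
  have hfin' : ∫⁻ ω, φ (P.lik s (aStar ω) r) ∂ℙr ≠ ∞ :=
    ne_top_of_le_ne_top hfin (lintegral_mono fun ω => hφ' _)
  have hq : Measurable[P.limitInfo θ U d] fun ω => P.limitDensity d s ω r :=
    @measurable_limitDensity_left _ _ _ _ _ P Ω (P.limitInfo θ U d) _
      (measurable_d_limitInfo θ U d) s r
  have h1 := condExp_eq_self_of_eqOn (μ := ℙr) h.limitInfo_le (h.measurableSet_frequently s)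
    (Z := fun ω => (φ (P.lik s (aStar ω) r)).toReal)
    (Z' := fun ω => (φ (P.limitDensity d s ω r)).toReal)
    (integrable_toReal_of_lintegral_ne_top (hg.comp h.aStar_measurable).aemeasurable hfin')
    (hφ.comp hq).ennreal_toReal (hr.mono fun ω hω hωB => by rw [hω hωB])
  filter_upwards [h.tendsto_lintegral_posterior hg hfin', h1] with ω h2 h3 hω
  rw [h3 hω, ENNReal.ofReal_toReal (ne_top_of_le_ne_top ENNReal.coe_ne_top (hφ' _))] at h2
  exact h2

/-- For `c` below the likelihood at `aStar`, the predictive density eventually exceeds `c`, so the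
overlap is at least the posterior integral of the likelihood truncated at `c`, which tends to `c`.
Rational levels keep the exceptional set null. -/
theorem lik_le_liminf_overlap (s : Fin N) : ∀ᵐ r ∂(P.ref s), ∀ᵐ ω ∂ℙr,
    (∃ᶠ t in atTop, P.action (d t ω) = .inr s) →
      (P.lik s (aStar ω) r : ℝ≥0∞) ≤ liminf (fun t => P.overlap (P.srcHist d t ω) s r) atTop := by
  filter_upwards [h.lik_ae_eq_limitDensity s, h.ae_lintegral_lik_ne_top s] with r hr hfin
  have h1 := h.tendsto_lintegral_posterior_of_frequently s hr measurable_id (fun x => le_rfl) hfin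
  have h2 : ∀ c : ℚ, _ := fun c => h.tendsto_lintegral_posterior_of_frequently s hr
    (φ := fun x => min x ((c : ℝ).toNNReal : ℝ≥0∞)) (by fun_prop) (fun x => min_le_left _ _) hfin
  filter_upwards [h1, ae_all_iff.2 h2] with ω h3 h4 hω
  refine le_of_forall_lt fun b hb => ?_
  obtain ⟨c, -, hbc, hc⟩ := ENNReal.lt_iff_exists_rat_btwn.1 hb
  -- A second level below `c` is needed because the truncated integrals only converge to `c`.
  obtain ⟨c', -, hbc', hc'⟩ := ENNReal.lt_iff_exists_rat_btwn.1 hbc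
  refine hbc'.trans_le (le_liminf_of_le (by isBoundedDefault) ?_)
  have h5 : ∀ᶠ t in atTop, ((c : ℝ).toNNReal : ℝ≥0∞) < P.predDensity (P.srcHist d t ω) s r :=
    (h3 hω).eventually_const_lt hc
  have h6 := h4 c hω
  rw [min_eq_right hc.le] at h6
  filter_upwards [h5, h6.eventually_const_lt hc'] with t h7 h8
  exact h8.le.trans (lintegral_mono fun a => min_le_min_left _ h7.le)

/-- Fatou's lemma bounds the liminf below by the total mass of the true data density, which is one;
the overlap never exceeds the predictive density, of mass at most one. -/
theorem tendsto_lintegral_overlap (s : Fin N) : ∀ᵐ ω ∂ℙr,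
    (∃ᶠ t in atTop, P.action (d t ω) = .inr s) →
      Tendsto (fun t => ∫⁻ r, P.overlap (P.srcHist d t ω) s r ∂(P.ref s)) atTop (𝓝 1) := by
  set B := {ω | ∃ᶠ t in atTop, P.action (d t ω) = .inr s} with hB
  have hBm : MeasurableSet B := h.limitInfo_le _ (h.measurableSet_frequently s)
  have hm := fun t => measurable_overlap_srcHist h.d_measurable s t
  have hset : MeasurableSet {p : R × Ω | p.2 ∈ B → (P.lik s (aStar p.2) p.1 : ℝ≥0∞)
      ≤ liminf (fun t => P.overlap (P.srcHist d t p.2) s p.1) atTop} := by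
    have h1 : Measurable fun p : R × Ω => (P.lik s (aStar p.2) p.1 : ℝ≥0∞) :=
      (measurable_lik_comp h.aStar_measurable s).comp measurable_swap
    exact MeasurableSet.imp (p := fun p : R × Ω => p.2 ∈ B) (measurable_snd hBm)
      (measurableSet_le h1 (measurable_liminf_overlap h.d_measurable s))
  have h1 := (Measure.ae_ae_comm (p := fun r ω => ω ∈ B → (P.lik s (aStar ω) r : ℝ≥0∞)
      ≤ liminf (fun t => P.overlap (P.srcHist d t ω) s r) atTop) hset).1 (h.lik_le_liminf_overlap s)
  filter_upwards [h1] with ω h2 hω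
  have hmω : ∀ t, Measurable fun r => P.overlap (P.srcHist d t ω) s r := fun t => by
    have h3 := (hm t).comp (f := fun r : R => (ω, r)) (by fun_prop)
    simpa only [Function.comp_def] using h3
  refine tendsto_of_le_liminf_of_limsup_le ?_ ?_
  · calc (1 : ℝ≥0∞) = ∫⁻ r, P.lik s (aStar ω) r ∂(P.ref s) := (P.lik_prob s _).symm
      _ ≤ ∫⁻ r, liminf (fun t => P.overlap (P.srcHist d t ω) s r) atTop ∂(P.ref s) :=
        lintegral_mono_ae (h2.mono fun r hr => hr hω)
      _ ≤ liminf (fun t => ∫⁻ r, P.overlap (P.srcHist d t ω) s r ∂(P.ref s)) atTop :=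
        lintegral_liminf_le hmω
  · refine limsup_le_of_le (by isBoundedDefault) (Eventually.of_forall fun t => ?_)
    calc ∫⁻ r, P.overlap (P.srcHist d t ω) s r ∂(P.ref s)
        ≤ ∫⁻ r, P.predDensity (P.srcHist d t ω) s r ∂(P.ref s) :=
        lintegral_mono fun r => lintegral_mono fun a => min_le_left _ _
      _ ≤ 1 := (lintegral_predDensity _ s).trans_le (P.posterior_univ_le _)

end IsRun

end Problem

/-! ### The value of a source query in terms of the overlap -/

namespace Problem

variable {D J N : ℕ} {R : Type*} [MeasurableSpace R] {P : Problem D J N R}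

theorem overlap_le (Rm : List (Fin N × R)) (s : Fin N) (r : R) :
    P.overlap Rm s r ≤ P.predDensity Rm s r :=
  lintegral_mono fun _ => min_le_left _ _

theorem withDensity_lik_posterior (Rm : List (Fin N × R)) (s : Fin N) {r : R}
    (hq : P.predDensity Rm s r ≠ ∞) :
    (P.posterior Rm).withDensity (fun a => (P.lik s a r : ℝ≥0∞))
      = P.predDensity Rm s r • P.posterior ((s, r) :: Rm) := by
  ext C hC
  rw [withDensity_apply _ hC, Measure.smul_apply, smul_eq_mul, mul_comm,
    posterior_cons_mul_predDensity Rm s hq hC]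

/-- `|x - q| = x + q - 2 * min x q`, and `q` is itself the posterior mean of the likelihood. -/
theorem integral_abs_lik_sub_predDensity {Rm : List (Fin N × R)} (hp : P.posterior Rm Set.univ = 1)
    (s : Fin N) {r : R} (hq : P.predDensity Rm s r ≠ ∞) :
    ∫ a, |(P.lik s a r : ℝ) - (P.predDensity Rm s r).toReal| ∂(P.posterior Rm)
      = 2 * ((P.predDensity Rm s r).toReal - (P.overlap Rm s r).toReal) := by
  have : IsProbabilityMeasure (P.posterior Rm) := ⟨hp⟩
  set q := P.predDensity Rm s r with hqdef
  have hl : Integrable (fun a => (P.lik s a r : ℝ≥0∞).toReal) (P.posterior Rm) :=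
    integrable_toReal_of_lintegral_ne_top (measurable_lik s r).aemeasurable hq
  have ho : P.overlap Rm s r ≠ ∞ := ne_top_of_le_ne_top hq (overlap_le Rm s r)
  have hom : Measurable fun a => min (P.lik s a r : ℝ≥0∞) q := (measurable_lik s r).min measurable_const
  have hmin : Integrable (fun a => (min (P.lik s a r : ℝ≥0∞) q).toReal) (P.posterior Rm) :=
    integrable_toReal_of_lintegral_ne_top hom.aemeasurable ho
  have e : ∀ a, |(P.lik s a r : ℝ) - q.toReal|
      = (P.lik s a r : ℝ≥0∞).toReal + q.toReal - 2 * (min (P.lik s a r : ℝ≥0∞) q).toReal := fun a => by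
    rw [ENNReal.toReal_min ENNReal.coe_ne_top hq, ENNReal.coe_toReal]
    rcases le_total (P.lik s a r : ℝ) q.toReal with h1 | h1
    · rw [min_eq_left h1, abs_of_nonpos (sub_nonpos.2 h1)]
      ring
    · rw [min_eq_right h1, abs_of_nonneg (sub_nonneg.2 h1)]
      ring
  simp only [e]
  have hlq : Integrable (fun a => (P.lik s a r : ℝ≥0∞).toReal + q.toReal) (P.posterior Rm) :=
    hl.add (integrable_const _)
  rw [integral_sub hlq (hmin.const_mul 2), integral_add hl
    (integrable_const _), integral_const_mul, integral_const, probReal_univ, one_smul,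
    integral_toReal hom.aemeasurable (ae_of_all _ fun a => min_lt_of_left_lt ENNReal.coe_lt_top),
    integral_toReal (measurable_lik s r).aemeasurable (ae_of_all _ fun a => ENNReal.coe_lt_top)]
  change q.toReal + q.toReal - 2 * (P.overlap Rm s r).toReal = _
  ring

/-- By Bayes' rule, `q` times the change of `G` is the posterior integral of the posterior mean
function against `lik - q`, hence at most `M` times the posterior `L¹` distance of the likelihood
from `q`. The factor `q` is also the density of the predictive law used in `VoI`. -/
theorem predDensity_mul_abs_Gmax_sub_le {Rm : List (Fin N × R)}
    (hp : P.posterior Rm Set.univ = 1) {F : List (P.Point × ℝ)} {M : ℝ}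
    (hM : ∀ z, |P.mean F z| ≤ M) (s : Fin N) {r : R} (hq : P.predDensity Rm s r ≠ ∞) :
    (P.predDensity Rm s r).toReal * |P.Gmax ((s, r) :: Rm) F - P.Gmax Rm F|
      ≤ 2 * M * ((P.predDensity Rm s r).toReal - (P.overlap Rm s r).toReal) := by
  set q := P.predDensity Rm s r with hqdef
  have hoq : (P.overlap Rm s r).toReal ≤ q.toReal := ENNReal.toReal_mono hq (overlap_le Rm s r)
  have hM0 : 0 ≤ M := (abs_nonneg _).trans (hM (Classical.arbitrary _))
  rcases eq_or_ne q 0 with h0 | h0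
  · rw [h0, ENNReal.toReal_zero] at hoq ⊢
    rw [le_antisymm hoq ENNReal.toReal_nonneg]
    simp
  have hq0 : 0 < q.toReal := ENNReal.toReal_pos h0 hq
  rw [← le_div_iff₀' hq0]
  refine abs_ciSup_sub_ciSup_le fun x => ?_
  rw [le_div_iff₀' hq0]
  set f : P.A → ℝ := fun a => P.mean F (x, a) with hf
  have hfc : Continuous f := (P.continuous_mean F).comp (by fun_prop)
  have hfb : ∀ a, |f a| ≤ M := fun a => hM _
  have hi := P.integrable_posterior hfc Rm
  have hl : Integrable (fun a => (P.lik s a r : ℝ≥0∞).toReal) (P.posterior Rm) :=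
    integrable_toReal_of_lintegral_ne_top (measurable_lik s r).aemeasurable hq
  simp only [ENNReal.coe_toReal] at hl
  have hlf : Integrable (fun a => (P.lik s a r : ℝ) * f a) (P.posterior Rm) :=
    hl.mul_bdd hfc.aestronglyMeasurable (ae_of_all _ hfb)
  have e1 : q.toReal * P.G ((s, r) :: Rm) F x = ∫ a, (P.lik s a r : ℝ) * f a ∂(P.posterior Rm) := by
    have h1 := congrArg (fun ν => ∫ a, f a ∂ν) (withDensity_lik_posterior Rm s hq)
    simp only [integral_smul_measure] at h1
    have hm : Measurable fun a => P.lik s a r :=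
      (P.lik_measurable s).comp (f := fun a => (a, r)) (by fun_prop)
    rw [integral_withDensity_eq_integral_smul hm] at h1
    exact h1.symm
  have e2 : q.toReal * (P.G ((s, r) :: Rm) F x - P.G Rm F x)
      = ∫ a, ((P.lik s a r : ℝ) - q.toReal) * f a ∂(P.posterior Rm) := by
    simp only [sub_mul]
    rw [mul_sub, e1, integral_sub hlf (hi.const_mul _), integral_const_mul]
    rfl
  have : IsProbabilityMeasure (P.posterior Rm) := ⟨hp⟩
  calc q.toReal * |P.G ((s, r) :: Rm) F x - P.G Rm F x|
      = |∫ a, ((P.lik s a r : ℝ) - q.toReal) * f a ∂(P.posterior Rm)| := by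
        rw [← e2, abs_mul, abs_of_pos hq0]
    _ ≤ ∫ a, |(P.lik s a r : ℝ) - q.toReal| * M ∂(P.posterior Rm) := by
        have hlq : Integrable (fun a => (P.lik s a r : ℝ) - q.toReal) (P.posterior Rm) :=
          hl.sub (integrable_const _)
        rw [← Real.norm_eq_abs]
        refine norm_integral_le_of_norm_le (hlq.abs.mul_const M) (ae_of_all _ fun a => ?_)
        rw [Real.norm_eq_abs, abs_mul]
        exact mul_le_mul_of_nonneg_left (hfb a) (abs_nonneg _)
    _ = _ := by
        rw [integral_mul_const, integral_abs_lik_sub_predDensity hp s hq]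
        ring

theorem ofReal_abs_VoI_inr_le {L : List P.Datum} (hp : P.posterior (P.srcData L) Set.univ = 1)
    {M : ℝ} (hM : ∀ z, |P.mean (P.simData L) z| ≤ M) (s : Fin N) :
    ENNReal.ofReal |P.VoI L (.inr s)| ≤ ENNReal.ofReal (2 * M / P.costSrc s)
      * (1 - ∫⁻ r, P.overlap (P.srcData L) s r ∂(P.ref s)) := by
  set Rm := P.srcData L with hRm
  set F := P.simData L with hF
  have hc := P.costSrc_pos s
  have hM0 : 0 ≤ M := (abs_nonneg _).trans (hM (Classical.arbitrary _))
  have hqm : Measurable fun r => P.predDensity Rm s r :=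
    ((P.lik_measurable s).comp measurable_swap).coe_nnreal_ennreal.lintegral_prod_right'
  have hom : Measurable fun r => P.overlap Rm s r :=
    Measurable.lintegral_prod_right' (f := fun p : R × P.A =>
      min (P.lik s p.2 p.1 : ℝ≥0∞) (P.predDensity Rm s p.1))
      (((P.lik_measurable s).comp measurable_swap).coe_nnreal_ennreal.min
        (hqm.comp measurable_fst))
  have hq1 : ∫⁻ r, P.predDensity Rm s r ∂(P.ref s) = 1 := (lintegral_predDensity Rm s).trans hp
  have ho1 : ∫⁻ r, P.overlap Rm s r ∂(P.ref s) ≠ ∞ := ne_top_of_le_ne_top ENNReal.one_ne_top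
    ((lintegral_mono fun r => overlap_le Rm s r).trans_eq hq1)
  rw [← Real.enorm_eq_ofReal_abs]
  change ‖∫ r, (P.Gmax ((s, r) :: Rm) F - P.Gmax Rm F) / P.costSrc s
    ∂((P.ref s).withDensity fun r => P.predDensity Rm s r)‖ₑ ≤ _
  refine (enorm_integral_le_lintegral_enorm _).trans
    -- Only inequalities are used up to here, so measurability of `Gmax` in `r` is not required.
    ((lintegral_withDensity_le_lintegral_mul _ hqm _).trans ?_)
  rw [← hq1, ← lintegral_sub hom ho1 (ae_of_all _ fun r => overlap_le Rm s r),
    ← lintegral_const_mul' _ _ ENNReal.ofReal_ne_top]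
  refine lintegral_mono_ae ?_
  filter_upwards [ae_predDensity_ne_top Rm s] with r hq
  have ho := ne_top_of_le_ne_top hq (overlap_le Rm s r)
  rw [Pi.mul_apply, Real.enorm_eq_ofReal_abs, abs_div, abs_of_pos hc, ← ENNReal.ofReal_toReal hq,
    ← ENNReal.ofReal_toReal ho, ← ENNReal.ofReal_sub _ ENNReal.toReal_nonneg,
    ← ENNReal.ofReal_mul ENNReal.toReal_nonneg, ← ENNReal.ofReal_mul (by positivity)]
  refine ENNReal.ofReal_le_ofReal ?_
  rw [← mul_div_assoc, div_mul_eq_mul_div]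
  exact div_le_div_of_nonneg_right (predDensity_mul_abs_Gmax_sub_le hp hM s hq) hc.le

theorem IsRun.tendsto_VoI_inr {Ω E : Type*} [MeasurableSpace Ω] [MeasurableSpace E] {ℙr : Measure Ω}
    [IsProbabilityMeasure ℙr] {θ : P.Point → Ω → ℝ} {aStar : Ω → P.A} {U : Ω → E}
    {d : ℕ → Ω → P.Datum} (h : P.IsRun ℙr θ aStar U d) (s : Fin N) :
    ∀ᵐ ω ∂ℙr, (∃ᶠ t in atTop, P.action (d t ω) = .inr s) →
      Tendsto (fun t => P.VoI (P.history (fun i => d i ω) t) (.inr s)) atTop (𝓝 0) := by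
  filter_upwards [h.ae_exists_bound_mean, h.ae_posterior_univ, h.tendsto_lintegral_overlap s]
    with ω ⟨M, hM⟩ hp ho hω
  have h1 : Tendsto (fun t => ENNReal.ofReal (2 * M / P.costSrc s)
      * (1 - ∫⁻ r, P.overlap (P.srcHist d t ω) s r ∂(P.ref s))) atTop (𝓝 0) := by
    have h2 := ENNReal.Tendsto.const_mul (a := ENNReal.ofReal (2 * M / P.costSrc s))
      (ENNReal.Tendsto.sub tendsto_const_nhds (ho hω) (.inl ENNReal.one_ne_top))
      (.inr ENNReal.ofReal_ne_top)
    simpa using h2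
  have h3 := tendsto_of_tendsto_of_tendsto_of_le_of_le tendsto_const_nhds h1
    (fun t => zero_le) fun t => ofReal_abs_VoI_inr_le (hp t) (hM t) s
  have h4 := (ENNReal.tendsto_toReal ENNReal.zero_ne_top).comp h3
  simp only [Function.comp_def, ENNReal.toReal_ofReal (abs_nonneg _), ENNReal.toReal_zero] at h4
  exact (tendsto_zero_iff_abs_tendsto_zero _).2 h4

end Problem

end BICO

end

theorem mainTheorem1 {D J N : ℕ} {R : Type*} [MeasurableSpace R] (P : BICO.Problem D J N R)
    {Ω E : Type*} [MeasurableSpace Ω] [MeasurableSpace E] (ℙr : Measure Ω) [IsProbabilityMeasure ℙr]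
    (θ : P.Point → Ω → ℝ) (aStar : Ω → P.A) (U : Ω → E) (d : ℕ → Ω → P.Datum)
    (hrun : P.IsRun ℙr θ aStar U d) :
    ∀ᵐ ω ∂ℙr,
      (∀ (x' : P.X) (a' : P.A), (∃ᶠ t in atTop, P.action (d t ω) = .inl (x', a')) →
        Tendsto (fun t => P.VoI (P.history (fun i => d i ω) t) (.inl (x', a'))) atTop (𝓝 0)) ∧
      (∀ s : Fin N, (∃ᶠ t in atTop, P.action (d t ω) = .inr s) →
        Tendsto (fun t => P.VoI (P.history (fun i => d i ω) t) (.inr s)) atTop (𝓝 0)) := by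
  -- Null sets arise only from the finitely many sources; the possibly uncountable family of
  -- simulation points is handled on every path.
  filter_upwards [ae_all_iff.2 hrun.tendsto_VoI_inr] with ω hω
  exact ⟨fun x' a' h => P.tendsto_VoI_inl hrun.isCovKernel (fun i => d i ω) (x', a') h, hω⟩
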